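/- Let $\Lambda=2\pi\mathbb Z+2\pi i\mathbb Z$ be the square lattice with periods $2\pi$ and $2\pi i$. For $\tau$ in the upper half-plane $\mathbb H$ put $h=h(\tau)=e^{\pi i\tau}$ and let $$\theta_2=2h^{1/4}\sum_{n\ge 0}h^{n(n+1)}=2h^{1/4}(1+h^2+h^6+h^{12}+\cdots),\qquad \theta_3=1+2\sum_{n\ge1}h^{n^2}=1+2h+2h^4+2h^9+\cdots$$ (principal branch of $h^{1/4}$), and let $\kappa^2(\tau)=(\theta_2/\theta_3)^4$ be Jacobi's modular function. For $w\in\mathbb C\setminus((-\infty,0]\cup[1,\infty))$ let $$g(w)=C\int_0^w\zeta^{-3/4}(1-\zeta)^{-3/4}\,d\zeta,\qquad C=\frac{2\pi\sqrt2}{B(1/4,1/4)},$$ with principal branches and integration along the segment from $0$ to $w$, where $B$ is Euler's Beta function. Let $Q_1=\{\tau\in\mathbb H:\ |\mathrm{Re}\,\tau|<1,\ |\tau-\tfrac12|>\tfrac12,\ |\tau+\tfrac12|>\tfrac12\}$ be the hyperbolic quadrilateral with zero angles and vertices $-1,0,1,\infty$. Then: 1. $\kappa^2(i)=\tfrac12$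 and $g'(1/2)=C\cdot 2^{3/2}$. 2. On $Q_1$, $$\frac{d}{d\tau}\kappa^2=4\,\theta_2^3\,\theta_3^{-5}\,(\theta_2'\theta_3-\theta_2\theta_3')\,\frac{dh}{d\tau},\qquad \frac{dh}{d\tau}=\pi i h,$$ where $'$ on $\theta_2,\theta_3$ denotes $d/dh$ (both derivatives exist); at $\tau=i$ one has $h=e^{-\pi}$. 3. There is a holomorphic universal covering $f$ of $\mathbb C\setminus\Lambda$ by the unit disc with $f(0)=\pi+\pi i$, and every such $f$ satisfies: (a) there is a constant $c$ with $|c|=1$ such that $f\bigl(c\,\tfrac{\tau-i}{\tau+i}\bigr)=e^{\pi i/4}\,g(\kappa^2(\tau))$ for all $\tau\in Q_1$; that is, up to rotations of the disc and of the plane, $f_1=g\circ\kappa^2$ on $Q_1$, where $f_1$ is $f$ transported to the upper half-plane with $\tau=i$ corresponding to $0$; (b) $|f'(0)|=2\,|(\kappa^2)'(i)|\cdot g'(1/2)$; (c) $|f'(0)|\approx 7.416$, precisely $\bigl||f'(0)|-7.416\bigr|<0.0005$. -/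

import Mathlib

open Complex Set

noncomputable section

/-- The rectangular lattice with periods `2ω = 2πk` and `2ω' = 2πi` (so that `k = ln K / (2π)`);
for `k = 1` it is the square lattice. -/
def rectLattice (k : ℝ) : Set ℂ :=
  {z | ∃ m n : ℤ, z = m * (2 * Real.pi * k) + n * (2 * Real.pi * I)}

/-- The centre `ω + ω'` of the fundamental rectangle with corners `0, 2ω, 2ω + 2ω', 2ω'`. -/
def rectCenter (k : ℝ) : ℂ := Real.pi * k + Real.pi * I

/-- `f` restricts to a holomorphic covering map of the open unit disc onto `U`
(a universal covering, since the disc is simply connected). -/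
structure IsUniversalCover (f : ℂ → ℂ) (U : Set ℂ) : Prop where
  differentiableOn : DifferentiableOn ℂ f (Metric.ball 0 1)
  mapsTo : MapsTo f (Metric.ball 0 1) U
  surjOn : SurjOn f (Metric.ball 0 1) U
  isCoveringMap : IsCoveringMap (mapsTo.restrict f (Metric.ball 0 1) U)

/-- The nome `h = exp(πiτ)`. -/
def nome (τ : ℂ) : ℂ := exp (Real.pi * I * τ)

/-- `θ₂ = 2 h^{1/4} (1 + h² + h⁶ + h¹² + ⋯)` as a function of `h`, principal branch. -/
def thetaTwo (h : ℂ) : ℂ := 2 * h ^ (1 / 4 : ℂ) * ∑' n : ℕ, h ^ (n * (n + 1))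

/-- `θ₃ = 1 + 2h + 2h⁴ + 2h⁹ + ⋯` as a function of `h`. -/
def thetaThree (h : ℂ) : ℂ := 1 + 2 * ∑' n : ℕ, h ^ ((n + 1) ^ 2)

/-- Jacobi's modular function `κ² = (θ₂ / θ₃)⁴` on the upper half-plane.
The fourth power makes the choice of the branch of `h^{1/4}` irrelevant. -/
def kappaSq (τ : ℂ) : ℂ := (thetaTwo (nome τ) / thetaThree (nome τ)) ^ 4

/-- The constant `C = 2π√2 / B(1/4, 1/4)`. -/
def scConst : ℂ := 2 * Real.pi * Real.sqrt 2 / betaIntegral (1 / 4) (1 / 4)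

/-- `g(w) = C ∫₀ʷ ζ^{-3/4} (1 - ζ)^{-3/4} dζ`, the integral being along the segment `ζ = t w`,
`0 ≤ t ≤ 1`, with principal branches; it is holomorphic off `(-∞, 0] ∪ [1, ∞)`. -/
def scMap (w : ℂ) : ℂ :=
  scConst * ∫ t in (0 : ℝ)..1,
    ((t : ℂ) * w) ^ (-3 / 4 : ℂ) * (1 - (t : ℂ) * w) ^ (-3 / 4 : ℂ) * w

/-- The open hyperbolic quadrilateral with zero angles and vertices `-1, 0, 1, ∞`: the ideal
triangle `0, 1, ∞` together with its reflection in the imaginary axis and their common side. -/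
def quadQ : Set ℂ :=
  {τ | 0 < τ.im ∧ |τ.re| < 1 ∧ 1 / 2 < ‖τ - 1 / 2‖ ∧ 1 / 2 < ‖τ + 1 / 2‖}

end

namespace KappaCover

open Filter Topology
open scoped Real Interval

/-! ### Lacunary power series -/

/-! Jacobi's identity `θ₂⁴ + θ₄⁴ = θ₃⁴` gives `1 - κ² = (θ₄/θ₃)⁴`, and `(κ²)' = πi κ² θ₄⁴`. Hence
the derivative of `g ∘ κ²` is a constant times `θ₂ θ₃² θ₄`, a weight two form without zeros on the
whole half-plane. So `e^{πi/4} g ∘ κ²` continues from `Q₁` to a locally injective function `dev` on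
the half-plane, with `dev i = π + πi` because `g(1/2)` is half of a complete Beta integral times
`C`.

The transformation laws of the theta constants give `dev (-1/τ) = 2π + 2πi - dev τ` and `dev (τ + 2)
= i dev τ`. Up to rotations by multiples of a quarter turn and lattice translations, the full
modular group therefore permutes three functions, `dev τ`, `dev (τ + 1)` and `devCusp τ = dev (1 -
1/τ)`, one for each coset of the theta group (`dev_induction`). Any property invariant under these
motions need only be checked for the three functions on `|Re τ| ≤ 1/2`, `Im τ ≥ √3/2`.

There the leading exponential dominates: the functions tend to the lattice points `0` and `2πi` at
the cusp, never attain them, and stay within `2π` of them, so `dev` omits the lattice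
(`dev_notMem_lattice`). Where the values keep a distance `δ` from the lattice, the imaginary part is
bounded; compactness yields local inverses on balls of one radius depending on `δ` alone
(`exists_hasBallSection_dev`). Uniform local sections make `dev`, transported to the disc as
`discMap`, a covering (`isEvenlyCovered_of_hasSections`). Lifting one covering through another and
the Schwarz lemma show that every other normalized covering is `discMap` after a rotation, which
gives (a) and (b).

For the number in (c), `|f'(0)| = 8π² |θ₄(i)|⁴ / B(1/4, 1/4)`. The Beta value comes from the same
developing map: expanding `dev` in the nome at `i` and comparing with `dev i = π + πi` encloses it
(`betaQ_bounds`). -/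

theorem norm_tsum_pow_sub_sum_le {a : ℕ → ℕ} (ha : StrictMono a) {h : ℂ} (hh : ‖h‖ < 1) (N : ℕ) :
    ‖∑' n, h ^ a n - ∑ n ∈ Finset.range N, h ^ a n‖ ≤ ‖h‖ ^ a N / (1 - ‖h‖) := by
  have hs : Summable fun n => h ^ a n := by
    refine Summable.of_norm_bounded (summable_geometric_of_lt_one (norm_nonneg h) hh) fun n => ?_
    rw [norm_pow]
    exact pow_le_pow_of_le_one (norm_nonneg _) hh.le (ha.id_le n)
  rw [← hs.sum_add_tsum_nat_add N, add_sub_cancel_left]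
  have hg := (hasSum_geometric_of_lt_one (norm_nonneg h) hh).mul_left (‖h‖ ^ a N)
  refine (tsum_of_norm_bounded hg fun n => ?_).trans_eq (div_eq_mul_inv _ _).symm
  rw [norm_pow, ← pow_add]
  -- Strictly increasing exponents grow by at least one per step, so `a N + n ≤ a (n + N)` and a
  -- geometric series dominates the tail.
  refine pow_le_pow_of_le_one (norm_nonneg _) hh.le ?_
  induction n with
  | zero => simp
  | succ n ih =>
    have := ha (show n + N < n + 1 + N by omega)
    omega

theorem differentiableOn_tsum_pow {a : ℕ → ℕ} (ha : StrictMono a) :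
    DifferentiableOn ℂ (fun h : ℂ => ∑' n, h ^ a n) (Metric.ball 0 1) := by
  intro h hh
  rw [mem_ball_zero_iff] at hh
  obtain ⟨r, hr, hr1⟩ := exists_between hh
  have hr0 : 0 ≤ r := (norm_nonneg h).trans hr.le
  have : DifferentiableOn ℂ (fun h : ℂ => ∑' n, h ^ a n) (Metric.ball 0 r) := by
    refine differentiableOn_tsum_of_summable_norm (summable_geometric_of_lt_one hr0 hr1)
      (fun n => (differentiable_id.pow _).differentiableOn) Metric.isOpen_ball fun n w hw => ?_
    rw [mem_ball_zero_iff] at hw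
    rw [norm_pow]
    exact (pow_le_pow_left₀ (norm_nonneg _) hw.le _).trans
      (pow_le_pow_of_le_one hr0 hr1.le (ha.id_le n))
  exact (this.differentiableAt
    (Metric.isOpen_ball.mem_nhds (by simpa using hr))).differentiableWithinAt

theorem strictMono_mul_succ : StrictMono fun n : ℕ => n * (n + 1) :=
  strictMono_nat_of_lt_succ fun n => by nlinarith

theorem strictMono_succ_sq : StrictMono fun n : ℕ => (n + 1) ^ 2 :=
  fun _ _ h => Nat.pow_lt_pow_left (Nat.succ_lt_succ h) two_ne_zero

/-- The series `1 + h² + h⁶ + h¹² + ⋯`. -/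
noncomputable def thetaP (h : ℂ) : ℂ := ∑' n : ℕ, h ^ (n * (n + 1))

theorem differentiableAt_thetaP {h : ℂ} (hh : ‖h‖ < 1) : DifferentiableAt ℂ thetaP h :=
  (differentiableOn_tsum_pow strictMono_mul_succ).differentiableAt
    (Metric.isOpen_ball.mem_nhds (by simpa using hh))

theorem differentiableAt_thetaThree {h : ℂ} (hh : ‖h‖ < 1) : DifferentiableAt ℂ thetaThree h :=
  (((differentiableOn_tsum_pow strictMono_succ_sq).differentiableAt
    (Metric.isOpen_ball.mem_nhds (by simpa using hh))).const_mul 2).const_add 1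

theorem norm_thetaP_sub_one_le {h : ℂ} (hh : ‖h‖ < 1) :
    ‖thetaP h - 1‖ ≤ ‖h‖ ^ 2 / (1 - ‖h‖) := by
  simpa [thetaP] using norm_tsum_pow_sub_sum_le strictMono_mul_succ hh 1

theorem norm_thetaP_sub_le {h : ℂ} (hh : ‖h‖ < 1) :
    ‖thetaP h - (1 + h ^ 2)‖ ≤ ‖h‖ ^ 6 / (1 - ‖h‖) := by
  simpa [thetaP, Finset.sum_range_succ] using norm_tsum_pow_sub_sum_le strictMono_mul_succ hh 2

theorem norm_thetaThree_sub_le {h : ℂ} (hh : ‖h‖ < 1) :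
    ‖thetaThree h - (1 + 2 * h + 2 * h ^ 4)‖ ≤ 2 * (‖h‖ ^ 9 / (1 - ‖h‖)) := by
  have := norm_tsum_pow_sub_sum_le strictMono_succ_sq hh 2
  norm_num [Finset.sum_range_succ] at this
  have e : thetaThree h - (1 + 2 * h + 2 * h ^ 4)
      = 2 * (∑' n : ℕ, h ^ ((n + 1) ^ 2) - (h + h ^ 4)) := by
    rw [thetaThree]; ring
  rw [e, norm_mul, Complex.norm_ofNat]
  gcongr

theorem norm_thetaThree_sub_le' {h : ℂ} (hh : ‖h‖ < 1) :
    ‖thetaThree h - (1 + 2 * h)‖ ≤ 2 * (‖h‖ ^ 4 / (1 - ‖h‖)) := by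
  have := norm_tsum_pow_sub_sum_le strictMono_succ_sq hh 1
  norm_num at this
  have e : thetaThree h - (1 + 2 * h) = 2 * (∑' n : ℕ, h ^ ((n + 1) ^ 2) - h) := by
    rw [thetaThree]; ring
  rw [e, norm_mul, Complex.norm_ofNat]
  gcongr

/-! ### The nome -/

theorem norm_nome (τ : ℂ) : ‖nome τ‖ = Real.exp (-(π * τ.im)) := by
  rw [nome, norm_exp]; congr 1; simp

theorem norm_nome_lt_one {τ : ℂ} (hτ : 0 < τ.im) : ‖nome τ‖ < 1 := by
  rw [norm_nome, Real.exp_lt_one_iff]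
  have := mul_pos Real.pi_pos hτ
  linarith

theorem nome_ne_zero (τ : ℂ) : nome τ ≠ 0 := exp_ne_zero _

theorem hasDerivAt_nome (τ : ℂ) : HasDerivAt nome (π * I * nome τ) τ := by
  have h : HasDerivAt (fun x : ℂ => cexp (π * I * x)) (cexp (π * I * τ) * (π * I * 1)) τ :=
    ((hasDerivAt_id τ).const_mul (π * I : ℂ)).cexp
  rw [mul_one, mul_comm (cexp _)] at h
  exact h

theorem nome_add_one (τ : ℂ) : nome (τ + 1) = -nome τ := by
  rw [nome, nome, mul_add, mul_one, exp_add, exp_pi_mul_I]; ring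

theorem tendsto_nome : Tendsto nome (comap im atTop) (𝓝 0) := by
  rw [tendsto_zero_iff_norm_tendsto_zero]
  have : Tendsto (fun y : ℝ => Real.exp (-(π * y))) atTop (𝓝 0) :=
    Real.tendsto_exp_neg_atTop_nhds_zero.comp (tendsto_id.const_mul_atTop Real.pi_pos)
  exact (this.comp tendsto_comap).congr fun τ => (norm_nome τ).symm

/-! ### The theta constants -/

/-- `θ₂` as a function on the upper half-plane. -/
noncomputable def th2 (τ : ℂ) : ℂ := 2 * exp (π * I * τ / 4) * thetaP (nome τ)

/-- `θ₃` as a function on the upper half-plane. -/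
noncomputable def th3 (τ : ℂ) : ℂ := thetaThree (nome τ)

/-- `θ₄` as a function on the upper half-plane. -/
noncomputable def th4 (τ : ℂ) : ℂ := thetaThree (-nome τ)

theorem th3_add_one (τ : ℂ) : th3 (τ + 1) = th4 τ := by rw [th3, nome_add_one, th4]

theorem th4_add_one (τ : ℂ) : th4 (τ + 1) = th3 τ := by rw [th3, th4, nome_add_one, neg_neg]

theorem thetaP_neg (h : ℂ) : thetaP (-h) = thetaP h := by
  unfold thetaP
  exact tsum_congr fun n => (Nat.even_mul_succ_self n).neg_pow h

theorem th2_add_one (τ : ℂ) : th2 (τ + 1) = exp (π * I / 4) * th2 τ := by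
  rw [th2, nome_add_one, thetaP_neg, th2, show (π * I * (τ + 1) / 4 : ℂ) = π * I / 4 + π * I * τ / 4
    by ring, exp_add]
  ring

theorem differentiableAt_th2 {τ : ℂ} (hτ : 0 < τ.im) : DifferentiableAt ℂ th2 τ := by
  unfold th2
  have h1 := (differentiableAt_thetaP (norm_nome_lt_one hτ)).comp τ
    (hasDerivAt_nome τ).differentiableAt
  exact (by fun_prop : DifferentiableAt ℂ (fun τ : ℂ => 2 * exp (π * I * τ / 4)) τ).mul h1

theorem differentiableAt_th3 {τ : ℂ} (hτ : 0 < τ.im) : DifferentiableAt ℂ th3 τ :=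
  (differentiableAt_thetaThree (norm_nome_lt_one hτ)).comp τ (hasDerivAt_nome τ).differentiableAt

theorem differentiableAt_th4 {τ : ℂ} (hτ : 0 < τ.im) : DifferentiableAt ℂ th4 τ :=
  (differentiableAt_thetaThree (by simpa using norm_nome_lt_one hτ)).comp τ
    (hasDerivAt_nome τ).differentiableAt.neg

theorem th3_eq_jacobiTheta₂ {τ : ℂ} (hτ : 0 < τ.im) : th3 τ = jacobiTheta₂ 0 τ := by
  rw [← jacobiTheta_eq_jacobiTheta₂, jacobiTheta_eq_tsum_nat hτ, th3, thetaThree]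
  congr 2
  refine tsum_congr fun n => ?_
  rw [nome, ← exp_nat_mul]; push_cast; ring_nf

/-- Since `n² ≡ n` modulo 2, the shift `τ ↦ τ + 1` has the same effect on each term as moving the
elliptic variable by `1/2`. -/
theorem th4_eq_jacobiTheta₂ {τ : ℂ} (hτ : 0 < τ.im) : th4 τ = jacobiTheta₂ (1 / 2) τ := by
  rw [← th3_add_one, th3_eq_jacobiTheta₂ (by simpa using hτ), jacobiTheta₂, jacobiTheta₂]
  refine tsum_congr fun n => ?_
  rw [jacobiTheta₂_term, jacobiTheta₂_term, Complex.exp_eq_exp_iff_exists_int]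
  obtain ⟨k, hk⟩ := (Int.even_mul_pred_self n)
  refine ⟨k, ?_⟩
  have : (n : ℂ) * (n - 1) = k + k := by exact_mod_cast congrArg (Int.cast : ℤ → ℂ) hk
  linear_combination (π * I : ℂ) * this

/-- The indices `n` and `-(n + 1)` contribute the same power `h^{n(n+1)}`, which accounts for the
factor 2 in `θ₂`. -/
theorem th2_eq_jacobiTheta₂ {τ : ℂ} (hτ : 0 < τ.im) :
    th2 τ = exp (π * I * τ / 4) * jacobiTheta₂ (τ / 2) τ := by
  have hs := hasSum_jacobiTheta₂_term (τ / 2) hτ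
  have e1 : ∀ n : ℕ, jacobiTheta₂_term n (τ / 2) τ = nome τ ^ (n * (n + 1)) := fun n => by
    rw [nome, ← exp_nat_mul, jacobiTheta₂_term]; push_cast; ring_nf
  have e2 : ∀ n : ℕ, jacobiTheta₂_term (-(n + 1 : ℤ)) (τ / 2) τ = nome τ ^ (n * (n + 1)) :=
    fun n => by rw [nome, ← exp_nat_mul, jacobiTheta₂_term]; push_cast; ring_nf
  have hS : HasSum (fun n : ℕ => nome τ ^ (n * (n + 1))) (thetaP (nome τ)) := by
    refine Summable.hasSum (Summable.of_norm_bounded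
      (summable_geometric_of_lt_one (norm_nonneg _) (norm_nome_lt_one hτ)) fun n => ?_)
    rw [norm_pow]
    exact pow_le_pow_of_le_one (norm_nonneg _) (norm_nome_lt_one hτ).le
      (strictMono_mul_succ.id_le n)
  have h2 := HasSum.of_nat_of_neg_add_one (f := fun n : ℤ => jacobiTheta₂_term n (τ / 2) τ)
    (by simpa only [e1] using hS) (by simpa only [e2] using hS)
  rw [hs.unique h2, th2]; ring

/-- The automorphy factor `√(-iτ)`. -/
noncomputable def sFac (τ : ℂ) : ℂ := (-I * τ) ^ (1 / 2 : ℂ)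

theorem sFac_sq (τ : ℂ) : sFac τ ^ 2 = -I * τ := by
  rw [sFac, ← cpow_nat_mul]; norm_num

theorem sFac_pow_four (τ : ℂ) : sFac τ ^ 4 = -τ ^ 2 := by
  rw [show sFac τ ^ 4 = (sFac τ ^ 2) ^ 2 by ring, sFac_sq, mul_pow, neg_sq, I_sq]; ring

theorem ne_zero_of_im_pos {τ : ℂ} (hτ : 0 < τ.im) : τ ≠ 0 := by
  rintro rfl; simp at hτ

theorem sFac_ne_zero {τ : ℂ} (hτ : 0 < τ.im) : sFac τ ≠ 0 := by
  intro h
  have := sFac_sq τ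
  rw [h] at this
  have h0 := ne_zero_of_im_pos hτ
  simp [h0] at this

theorem neg_inv_im_pos {τ : ℂ} (hτ : 0 < τ.im) : 0 < (-1 / τ).im := by
  rw [neg_div, one_div, neg_im, inv_im, neg_div, neg_neg]
  exact div_pos hτ (normSq_pos.2 (ne_zero_of_im_pos hτ))

theorem th3_neg_inv {τ : ℂ} (hτ : 0 < τ.im) : th3 (-1 / τ) = sFac τ * th3 τ := by
  rw [th3_eq_jacobiTheta₂ hτ, th3_eq_jacobiTheta₂ (neg_inv_im_pos hτ),
    jacobiTheta₂_functional_equation 0 τ, ← sFac]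
  have := sFac_ne_zero hτ
  simp
  field_simp

theorem th2_neg_inv {τ : ℂ} (hτ : 0 < τ.im) : th2 (-1 / τ) = sFac τ * th4 τ := by
  have h0 := ne_zero_of_im_pos hτ
  rw [th4_eq_jacobiTheta₂ hτ, th2_eq_jacobiTheta₂ (neg_inv_im_pos hτ),
    jacobiTheta₂_functional_equation (1 / 2) τ, ← sFac, ← jacobiTheta₂_neg_left]
  have := sFac_ne_zero hτ
  have e1 : -(-1 / τ / 2) = 1 / 2 / τ := by field_simp
  have e2 : (π * I * (-1 / τ) / 4 : ℂ) = -π * I * (1 / 2) ^ 2 / τ := by field_simp; norm_num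
  rw [e1, e2]
  field_simp

theorem sFac_neg_inv {τ : ℂ} (hτ : 0 < τ.im) : sFac (-1 / τ) = (sFac τ)⁻¹ := by
  have h0 := ne_zero_of_im_pos hτ
  rw [sFac, sFac, ← inv_cpow]
  · congr 1
    rw [mul_inv, inv_neg, inv_I, neg_neg]
    field_simp
  -- The number `-iτ` has positive real part, so it avoids the cut of the principal root.
  · intro h
    rw [arg_eq_pi_iff] at h
    simp at h
    linarith [h.1]

theorem th4_neg_inv {τ : ℂ} (hτ : 0 < τ.im) : th4 (-1 / τ) = sFac τ * th2 τ := by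
  have h0 := ne_zero_of_im_pos hτ
  have h1 := th2_neg_inv (neg_inv_im_pos hτ)
  have e : -1 / (-1 / τ) = τ := by field_simp
  rw [e, sFac_neg_inv hτ] at h1
  rw [h1, mul_inv_cancel_left₀ (sFac_ne_zero hτ)]

/-! ### The modular group -/

-- `S` and `T` generate the modular group and every orbit meets the standard fundamental domain.
-- Together the hypotheses make `P` invariant in both directions: `hT'` undoes `hT`, and `S` is an
-- involution.
open UpperHalfPlane ModularGroup in
theorem upperHalfPlane_induction {P : ℂ → Prop}
    (hT : ∀ τ : ℂ, 0 < τ.im → P τ → P (τ + 1)) (hT' : ∀ τ : ℂ, 0 < τ.im → P τ → P (τ - 1))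
    (hS : ∀ τ : ℂ, 0 < τ.im → P τ → P (-1 / τ))
    (h : ∀ τ : ℂ, 0 < τ.im → |τ.re| ≤ 1 / 2 → 3 / 4 ≤ τ.im ^ 2 → P τ) :
    ∀ τ : ℂ, 0 < τ.im → P τ := by
  have key : ∀ g ∈ Subgroup.closure {S, T}, ∀ z : UpperHalfPlane, P z ↔ P (g • z : ℍ) := by
    intro g hg
    induction hg using Subgroup.closure_induction with
    | mem g hg =>
      intro z
      rcases hg with rfl | rfl
      · have e : ((S • z : ℍ) : ℂ) = -1 / z := by
          rw [modular_S_smul]; simp [neg_div, inv_neg]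
        rw [e]
        refine ⟨hS z z.im_pos, fun hz => ?_⟩
        have := hS _ (neg_inv_im_pos z.im_pos) hz
        rwa [show (-1 : ℂ) / (-1 / z) = z by have := z.ne_zero; field_simp] at this
      · have e : ((T • z : ℍ) : ℂ) = z + 1 := by
          rw [modular_T_smul]; simp [add_comm]
        rw [e]
        refine ⟨hT z z.im_pos, fun hz => ?_⟩
        have := hT' (z + 1) (by simpa using z.im_pos) hz
        rwa [add_sub_cancel_right] at this
    | one => simp
    | mul g g' _ _ hg hg' => intro z; rw [mul_smul, ← hg, ← hg']
    | inv g _ hg => intro z; rw [hg (g⁻¹ • z), smul_inv_smul]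
  intro τ hτ
  obtain ⟨g, hg⟩ := exists_smul_mem_fd ⟨τ, hτ⟩
  rw [show τ = ((⟨τ, hτ⟩ : ℍ) : ℂ) from rfl,
    key g (by rw [SpecialLinearGroup.SL2Z_generators]; trivial)]
  refine h _ (g • (⟨τ, hτ⟩ : ℍ)).im_pos hg.2 ?_
  have := three_le_four_mul_im_sq_of_mem_fd hg
  rw [UpperHalfPlane.coe_im]
  linarith

theorem convex_im_pos : Convex ℝ {τ : ℂ | 0 < τ.im} := convex_halfSpace_im_gt 0

theorem isOpen_im_pos : IsOpen {τ : ℂ | 0 < τ.im} := isOpen_lt continuous_const continuous_im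

theorem isCompact_re_im (a b c : ℝ) :
    IsCompact {τ : ℂ | |τ.re| ≤ a ∧ b ≤ τ.im ∧ τ.im ≤ c} := by
  have : {τ : ℂ | |τ.re| ≤ a ∧ b ≤ τ.im ∧ τ.im ≤ c} = Icc (-a) a ×ℂ Icc b c := by
    ext τ; simp [mem_reProdIm, abs_le]
  rw [this]
  exact isCompact_Icc.reProdIm isCompact_Icc

theorem sqrt_three_div_two_le {y : ℝ} (hy : 0 < y) (h : 3 / 4 ≤ y ^ 2) : √3 / 2 ≤ y := by
  rw [div_le_iff₀ two_pos, Real.sqrt_le_left (by positivity)]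
  linarith

/-- A modular function for the full modular group with a limit at infinity is constant. -/
theorem eq_limit_of_modular_invariant {Φ : ℂ → ℂ} {L : ℂ}
    (hd : DifferentiableOn ℂ Φ {τ | 0 < τ.im})
    (hT : ∀ τ : ℂ, 0 < τ.im → Φ (τ + 1) = Φ τ) (hS : ∀ τ : ℂ, 0 < τ.im → Φ (-1 / τ) = Φ τ)
    (hL : Tendsto Φ (comap im atTop) (𝓝 L)) : ∀ τ : ℂ, 0 < τ.im → Φ τ = L := by
  by_contra! hne
  obtain ⟨τ₀, hτ₀, hne⟩ := hne
  have hpos : 0 < ‖Φ τ₀ - L‖ := norm_pos_iff.2 (sub_ne_zero.2 hne)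
  have hev := (tendsto_iff_norm_sub_tendsto_zero.1 hL).eventually_lt_const hpos
  rw [eventually_comap, eventually_atTop] at hev
  obtain ⟨Y, hY⟩ := hev
  set K := {τ : ℂ | |τ.re| ≤ 1 / 2 ∧ √3 / 2 ≤ τ.im ∧ τ.im ≤ max Y 1} with hK
  have h3 : 0 < √3 / 2 := by positivity
  have hKH : K ⊆ {τ | 0 < τ.im} := fun τ hτ => h3.trans_le hτ.2.1
  have hKne : K.Nonempty := ⟨I, by
    refine ⟨by simp, ?_, by simp⟩
    rw [I_im]; exact sqrt_three_div_two_le one_pos (by norm_num)⟩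
  obtain ⟨τ₁, hτ₁, hmax⟩ := (isCompact_re_im _ _ _).exists_isMaxOn hKne
    (f := fun τ => ‖Φ τ - L‖) ((hd.mono hKH).continuousOn.sub continuousOn_const).norm
  -- The maximum over the compact part of the fundamental domain bounds the norm globally, except
  -- where the norm is already below its value at `τ₀`. Both alternatives depend on `Φ τ` only,
  -- hence are invariant. The maximum principle then makes `Φ` constant, against its smallness high
  -- up.
  have hQ : ∀ τ : ℂ, 0 < τ.im → ‖Φ τ - L‖ ≤ ‖Φ τ₁ - L‖ ∨ ‖Φ τ - L‖ < ‖Φ τ₀ - L‖ := by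
    refine upperHalfPlane_induction ?_ ?_ ?_ ?_
    · intro τ hτ h; rwa [hT τ hτ]
    · intro τ hτ h
      have := hT (τ - 1) (by simpa using hτ)
      rw [sub_add_cancel] at this
      rwa [← this]
    · intro τ hτ h; rwa [hS τ hτ]
    · intro τ hτ h1 h2
      rcases le_total τ.im (max Y 1) with h | h
      · exact Or.inl (hmax ⟨h1, sqrt_three_div_two_le hτ h2, h⟩)
      · exact Or.inr (hY _ ((le_max_left _ _).trans h) _ rfl)
  have h01 : ‖Φ τ₀ - L‖ ≤ ‖Φ τ₁ - L‖ := (hQ τ₀ hτ₀).resolve_right (lt_irrefl _)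
  have hmax' : IsMaxOn (norm ∘ fun τ => Φ τ - L) {τ | 0 < τ.im} τ₁ := fun τ hτ =>
    (hQ τ hτ).elim id fun h => h.le.trans h01
  have hc := eqOn_of_isPreconnected_of_isMaxOn_norm convex_im_pos.isPreconnected isOpen_im_pos
    (hd.sub_const L) (hKH hτ₁) hmax'
  set y : ℝ := max Y 1
  have hy : 0 < ((y : ℂ) * I).im := by simp [y]
  have h2 : Φ (y * I) - L = Φ τ₁ - L := hc hy
  have h3 := hY y (le_max_left _ _) (y * I) (by simp)
  rw [h2] at h3
  exact absurd h3 (not_lt.2 h01)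

/-! ### Non-vanishing -/

/-- On the fundamental domain `|h| ≤ e^{-π√3/2} ≈ 0.0658`; the non-vanishing and cusp estimates
below all rest on this bound. -/
theorem norm_nome_le {τ : ℂ} (hτ : 0 < τ.im) (h : 3 / 4 ≤ τ.im ^ 2) : ‖nome τ‖ ≤ 0.066 := by
  rw [norm_nome, Real.exp_neg]
  have h1 : (2.72 : ℝ) ≤ π * τ.im := by
    have h2 : (0.866 : ℝ) ≤ τ.im := by
      by_contra! h'
      nlinarith
    nlinarith [Real.pi_gt_d4]
  -- `0.68 = 2.72 / 4`: six Taylor terms suffice after passing to the fourth root.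
  have h3 := Real.sum_le_exp_of_nonneg (show (0 : ℝ) ≤ 0.68 by norm_num) 6
  norm_num [Finset.sum_range_succ, Nat.factorial] at h3
  have h4 : (0.066 : ℝ)⁻¹ ≤ Real.exp (π * τ.im) := calc
    (0.066 : ℝ)⁻¹ ≤ (Real.exp (17 / 25)) ^ 4 := by
      refine le_trans ?_ (pow_le_pow_left₀ (by norm_num) h3 4)
      norm_num
    _ = Real.exp 2.72 := by rw [← Real.exp_nat_mul]; norm_num
    _ ≤ _ := Real.exp_le_exp.2 h1
  exact inv_le_of_inv_le₀ (by norm_num) h4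

theorem thetaP_ne_zero {h : ℂ} (hh : ‖h‖ ≤ 0.066) : thetaP h ≠ 0 := by
  intro h0
  have := norm_thetaP_sub_one_le (h := h) (hh.trans_lt (by norm_num))
  rw [h0, zero_sub, norm_neg, norm_one, le_div_iff₀ (by linarith)] at this
  nlinarith [norm_nonneg h]

theorem thetaThree_ne_zero {h : ℂ} (hh : ‖h‖ ≤ 0.066) : thetaThree h ≠ 0 := by
  intro h0
  have h1 := norm_thetaThree_sub_le' (h := h) (hh.trans_lt (by norm_num))
  have h2 : ‖h‖ ^ 4 / (1 - ‖h‖) ≤ 0.066 ^ 4 / (1 - 0.066) := by gcongr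
  rw [h0, zero_sub, norm_neg] at h1
  have h3 := norm_sub_le (1 + 2 * h) (2 * h)
  rw [add_sub_cancel_right, norm_one, norm_mul, Complex.norm_ofNat] at h3
  norm_num at h2
  linarith

/-- The translations and `S` permute the three theta constants up to non-vanishing factors, so the
series need only be inspected for small nome. -/
theorem theta_ne_zero : ∀ τ : ℂ, 0 < τ.im → th2 τ ≠ 0 ∧ th3 τ ≠ 0 ∧ th4 τ ≠ 0 := by
  refine upperHalfPlane_induction ?_ ?_ ?_ ?_
  · rintro τ - ⟨h2, h3, h4⟩
    rw [th2_add_one, th3_add_one, th4_add_one]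
    exact ⟨mul_ne_zero (exp_ne_zero _) h2, h4, h3⟩
  · rintro τ - ⟨h2, h3, h4⟩
    have e2 := th2_add_one (τ - 1)
    have e3 := th3_add_one (τ - 1)
    have e4 := th4_add_one (τ - 1)
    rw [sub_add_cancel] at e2 e3 e4
    exact ⟨right_ne_zero_of_mul (e2 ▸ h2), e4 ▸ h4, e3 ▸ h3⟩
  · rintro τ hτ ⟨h2, h3, h4⟩
    rw [th2_neg_inv hτ, th3_neg_inv hτ, th4_neg_inv hτ]
    have := sFac_ne_zero hτ
    exact ⟨mul_ne_zero this h4, mul_ne_zero this h3, mul_ne_zero this h2⟩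
  · intro τ hτ _ h
    have hn := norm_nome_le hτ h
    refine ⟨mul_ne_zero (mul_ne_zero two_ne_zero (exp_ne_zero _)) (thetaP_ne_zero hn),
      thetaThree_ne_zero hn, thetaThree_ne_zero (by rwa [norm_neg])⟩

theorem th2_ne_zero {τ : ℂ} (hτ : 0 < τ.im) : th2 τ ≠ 0 := (theta_ne_zero τ hτ).1
theorem th3_ne_zero {τ : ℂ} (hτ : 0 < τ.im) : th3 τ ≠ 0 := (theta_ne_zero τ hτ).2.1
theorem th4_ne_zero {τ : ℂ} (hτ : 0 < τ.im) : th4 τ ≠ 0 := (theta_ne_zero τ hτ).2.2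

/-! ### Jacobi's quartic identity -/

theorem th2_pow_four (τ : ℂ) : th2 τ ^ 4 = 16 * nome τ * thetaP (nome τ) ^ 4 := by
  rw [th2, mul_pow, mul_pow, ← exp_nat_mul, nome]
  push_cast
  rw [mul_div_cancel₀ _ (by norm_num : (4 : ℂ) ≠ 0)]
  ring

theorem th2_add_one_pow_four (τ : ℂ) : th2 (τ + 1) ^ 4 = -th2 τ ^ 4 := by
  rw [th2_pow_four, th2_pow_four, nome_add_one, thetaP_neg]; ring

theorem thetaP_zero : thetaP 0 = 1 := by
  have := norm_thetaP_sub_one_le (h := 0) (by simp)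
  simpa [sub_eq_zero] using this

theorem thetaThree_zero : thetaThree 0 = 1 := by
  have := norm_thetaThree_sub_le' (h := 0) (by simp)
  simpa [sub_eq_zero] using this

/-- The defect `J` has weight two and changes sign under `T`. Thus `J⁶` over the eighth power of
`θ₂θ₃θ₄` is invariant under the full modular group. The denominator vanishes only to order `h²` at
the cusp, while `J` has a factor `h`; the quotient tends to `0` and is identically `0`. -/
theorem jacobi_identity {τ : ℂ} (hτ : 0 < τ.im) : th2 τ ^ 4 + th4 τ ^ 4 = th3 τ ^ 4 := by
  set J : ℂ → ℂ := fun τ => th2 τ ^ 4 + th4 τ ^ 4 - th3 τ ^ 4 with hJ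
  set Φ : ℂ → ℂ := fun τ => J τ ^ 6 / (th2 τ * th3 τ * th4 τ) ^ 8 with hΦ
  have hd : DifferentiableOn ℂ Φ {τ | 0 < τ.im} := by
    intro τ hτ
    have h2 := differentiableAt_th2 hτ
    have h3 := differentiableAt_th3 hτ
    have h4 := differentiableAt_th4 hτ
    refine DifferentiableAt.differentiableWithinAt (DifferentiableAt.div
      ((((h2.pow 4).add (h4.pow 4)).sub (h3.pow 4)).pow 6) (((h2.mul h3).mul h4).pow 8) ?_)
    exact pow_ne_zero _ (mul_ne_zero (mul_ne_zero (th2_ne_zero hτ) (th3_ne_zero hτ))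
      (th4_ne_zero hτ))
  set j : ℂ → ℂ := fun h => 16 * h * thetaP h ^ 4 + thetaThree (-h) ^ 4 - thetaThree h ^ 4 with hj
  have hP := differentiableAt_thetaP (h := 0) (by simp)
  have h3 := differentiableAt_thetaThree (h := 0) (by simp)
  have h4 : DifferentiableAt ℂ (fun h => thetaThree (-h)) 0 :=
    DifferentiableAt.comp (g := thetaThree) (f := fun h => -h) (0 : ℂ)
      (differentiableAt_thetaThree (by simp)) differentiable_neg.differentiableAt
  have hjd : DifferentiableAt ℂ j 0 :=
    (((differentiableAt_id.const_mul 16).mul (hP.pow 4)).add (h4.pow 4)).sub (h3.pow 4)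
  have hj0 : j 0 = 0 := by simp [hj]
  have hds : ContinuousAt (dslope j 0) 0 := continuousAt_dslope_same.2 hjd
  have hlim : Tendsto (fun h => h ^ 4 * dslope j 0 h ^ 6 /
      (256 * (thetaP h * thetaThree h * thetaThree (-h)) ^ 8)) (𝓝 0) (𝓝 0) := by
    have hc : ContinuousAt (fun h => h ^ 4 * dslope j 0 h ^ 6 /
      (256 * (thetaP h * thetaThree h * thetaThree (-h)) ^ 8)) 0 := by
      refine ContinuousAt.div ((continuousAt_id.pow 4).mul (hds.pow 6))
        (continuousAt_const.mul (((hP.continuousAt.mul h3.continuousAt).mul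
          h4.continuousAt).pow 8)) ?_
      simp [thetaP_zero, thetaThree_zero]
    have := hc.tendsto
    simpa using this
  have hL : Tendsto Φ (comap im atTop) (𝓝 0) := by
    refine (hlim.comp tendsto_nome).congr fun τ => ?_
    have hn := nome_ne_zero τ
    have e : J τ = nome τ * dslope j 0 (nome τ) := by
      have := sub_smul_dslope j 0 (nome τ)
      rw [hj0, sub_zero, sub_zero, smul_eq_mul] at this
      rw [this, hj, hJ]
      simp only [th2_pow_four, th3, th4]
    have e2 : th2 τ ^ 8 = 256 * nome τ ^ 2 * thetaP (nome τ) ^ 8 := by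
      rw [show th2 τ ^ 8 = (th2 τ ^ 4) ^ 2 by ring, th2_pow_four]; ring
    simp only [hΦ, Function.comp, e, mul_pow, e2, th3, th4]
    rw [show nome τ ^ 6 * dslope j 0 (nome τ) ^ 6 = nome τ ^ 2 * (nome τ ^ 4 * dslope j 0 (nome τ) ^ 6)
      by ring]
    rw [show ∀ a b c d : ℂ, 256 * a * b * c * d = a * (256 * (b * c * d)) by intros; ring,
      mul_div_mul_left _ _ (pow_ne_zero 2 hn)]
  have := eq_limit_of_modular_invariant hd ?_ ?_ hL τ hτ
  · rw [hΦ, div_eq_zero_iff] at this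
    have hne : (th2 τ * th3 τ * th4 τ) ^ 8 ≠ 0 := pow_ne_zero _ (mul_ne_zero (mul_ne_zero
      (th2_ne_zero hτ) (th3_ne_zero hτ)) (th4_ne_zero hτ))
    exact sub_eq_zero.1 (pow_eq_zero_iff (by norm_num) |>.1 (this.resolve_right hne))
  · intro τ hτ
    have e : J (τ + 1) = -J τ := by
      simp only [hJ, th2_add_one_pow_four, th3_add_one, th4_add_one]; ring
    have e2 : th2 (τ + 1) ^ 8 = th2 τ ^ 8 := by
      rw [show ∀ x : ℂ, x ^ 8 = (x ^ 4) ^ 2 by intro; ring, th2_add_one_pow_four]; ring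
    simp only [hΦ, e, mul_pow, e2, th3_add_one, th4_add_one]
    ring
  · intro τ hτ
    have e : J (-1 / τ) = sFac τ ^ 4 * J τ := by
      simp only [hJ, th2_neg_inv hτ, th3_neg_inv hτ, th4_neg_inv hτ]; ring
    simp only [hΦ, e, th2_neg_inv hτ, th3_neg_inv hτ, th4_neg_inv hτ]
    rw [show (sFac τ ^ 4 * J τ) ^ 6 = sFac τ ^ 24 * J τ ^ 6 by ring,
      show (sFac τ * th4 τ * (sFac τ * th3 τ) * (sFac τ * th2 τ)) ^ 8
        = sFac τ ^ 24 * (th2 τ * th3 τ * th4 τ) ^ 8 by ring,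
      mul_div_mul_left _ _ (pow_ne_zero _ (sFac_ne_zero hτ))]

/-! ### Jacobi's modular function -/

theorem kappaSq_eq (τ : ℂ) : kappaSq τ = th2 τ ^ 4 / th3 τ ^ 4 := by
  rw [kappaSq, div_pow, th2_pow_four, th3]
  congr 1
  rw [thetaTwo, ← thetaP, mul_pow, mul_pow, ← cpow_nat_mul]
  norm_num

theorem one_sub_kappaSq {τ : ℂ} (hτ : 0 < τ.im) : 1 - kappaSq τ = th4 τ ^ 4 / th3 τ ^ 4 := by
  have := pow_ne_zero 4 (th3_ne_zero hτ)
  rw [kappaSq_eq, eq_div_iff this, sub_mul, div_mul_cancel₀ _ this, ← jacobi_identity hτ]; ring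

theorem kappaSq_ne_zero {τ : ℂ} (hτ : 0 < τ.im) : kappaSq τ ≠ 0 := by
  rw [kappaSq_eq]
  exact div_ne_zero (pow_ne_zero _ (th2_ne_zero hτ)) (pow_ne_zero _ (th3_ne_zero hτ))

theorem one_sub_kappaSq_ne_zero {τ : ℂ} (hτ : 0 < τ.im) : 1 - kappaSq τ ≠ 0 := by
  rw [one_sub_kappaSq hτ]
  exact div_ne_zero (pow_ne_zero _ (th4_ne_zero hτ)) (pow_ne_zero _ (th3_ne_zero hτ))

theorem kappaSq_add_one {τ : ℂ} (hτ : 0 < τ.im) :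
    kappaSq (τ + 1) = -kappaSq τ / (1 - kappaSq τ) := by
  rw [one_sub_kappaSq hτ, kappaSq_eq, kappaSq_eq, th2_add_one_pow_four, th3_add_one]
  have := th3_ne_zero hτ
  have := th4_ne_zero hτ
  field_simp

theorem kappaSq_neg_inv {τ : ℂ} (hτ : 0 < τ.im) : kappaSq (-1 / τ) = 1 - kappaSq τ := by
  rw [one_sub_kappaSq hτ, kappaSq_eq, th2_neg_inv hτ, th3_neg_inv hτ, mul_pow, mul_pow,
    mul_div_mul_left _ _ (pow_ne_zero 4 (sFac_ne_zero hτ))]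

theorem kappaSq_I : kappaSq I = 1 / 2 := by
  have h := kappaSq_neg_inv (τ := I) (by simp)
  rw [neg_div, one_div, inv_I, neg_neg] at h
  linear_combination h / 2

theorem differentiableAt_kappaSq {τ : ℂ} (hτ : 0 < τ.im) : DifferentiableAt ℂ kappaSq τ := by
  rw [show kappaSq = fun τ => th2 τ ^ 4 / th3 τ ^ 4 from funext kappaSq_eq]
  exact ((differentiableAt_th2 hτ).pow 4).div ((differentiableAt_th3 hτ).pow 4)
    (pow_ne_zero _ (th3_ne_zero hτ))

theorem differentiableOn_deriv_kappaSq : DifferentiableOn ℂ (deriv kappaSq) {τ | 0 < τ.im} :=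
  DifferentiableOn.deriv
    (fun _ hτ => (differentiableAt_kappaSq hτ).differentiableWithinAt) isOpen_im_pos

theorem hasDerivAt_neg_inv {τ : ℂ} (hτ : 0 < τ.im) :
    HasDerivAt (fun τ : ℂ => -1 / τ) (1 / τ ^ 2) τ := by
  have := (hasDerivAt_inv (ne_zero_of_im_pos hτ)).neg
  simp only [neg_neg] at this
  simpa [neg_div, Pi.neg_def] using! this

/-- The quotient of the two sides is invariant under `T` and `S`, by the known action on `κ²` and on
the theta constants, and tends to `1` at the cusp; hence it is constant. -/
theorem hasDerivAt_kappaSq {τ : ℂ} (hτ : 0 < τ.im) :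
    HasDerivAt kappaSq (π * I * kappaSq τ * th4 τ ^ 4) τ := by
  have hpi : (π : ℂ) * I ≠ 0 := mul_ne_zero (by exact_mod_cast Real.pi_ne_zero) I_ne_zero
  set Φ : ℂ → ℂ := fun τ => deriv kappaSq τ / (π * I * kappaSq τ * th4 τ ^ 4) with hΦ
  have hne : ∀ {τ : ℂ}, 0 < τ.im → (π * I * kappaSq τ * th4 τ ^ 4 : ℂ) ≠ 0 := fun hτ =>
    mul_ne_zero (mul_ne_zero hpi (kappaSq_ne_zero hτ)) (pow_ne_zero _ (th4_ne_zero hτ))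
  have hd : DifferentiableOn ℂ Φ {τ | 0 < τ.im} := fun τ hτ =>
    (DifferentiableAt.div (differentiableOn_deriv_kappaSq.differentiableAt
      (isOpen_im_pos.mem_nhds hτ)) (((differentiableAt_kappaSq hτ).const_mul _).mul
        ((differentiableAt_th4 hτ).pow 4)) (hne hτ)).differentiableWithinAt
  -- In the nome, `κ² = k(h) = h m(h)` with `k'(0) = m(0) = 16`. This makes the limit `1` and
  -- exhibits the common factor `πi h` to be cancelled.
  set m : ℂ → ℂ := fun h => 16 * thetaP h ^ 4 / thetaThree h ^ 4 with hm
  set k : ℂ → ℂ := fun h => h * m h with hk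
  have hmd : ∀ {h : ℂ}, ‖h‖ < 0.066 → DifferentiableAt ℂ m h := fun {h} hh =>
    (((differentiableAt_thetaP (hh.trans (by norm_num))).pow 4).const_mul 16).div
      ((differentiableAt_thetaThree (hh.trans (by norm_num))).pow 4)
      (pow_ne_zero _ (thetaThree_ne_zero hh.le))
  have hkd : DifferentiableOn ℂ k (Metric.ball 0 0.066) := fun h hh =>
    (differentiableAt_id.mul (hmd (by simpa using hh))).differentiableWithinAt
  have hk0 : deriv k 0 = 16 := by
    have := ((hasDerivAt_id (0 : ℂ)).mul (hmd (h := 0) (by norm_num)).hasDerivAt).deriv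
    simpa [hm, thetaP_zero, thetaThree_zero] using! this
  have hkc : ContinuousAt (deriv k) 0 :=
    ((hkd.deriv Metric.isOpen_ball).differentiableAt
      (Metric.isOpen_ball.mem_nhds (by simp; norm_num))).continuousAt
  have hP := (differentiableAt_thetaP (h := 0) (by simp)).continuousAt
  have h3 := (differentiableAt_thetaThree (h := 0) (by simp)).continuousAt
  have h4 : ContinuousAt (fun h => thetaThree (-h)) 0 :=
    ContinuousAt.comp (x := (0 : ℂ)) (g := thetaThree) (f := fun h => -h)
      (differentiableAt_thetaThree (by simp)).continuousAt continuous_neg.continuousAt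
  have hL : Tendsto Φ (comap im atTop) (𝓝 1) := by
    have hc : ContinuousAt (fun h => deriv k h / (m h * thetaThree (-h) ^ 4)) 0 := by
      refine hkc.div ((hmd (by norm_num)).continuousAt.mul (h4.pow 4)) ?_
      simp [hm, thetaP_zero, thetaThree_zero]
    have ht := hc.tendsto
    simp only [hk0, hm, thetaP_zero, thetaThree_zero, neg_zero] at ht
    norm_num at ht
    refine (ht.comp tendsto_nome).congr' ?_
    have hs : ∀ᶠ τ in comap im atTop, ‖nome τ‖ < 0.066 :=
      (tendsto_zero_iff_norm_tendsto_zero.1 tendsto_nome).eventually_lt_const (by norm_num)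
    filter_upwards [hs] with τ hτ
    have hkap : kappaSq = fun τ => k (nome τ) := by
      funext τ; rw [kappaSq_eq, th2_pow_four, th3]; simp only [hk, hm]; ring
    have hder : HasDerivAt kappaSq (deriv k (nome τ) * (π * I * nome τ)) τ := by
      rw [hkap]
      exact ((hkd.differentiableAt (Metric.isOpen_ball.mem_nhds (by simpa using hτ))).hasDerivAt).comp
        τ (hasDerivAt_nome τ)
    have hn := nome_ne_zero τ
    simp only [Function.comp, hΦ, hder.deriv]
    rw [hkap, th4]
    simp only [hk]
    rw [show deriv k (nome τ) * (π * I * nome τ) = (π * I * nome τ) * deriv k (nome τ) by ring,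
      show (π * I * (nome τ * m (nome τ)) * thetaThree (-nome τ) ^ 4 : ℂ)
        = (π * I * nome τ) * (m (nome τ) * thetaThree (-nome τ) ^ 4) by ring,
      mul_div_mul_left _ _ (mul_ne_zero hpi hn)]
  have key := eq_limit_of_modular_invariant hd ?_ ?_ hL τ hτ
  · rw [hΦ, div_eq_one_iff_eq (hne hτ)] at key
    rw [← key]
    exact (differentiableAt_kappaSq hτ).hasDerivAt
  · intro τ hτ
    have h1 := one_sub_kappaSq_ne_zero hτ
    have hk' := (differentiableAt_kappaSq hτ).hasDerivAt
    have e : deriv kappaSq (τ + 1) = -deriv kappaSq τ / (1 - kappaSq τ) ^ 2 := by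
      rw [← deriv_comp_add_const]
      have : (fun x => kappaSq (x + 1)) =ᶠ[𝓝 τ] fun x => -kappaSq x / (1 - kappaSq x) :=
        (isOpen_im_pos.eventually_mem hτ).mono fun x hx => kappaSq_add_one hx
      have h2 : HasDerivAt (fun x => -kappaSq x / (1 - kappaSq x)) _ τ :=
        hk'.neg.div (hk'.const_sub 1) h1
      rw [this.deriv_eq, h2.deriv]
      congr 1
      simp only [Pi.neg_apply]
      ring
    simp only [hΦ, e, kappaSq_add_one hτ, th4_add_one]
    have h3 := th3_ne_zero hτ
    have h4 := th4_ne_zero hτ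
    have h0 := kappaSq_ne_zero hτ
    have e4 : th4 τ ^ 4 = (1 - kappaSq τ) * th3 τ ^ 4 := by
      rw [one_sub_kappaSq hτ]; field_simp
    rw [e4]
    field_simp
  · intro τ hτ
    have hk' := (differentiableAt_kappaSq hτ).hasDerivAt
    have h0 := ne_zero_of_im_pos hτ
    have e : deriv kappaSq (-1 / τ) = -τ ^ 2 * deriv kappaSq τ := by
      have h1 := (differentiableAt_kappaSq (neg_inv_im_pos hτ)).hasDerivAt.comp τ
        (hasDerivAt_neg_inv hτ)
      have : (kappaSq ∘ fun τ : ℂ => -1 / τ) =ᶠ[𝓝 τ] fun x => 1 - kappaSq x :=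
        (isOpen_im_pos.eventually_mem hτ).mono fun x hx => kappaSq_neg_inv hx
      have h2 := this.deriv_eq
      rw [h1.deriv, (hk'.const_sub 1).deriv] at h2
      rw [mul_one_div, div_eq_iff (pow_ne_zero 2 h0)] at h2
      linear_combination h2
    simp only [hΦ, e, kappaSq_neg_inv hτ, th4_neg_inv hτ, mul_pow, sFac_pow_four,
      one_sub_kappaSq hτ]
    rw [kappaSq_eq]
    have h2 := th2_ne_zero hτ
    have h3 := th3_ne_zero hτ
    have h4 := th4_ne_zero hτ
    field_simp

/-! ### The Schwarz–Christoffel integral -/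

theorem ofReal_mul_cpow {t : ℝ} (ht : 0 < t) {w : ℂ} (hw : w ≠ 0) (r : ℂ) :
    ((t : ℂ) * w) ^ r = (t : ℂ) ^ r * w ^ r := by
  have ht' : (t : ℂ) ≠ 0 := ofReal_ne_zero.2 ht.ne'
  rw [cpow_def_of_ne_zero (mul_ne_zero ht' hw), cpow_def_of_ne_zero ht', cpow_def_of_ne_zero hw,
    log_ofReal_mul ht hw, ← exp_add, ofReal_log ht.le]
  ring_nf

/-- The plane cut along `(-∞, 0]` and `[1, ∞)`. -/
def slitDomain : Set ℂ := {w | w ∈ slitPlane ∧ 1 - w ∈ slitPlane}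

theorem one_sub_mul_mem_slitPlane {t : ℝ} (ht : t ∈ Icc (0 : ℝ) 1) {w : ℂ}
    (hw : 1 - w ∈ slitPlane) : 1 - t * w ∈ slitPlane := by
  have h := starConvex_one_slitPlane hw (sub_nonneg.2 ht.2) ht.1 (by ring)
  rw [real_smul, real_smul] at h
  convert h using 1
  push_cast; ring

theorem hasDerivAt_one_sub_mul_cpow {t w r : ℂ} (h : 1 - t * w ∈ slitPlane) :
    HasDerivAt (fun w : ℂ => (1 - t * w) ^ r) (r * (1 - t * w) ^ (r - 1) * -t) w := by
  have h1 : HasDerivAt (fun w : ℂ => 1 - t * w) (-t) w := by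
    simpa using ((hasDerivAt_id w).const_mul t).const_sub 1
  exact h1.cpow_const h

theorem intervalIntegrable_cpow_mul_cpow {w : ℂ} (hw : 1 - w ∈ slitPlane) (r : ℂ) :
    IntervalIntegrable (fun t : ℝ => (t : ℂ) ^ (-3 / 4 : ℂ) * (1 - t * w) ^ r)
      MeasureTheory.volume 0 1 := by
  refine (intervalIntegral.intervalIntegrable_cpow' (by norm_num)).mul_continuousOn ?_
  rw [uIcc_of_le zero_le_one]
  intro t ht
  have hc : ContinuousAt (fun t : ℝ => 1 - (t : ℂ) * w) t := by fun_prop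
  exact (hc.cpow continuousAt_const (one_sub_mul_mem_slitPlane ht hw)).continuousWithinAt

/-- The integral `∫₀¹ t^{-3/4} (1 - tw)^{-3/4} dt`. -/
noncomputable def scInt (w : ℂ) : ℂ :=
  ∫ t in (0 : ℝ)..1, (t : ℂ) ^ (-3 / 4 : ℂ) * (1 - t * w) ^ (-3 / 4 : ℂ)

theorem scMap_eq {w : ℂ} (hw : w ≠ 0) :
    scMap w = scConst * (w ^ (1 / 4 : ℂ) * scInt w) := by
  rw [scMap, scInt]
  congr 1
  rw [← intervalIntegral.integral_const_mul]
  refine intervalIntegral.integral_congr_ae (Eventually.of_forall fun t ht => ?_)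
  rw [uIoc_of_le zero_le_one] at ht
  have : w ^ (-3 / 4 : ℂ) * w = w ^ (1 / 4 : ℂ) := by
    nth_rewrite 2 [← cpow_one w]
    rw [← cpow_add _ _ hw]; norm_num
  rw [ofReal_mul_cpow ht.1 hw, ← this]; ring

/-- Differentiation under the integral: on a small closed ball about `w` the smooth factor is
bounded by compactness, and the singular factor `t^{-3/4}` is integrable. -/
theorem hasDerivAt_scInt {w : ℂ} (hw : 1 - w ∈ slitPlane) :
    HasDerivAt scInt (∫ t in (0 : ℝ)..1,
      (t : ℂ) ^ (-3 / 4 : ℂ) * ((3 / 4) * t * (1 - t * w) ^ (-7 / 4 : ℂ))) w := by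
  have ho : IsOpen {w : ℂ | 1 - w ∈ slitPlane} :=
    isOpen_slitPlane.preimage (continuous_const.sub continuous_id)
  obtain ⟨ε, hε, hsub⟩ := Metric.nhds_basis_closedBall.mem_iff.1 (ho.mem_nhds hw)
  obtain ⟨M, hM⟩ := (isCompact_Icc (a := (0 : ℝ)) (b := 1)).prod
    (isCompact_closedBall w ε) |>.exists_bound_of_continuousOn
    (f := fun p : ℝ × ℂ => (1 - p.1 * p.2) ^ (-7 / 4 : ℂ)) (by
      rintro ⟨t, v⟩ ⟨ht, hv⟩
      have hc : ContinuousAt (fun p : ℝ × ℂ => 1 - (p.1 : ℂ) * p.2) (t, v) := by fun_prop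
      exact (hc.cpow continuousAt_const
        (one_sub_mul_mem_slitPlane ht (hsub hv))).continuousWithinAt)
  have hI : Ι (0 : ℝ) 1 = Ioc 0 1 := uIoc_of_le zero_le_one
  have hint : IntervalIntegrable (fun t : ℝ => (t : ℂ) ^ (-3 / 4 : ℂ)) MeasureTheory.volume 0 1 :=
    intervalIntegral.intervalIntegrable_cpow' (by norm_num)
  refine (intervalIntegral.hasDerivAt_integral_of_dominated_loc_of_deriv_le
    (F := fun w t => (t : ℂ) ^ (-3 / 4 : ℂ) * (1 - t * w) ^ (-3 / 4 : ℂ))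
    (F' := fun w t => (t : ℂ) ^ (-3 / 4 : ℂ) * ((3 / 4) * t * (1 - t * w) ^ (-7 / 4 : ℂ)))
    (μ := MeasureTheory.volume) (a := 0) (b := 1)
    (bound := fun t : ℝ => ‖(t : ℂ) ^ (-3 / 4 : ℂ)‖ * M)
    (Metric.closedBall_mem_nhds w hε) ?_ ?_ ?_ ?_ ?_ ?_).2
  · filter_upwards [ho.mem_nhds hw] with v hv
    rw [hI]
    exact (intervalIntegrable_cpow_mul_cpow hv _).1.aestronglyMeasurable
  · exact intervalIntegrable_cpow_mul_cpow hw _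
  · have h := (intervalIntegrable_cpow_mul_cpow hw (-7 / 4)).mul_continuousOn
      (g := fun t : ℝ => (3 / 4 * t : ℂ)) (by fun_prop)
    rw [hI]
    refine h.1.aestronglyMeasurable.congr (Eventually.of_forall fun t => ?_)
    ring
  · refine Eventually.of_forall fun t ht v hv => ?_
    rw [hI] at ht
    rw [norm_mul, norm_mul, norm_mul]
    refine mul_le_mul_of_nonneg_left ?_ (norm_nonneg _)
    have h1 := hM (t, v) ⟨⟨ht.1.le, ht.2⟩, hv⟩
    have h2 : ‖(3 / 4 : ℂ)‖ * ‖(t : ℂ)‖ ≤ 1 := by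
      rw [norm_real, Real.norm_of_nonneg ht.1.le]
      norm_num
      linarith [ht.2]
    exact (mul_le_mul h2 h1 (norm_nonneg _) zero_le_one).trans_eq (one_mul M)
  · exact hint.norm.mul_const M
  · refine Eventually.of_forall fun t ht v hv => ?_
    rw [hI] at ht
    have := (hasDerivAt_one_sub_mul_cpow (r := -3 / 4)
      (one_sub_mul_mem_slitPlane ⟨ht.1.le, ht.2⟩ (hsub hv))).const_mul ((t : ℂ) ^ (-3 / 4 : ℂ))
    refine this.congr_deriv ?_
    rw [show (-3 / 4 - 1 : ℂ) = -7 / 4 by norm_num]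
    ring

/-- The left side is the integral over `[0, 1]` of the `t`-derivative of `t^{1/4} (1 - tw)^{-3/4}`.
Multiplied by `w^{-3/4}` it is the derivative of `w^{1/4} scInt w`, which is how the integrand of
`g` is recovered. -/
theorem scInt_identity {w : ℂ} (hw : 1 - w ∈ slitPlane) :
    (1 / 4) * scInt w + w * ∫ t in (0 : ℝ)..1,
      (t : ℂ) ^ (-3 / 4 : ℂ) * ((3 / 4) * t * (1 - t * w) ^ (-7 / 4 : ℂ))
      = (1 - w) ^ (-3 / 4 : ℂ) := by
  have h1 := intervalIntegrable_cpow_mul_cpow hw (-3 / 4)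
  have h2 : IntervalIntegrable (fun t : ℝ =>
      (t : ℂ) ^ (-3 / 4 : ℂ) * ((3 / 4) * t * (1 - t * w) ^ (-7 / 4 : ℂ)))
      MeasureTheory.volume 0 1 := by
    have h := (intervalIntegrable_cpow_mul_cpow hw (-7 / 4)).mul_continuousOn
      (g := fun t : ℝ => (3 / 4 * t : ℂ)) (by fun_prop)
    refine h.congr fun t _ => ?_
    ring
  rw [scInt, ← intervalIntegral.integral_const_mul, ← intervalIntegral.integral_const_mul,
    ← intervalIntegral.integral_add (h1.const_mul _) (h2.const_mul _),
    intervalIntegral.integral_eq_sub_of_hasDerivAt_of_le zero_le_one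
      (f := fun t : ℝ => (t : ℂ) ^ (1 / 4 : ℂ) * (1 - t * w) ^ (-3 / 4 : ℂ))]
  · norm_num
  · intro t ht
    refine ContinuousAt.continuousWithinAt (ContinuousAt.mul ?_ ?_)
    · exact (continuousAt_ofReal_cpow_const t _ (Or.inl (by norm_num)))
    · exact ContinuousAt.cpow (by fun_prop) continuousAt_const (one_sub_mul_mem_slitPlane ht hw)
  · intro t ht
    have d1 := hasDerivAt_ofReal_cpow_const ht.1.ne' (r := 1 / 4) (by norm_num)
    have hm := one_sub_mul_mem_slitPlane ⟨ht.1.le, ht.2.le⟩ hw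
    have d2 : HasDerivAt (fun t : ℝ => (1 - t * w) ^ (-3 / 4 : ℂ))
        (-3 / 4 * (1 - t * w) ^ (-3 / 4 - 1 : ℂ) * -w) t := by
      have := (hasDerivAt_one_sub_mul_cpow (t := w) (w := t) (r := -3 / 4)
        (by rwa [mul_comm])).comp_ofReal
      simpa only [mul_comm w] using this
    refine (d1.mul d2).congr_deriv ?_
    have ht0 : (t : ℂ) ≠ 0 := ofReal_ne_zero.2 ht.1.ne'
    have e : (t : ℂ) ^ (1 / 4 : ℂ) = (t : ℂ) ^ (-3 / 4 : ℂ) * t := by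
      rw [show (1 / 4 : ℂ) = -3 / 4 + 1 by norm_num, cpow_add _ _ ht0, cpow_one]
    rw [e]
    norm_num
    ring
  · exact (h1.const_mul _).add (h2.const_mul _)

theorem hasDerivAt_scMap {w : ℂ} (hw : w ∈ slitDomain) :
    HasDerivAt scMap (scConst * (w ^ (-3 / 4 : ℂ) * (1 - w) ^ (-3 / 4 : ℂ))) w := by
  have h0 := slitPlane_ne_zero hw.1
  have h1 : HasDerivAt (fun w : ℂ => w ^ (1 / 4 : ℂ)) (1 / 4 * w ^ (1 / 4 - 1 : ℂ) * 1) w :=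
    (hasDerivAt_id w).cpow_const hw.1
  have h2 := (h1.mul (hasDerivAt_scInt hw.2)).const_mul scConst
  have h3 : scMap =ᶠ[𝓝 w] fun w => scConst * (w ^ (1 / 4 : ℂ) * scInt w) :=
    (isOpen_ne.eventually_mem h0).mono fun v hv => scMap_eq hv
  refine (h2.congr_of_eventuallyEq h3).congr_deriv ?_
  rw [← scInt_identity hw.2]
  have e : w ^ (1 / 4 : ℂ) = w ^ (-3 / 4 : ℂ) * w := by
    nth_rewrite 3 [← cpow_one w]
    rw [← cpow_add _ _ h0]; norm_num
  rw [e, show (1 / 4 - 1 : ℂ) = -3 / 4 by norm_num]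
  ring

theorem half_mem_slitDomain : (1 / 2 : ℂ) ∈ slitDomain := by
  constructor <;> rw [mem_slitPlane_iff] <;> left <;> norm_num

theorem hasDerivAt_scMap_half :
    HasDerivAt scMap (scConst * (2 : ℂ) ^ (3 / 2 : ℂ)) (1 / 2) := by
  convert hasDerivAt_scMap half_mem_slitDomain using 2
  have e : (2 : ℂ) ^ (3 / 4 : ℂ) = (1 / 2 : ℂ) ^ (-3 / 4 : ℂ) := by
    rw [one_div, inv_cpow _ _ (by rw [show (2 : ℂ) = ((2 : ℝ) : ℂ) by norm_num,
      arg_ofReal_of_nonneg (by norm_num)]; exact Real.pi_ne_zero.symm), ← cpow_neg]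
    norm_num
  rw [show (1 : ℂ) - 1 / 2 = 1 / 2 by norm_num, ← e, ← cpow_add _ _ two_ne_zero]
  norm_num

/-- The Beta integrand occurring in the Schwarz–Christoffel map. -/
noncomputable def betaFun (s : ℝ) : ℂ := (s : ℂ) ^ (-3 / 4 : ℂ) * (1 - (s : ℂ)) ^ (-3 / 4 : ℂ)

theorem intervalIntegrable_betaFun : IntervalIntegrable betaFun MeasureTheory.volume 0 1 := by
  have := betaIntegral_convergent (u := 1 / 4) (v := 1 / 4) (by norm_num) (by norm_num)
  norm_num at this
  unfold betaFun
  norm_num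
  exact this

theorem integral_betaFun : ∫ s in (0 : ℝ)..1, betaFun s = betaIntegral (1 / 4) (1 / 4) := by
  unfold betaFun betaIntegral
  norm_num

theorem scMap_ofReal {w : ℝ} (hw : w ≠ 0) :
    scMap w = scConst * ∫ s in (0 : ℝ)..w, betaFun s := by
  have h := intervalIntegral.integral_comp_mul_right (a := 0) (b := 1) betaFun hw
  rw [zero_mul, one_mul, eq_inv_smul_iff₀ hw] at h
  rw [← h, scMap, real_smul]
  congr 1
  rw [← intervalIntegral.integral_const_mul]
  congr 1
  funext t
  rw [betaFun]
  push_cast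
  ring

theorem integral_betaFun_half :
    ∫ s in (0 : ℝ)..(1 / 2), betaFun s = betaIntegral (1 / 4) (1 / 4) / 2 := by
  have h1 : ∫ s in (0 : ℝ)..(1 / 2), betaFun (1 - s) = ∫ s in (1 / 2 : ℝ)..1, betaFun s := by
    rw [intervalIntegral.integral_comp_sub_left]; norm_num
  have h2 : ∀ s : ℝ, betaFun (1 - s) = betaFun s := fun s => by
    rw [betaFun, betaFun]; push_cast; rw [sub_sub_cancel, mul_comm]
  simp only [h2] at h1
  have h3 := intervalIntegral.integral_add_adjacent_intervals
    (intervalIntegrable_betaFun.mono_set (c := 0) (d := 1 / 2) (by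
      rw [uIcc_of_le (by norm_num), uIcc_of_le zero_le_one]; exact Icc_subset_Icc_right (by norm_num)))
    (intervalIntegrable_betaFun.mono_set (c := 1 / 2) (d := 1) (by
      rw [uIcc_of_le (by norm_num), uIcc_of_le zero_le_one]; exact Icc_subset_Icc_left (by norm_num)))
  rw [← h1, integral_betaFun] at h3
  linear_combination h3 / 2

/-- The real number `B(1/4, 1/4)`. -/
noncomputable def betaQ : ℝ := Real.Gamma (1 / 4) ^ 2 / Real.Gamma (1 / 2)

theorem betaQ_pos : 0 < betaQ :=
  div_pos (pow_pos (Real.Gamma_pos_of_pos (by norm_num)) _) (Real.Gamma_pos_of_pos (by norm_num))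

theorem betaIntegral_quarter : betaIntegral (1 / 4) (1 / 4) = betaQ := by
  have h := Gamma_mul_Gamma_eq_betaIntegral (s := 1 / 4) (t := 1 / 4) (by norm_num) (by norm_num)
  have h4 : Complex.Gamma (1 / 4) = (Real.Gamma (1 / 4) : ℝ) := by
    rw [← Gamma_ofReal]; norm_num
  have h2 : Complex.Gamma (1 / 4 + 1 / 4) = (Real.Gamma (1 / 2) : ℝ) := by
    rw [← Gamma_ofReal]; norm_num
  have h0 : ((Real.Gamma (1 / 2) : ℝ) : ℂ) ≠ 0 :=
    ofReal_ne_zero.2 (Real.Gamma_pos_of_pos (by norm_num)).ne'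
  rw [h4, h2] at h
  rw [betaQ]
  push_cast
  rw [eq_div_iff h0, mul_comm, ← h, sq]

/-- The constant `C` as a real number. -/
noncomputable def scC : ℝ := 2 * π * √2 / betaQ

theorem scC_pos : 0 < scC := div_pos (by positivity) betaQ_pos

theorem scConst_eq : scConst = scC := by
  rw [scConst, betaIntegral_quarter, scC]; push_cast; rfl

/-- The symmetry `s ↦ 1 - s` halves the Beta integral. The normalization of `C` and the rotation
`e^{πi/4}` then place the value at the centre `π + πi`. -/
theorem scMap_half : scMap (1 / 2) = π * √2 := by
  have h := scMap_ofReal (w := 1 / 2) (by norm_num)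
  rw [integral_betaFun_half, betaIntegral_quarter, scConst_eq, scC] at h
  push_cast at h
  rw [h]
  have : (betaQ : ℂ) ≠ 0 := ofReal_ne_zero.2 betaQ_pos.ne'
  field_simp

theorem tendsto_scMap_zero : Tendsto (fun w : ℝ => scMap w) (𝓝[>] 0) (𝓝 0) := by
  have h := intervalIntegral.continuousOn_primitive_interval' (a := 0)
    intervalIntegrable_betaFun (by simp)
  rw [uIcc_of_le zero_le_one] at h
  have h0 := h 0 (by simp)
  rw [ContinuousWithinAt, intervalIntegral.integral_same] at h0
  have h1 := (h0.const_mul scConst).mono_left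
    (nhdsWithin_mono (s := Ioc (0 : ℝ) 1) 0 Ioc_subset_Icc_self)
  rw [mul_zero, nhdsWithin_Ioc_eq_nhdsGT zero_lt_one] at h1
  refine h1.congr' ?_
  filter_upwards [self_mem_nhdsWithin] with w hw
  exact (scMap_ofReal (ne_of_gt hw)).symm

/-! ### The modular function on the quadrilateral -/

theorem thetaP_ofReal {r : ℝ} (h0 : 0 ≤ r) (h1 : r < 1) : ∃ a : ℝ, 0 < a ∧ thetaP r = a := by
  have hs : Summable fun n : ℕ => r ^ (n * (n + 1)) :=
    Summable.of_nonneg_of_le (fun n => pow_nonneg h0 _)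
      (fun n => pow_le_pow_of_le_one h0 h1.le (strictMono_mul_succ.id_le n))
      (summable_geometric_of_lt_one h0 h1)
  refine ⟨∑' n : ℕ, r ^ (n * (n + 1)), hs.tsum_pos (fun n => pow_nonneg h0 _) 0 (by simp), ?_⟩
  rw [thetaP]; push_cast; rfl

theorem thetaThree_ofReal (r : ℝ) : ∃ a : ℝ, thetaThree r = a ∧ (0 ≤ r → 0 < a) := by
  refine ⟨1 + 2 * ∑' n : ℕ, r ^ ((n + 1) ^ 2), ?_, fun h => ?_⟩
  · rw [thetaThree]; push_cast; rfl
  · have : 0 ≤ ∑' n : ℕ, r ^ ((n + 1) ^ 2) := tsum_nonneg fun n => pow_nonneg h _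
    linarith

theorem nome_ofReal_mul_I (y : ℝ) : nome (y * I) = (Real.exp (-(π * y)) : ℝ) := by
  rw [nome, show (π * I * (y * I) : ℂ) = -(π * y) * (I * I) * -1 by ring, I_mul_I]
  push_cast; ring_nf

theorem th3_ofReal_mul_I (y : ℝ) : ∃ a : ℝ, 0 < a ∧ th3 (y * I) = a := by
  rw [th3, nome_ofReal_mul_I]
  obtain ⟨a, ha, ha0⟩ := thetaThree_ofReal (Real.exp (-(π * y)))
  exact ⟨a, ha0 (Real.exp_pos _).le, ha⟩

theorem th2_ofReal_mul_I {y : ℝ} (hy : 0 < y) : ∃ a : ℝ, 0 < a ∧ th2 (y * I) = a := by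
  have h1 : Real.exp (-(π * y)) < 1 := by
    rw [Real.exp_lt_one_iff]; have := mul_pos Real.pi_pos hy; linarith
  obtain ⟨a, ha, ha'⟩ := thetaP_ofReal (Real.exp_pos _).le h1
  refine ⟨2 * Real.exp (-(π * y / 4)) * a, by positivity, ?_⟩
  rw [th2, nome_ofReal_mul_I, ha',
    show (π * I * (y * I) / 4 : ℂ) = (π * y) / 4 * (I * I) by ring, I_mul_I]
  push_cast; ring_nf

theorem kappaSq_ofReal_mul_I {y : ℝ} (hy : 0 < y) :
    ∃ a : ℝ, 0 < a ∧ a < 1 ∧ kappaSq (y * I) = a := by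
  have him : 0 < ((y : ℂ) * I).im := by simpa using hy
  obtain ⟨a, ha, ha'⟩ := th2_ofReal_mul_I hy
  obtain ⟨b, hb, hb'⟩ := th3_ofReal_mul_I y
  obtain ⟨c, hc, -⟩ := thetaThree_ofReal (-Real.exp (-(π * y)))
  have hc' : th4 (y * I) = c := by rw [th4, nome_ofReal_mul_I, ← hc]; push_cast; rfl
  refine ⟨a ^ 4 / b ^ 4, by positivity, ?_, ?_⟩
  · have h1 := one_sub_kappaSq him
    have h4 := th4_ne_zero him
    rw [hc'] at h4
    have hc0 : c ≠ 0 := by exact_mod_cast h4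
    rw [kappaSq_eq, ha', hb', hc'] at h1
    have h2 : 1 - a ^ 4 / b ^ 4 = c ^ 4 / b ^ 4 := by exact_mod_cast h1
    have : 0 < c ^ 4 / b ^ 4 := by positivity
    linarith
  · rw [kappaSq_eq, ha', hb']; push_cast; rfl

/-- This keeps the real part of `θ₄⁴` in `(0, 2)`, which controls the speed of the argument of `κ²`
along horizontal lines. -/
theorem norm_th4_pow_four_sub_one_lt {τ : ℂ} (hτ : 0 < τ.im) (h : 3 / 4 ≤ τ.im ^ 2) :
    ‖th4 τ ^ 4 - 1‖ < 1 := by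
  have hn := norm_nome_le hτ h
  have h1 := norm_thetaThree_sub_le' (h := -nome τ) (by rw [norm_neg]; exact norm_nome_lt_one hτ)
  rw [norm_neg] at h1
  have h2 : ‖nome τ‖ ^ 4 / (1 - ‖nome τ‖) ≤ 0.066 ^ 4 / (1 - 0.066) := by gcongr
  have h3 : ‖th4 τ - 1‖ ≤ 0.133 := by
    calc ‖th4 τ - 1‖ = ‖(thetaThree (-nome τ) - (1 + 2 * -nome τ)) + -(2 * nome τ)‖ := by
          rw [th4]; congr 1; ring
      _ ≤ 2 * (‖nome τ‖ ^ 4 / (1 - ‖nome τ‖)) + 2 * ‖nome τ‖ := by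
          refine (norm_add_le _ _).trans (add_le_add h1 ?_)
          rw [norm_neg, norm_mul, Complex.norm_ofNat]
      _ ≤ 0.133 := by norm_num at h2 ⊢; linarith
  set z := th4 τ - 1
  have e : th4 τ ^ 4 - 1 = z * (4 + z * (6 + z * (4 + z))) := by simp only [z]; ring
  have a1 : ‖4 + z‖ ≤ 4.133 := (norm_add_le _ _).trans (by norm_num; linarith)
  have a2 : ‖6 + z * (4 + z)‖ ≤ 6.6 := by
    refine (norm_add_le _ _).trans ?_
    rw [norm_mul]
    have := mul_le_mul h3 a1 (norm_nonneg _) (by norm_num)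
    norm_num at this ⊢; linarith
  have a3 : ‖4 + z * (6 + z * (4 + z))‖ ≤ 5 := by
    refine (norm_add_le _ _).trans ?_
    rw [norm_mul]
    have := mul_le_mul h3 a2 (norm_nonneg _) (by norm_num)
    norm_num at this ⊢; linarith
  rw [e, norm_mul]
  have := mul_le_mul h3 a3 (norm_nonneg _) (by norm_num)
  norm_num at this ⊢; linarith

/-- Along a horizontal line the logarithmic derivative of `κ²` is `πi θ₄⁴`, so the argument `ψ` of
`κ²` increases strictly, at speed below `2π`. At `x = 0` the value is in `(0, 1)`, at `x = 1` it is
negative; therefore the argument gains exactly `π` and lies in `(0, π)` in between. -/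
theorem kappaSq_im_pos_of_im_sq {x y : ℝ} (hx0 : 0 < x) (hx1 : x < 1) (hy : 0 < y)
    (hy3 : 3 / 4 ≤ y ^ 2) : 0 < (kappaSq (x + y * I)).im := by
  have him : ∀ x : ℝ, 0 < ((x : ℂ) + y * I).im := fun x => by simpa using hy
  have hc : Continuous fun x : ℝ => (π * I * th4 (x + y * I) ^ 4 : ℂ) := by
    refine continuous_const.mul (Continuous.pow ?_ 4)
    refine continuous_iff_continuousAt.2 fun x => ?_
    have hx : ContinuousAt (fun x : ℝ => (x : ℂ) + y * I) x := by fun_prop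
    exact ContinuousAt.comp (g := th4) (f := fun x : ℝ => (x : ℂ) + y * I)
      (differentiableAt_th4 (him x)).continuousAt hx
  set φ : ℝ → ℂ := fun x => ∫ t in (0 : ℝ)..x, (π * I * th4 (t + y * I) ^ 4 : ℂ) with hφ
  have hφd : ∀ x : ℝ, HasDerivAt φ (π * I * th4 (x + y * I) ^ 4) x := fun x =>
    (hc.integral_hasStrictDerivAt 0 x).hasDerivAt
  have hφ0 : φ 0 = 0 := by simp [hφ]
  have hconst : ∀ x : ℝ, kappaSq (x + y * I) = kappaSq (y * I) * exp (φ x) := by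
    have hd : ∀ x : ℝ, HasDerivAt (fun x : ℝ => kappaSq (x + y * I) * exp (-φ x)) 0 x := fun x => by
      have h1 : HasDerivAt (fun x : ℝ => kappaSq (x + y * I))
          (π * I * kappaSq (x + y * I) * th4 (x + y * I) ^ 4) x := by
        have := (HasDerivAt.comp_add_const (x : ℂ) (y * I) (hasDerivAt_kappaSq (him x))).comp_ofReal
        exact this
      refine (h1.mul (hφd x).fun_neg.cexp).congr_deriv ?_
      ring
    intro x
    have := is_const_of_deriv_eq_zero (fun x => (hd x).differentiableAt) (fun x => (hd x).deriv) x 0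
    simp only [hφ0, ofReal_zero, zero_add, neg_zero, exp_zero, mul_one] at this
    rw [← this, mul_assoc, ← exp_add, neg_add_cancel, exp_zero, mul_one]
  set ψ : ℝ → ℝ := fun x => (φ x).im with hψ
  have hψd : ∀ x : ℝ, HasDerivAt ψ (π * (th4 (x + y * I) ^ 4).re) x := fun x => by
    have := imCLM.hasFDerivAt.comp_hasDerivAt x (hφd x)
    refine this.congr_deriv ?_
    simp [mul_re, mul_im, mul_assoc]
  have hre : ∀ x : ℝ, 0 < (th4 (x + y * I) ^ 4).re ∧ (th4 (x + y * I) ^ 4).re < 2 := fun x => by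
    have h1 := norm_th4_pow_four_sub_one_lt (him x) (by simpa using hy3)
    have h2 := (abs_re_le_norm _).trans_lt h1
    rw [sub_re, one_re, abs_lt] at h2
    constructor <;> linarith
  have hmono : StrictMono ψ := strictMono_of_deriv_pos fun x => by
    rw [(hψd x).deriv]; exact mul_pos Real.pi_pos (hre x).1
  have hψ0 : ψ 0 = 0 := by simp [hψ, hφ0]
  have hψ1 : ψ 1 ≤ 2 * π := by
    have := image_sub_le_mul_sub_of_deriv_le (f := ψ) (C := 2 * π)
      (fun x => (hψd x).differentiableAt) (fun x => by
        rw [(hψd x).deriv]; nlinarith [(hre x).2, Real.pi_pos]) zero_le_one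
    simpa [hψ0] using this
  obtain ⟨a, ha, ha1, hay⟩ := kappaSq_ofReal_mul_I hy
  have him_eq : ∀ x : ℝ, kappaSq (x + y * I) = (a * Real.exp (φ x).re : ℝ) * exp (ψ x * I) := by
    intro x
    rw [hconst x, hay]
    conv_lhs => rw [← re_add_im (φ x), exp_add]
    push_cast
    ring
  have hpos : ∀ x : ℝ, 0 < a * Real.exp (φ x).re := fun x => mul_pos ha (Real.exp_pos _)
  have hψπ : ψ 1 = π := by
    have h1 := him_eq 1
    rw [ofReal_one, add_comm, kappaSq_add_one (by simpa using hy), hay] at h1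
    have h2 : (-a / (1 - a) : ℝ) = (a * Real.exp (φ 1).re : ℝ) * exp (ψ 1 * I) := by
      rw [← h1]; push_cast; rfl
    have h3 := congrArg re h2
    have h4 := congrArg im h2
    rw [re_ofReal_mul, exp_ofReal_mul_I_re, ofReal_re] at h3
    rw [im_ofReal_mul, exp_ofReal_mul_I_im, ofReal_im] at h4
    have hs : Real.sin (ψ 1) = 0 := by
      rcases mul_eq_zero.1 h4.symm with h | h
      · exact absurd h (hpos 1).ne'
      · exact h
    have hcos : Real.cos (ψ 1) < 0 := by
      have : -a / (1 - a) < 0 := div_neg_of_neg_of_pos (by linarith) (by linarith)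
      rw [h3] at this
      exact neg_of_mul_neg_right this (hpos 1).le
    obtain ⟨n, hn⟩ := Real.sin_eq_zero_iff.1 hs
    have h0 : 0 < ψ 1 := hψ0 ▸ hmono zero_lt_one
    rw [← hn] at h0 hψ1 hcos
    have hn0 : 0 < n := by exact_mod_cast pos_of_mul_pos_left h0 Real.pi_pos.le
    have hn2 : n ≤ 2 := by exact_mod_cast le_of_mul_le_mul_right hψ1 Real.pi_pos
    -- The integer is 1 or 2; a gain of `2π` would make the value at `x = 1` positive.
    interval_cases n
    · rw [← hn]; simp
    · exfalso
      norm_num at hcos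
  rw [him_eq x, im_ofReal_mul, exp_ofReal_mul_I_im]
  refine mul_pos (hpos x) (Real.sin_pos_of_pos_of_lt_pi (hψ0 ▸ hmono hx0) (hψπ ▸ hmono hx1))

theorem one_sub_inv_im {τ : ℂ} : (1 - 1 / τ).im = τ.im / normSq τ := by
  rw [sub_im, one_im, one_div, inv_im]; ring

theorem kappaSq_one_sub_inv {τ : ℂ} (hτ : 0 < τ.im) : kappaSq (1 - 1 / τ) = 1 - 1 / kappaSq τ := by
  rw [show 1 - 1 / τ = -1 / τ + 1 by ring, kappaSq_add_one (neg_inv_im_pos hτ), kappaSq_neg_inv hτ,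
    sub_sub_cancel]
  have := kappaSq_ne_zero hτ
  field_simp
  ring

theorem kappaSq_one_sub_inv_im_pos {τ : ℂ} (hτ : 0 < τ.im) :
    0 < (kappaSq (1 - 1 / τ)).im ↔ 0 < (kappaSq τ).im := by
  rw [kappaSq_one_sub_inv hτ, one_sub_inv_im, div_pos_iff_of_pos_right
    (normSq_pos.2 (kappaSq_ne_zero hτ))]

theorem kappaSq_im_pos_of_one_le {τ : ℂ} (hτ : 0 < τ.im) (h0 : 0 < τ.re) (h1 : τ.re < 1)
    (h2 : 1 ≤ normSq τ) (h3 : 1 ≤ normSq (τ - 1)) : 0 < (kappaSq τ).im := by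
  rw [← re_add_im τ]
  refine kappaSq_im_pos_of_im_sq h0 h1 hτ ?_
  rw [normSq_apply] at h2 h3
  simp only [sub_re, sub_im, one_re, one_im] at h3
  rcases le_total τ.re (1 / 2) with h | h <;> nlinarith

/-- The rotation `τ ↦ 1 - 1/τ` permutes the vertices `0, 1, ∞` of the ideal triangle and acts on
`κ²` by `w ↦ 1 - 1/w`, which preserves the sign of the imaginary part. It or its inverse moves any
point into the third nearest to `∞`, where `Im τ ≥ √3/2`. -/
theorem kappaSq_im_pos {τ : ℂ} (hτ : 0 < τ.im) (h0 : 0 < τ.re) (h1 : τ.re < 1)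
    (h : τ.re < normSq τ) : 0 < (kappaSq τ).im := by
  have hne := ne_zero_of_im_pos hτ
  have hn : 0 < normSq τ := normSq_pos.2 hne
  have hn1 : normSq (τ - 1) = normSq τ - 2 * τ.re + 1 := by
    simp [normSq_apply]; ring
  have hn1' : 0 < normSq (τ - 1) := normSq_pos.2 (ne_zero_of_im_pos (by simpa using hτ))
  by_cases h23 : 1 ≤ normSq τ ∧ 1 ≤ normSq (τ - 1)
  · exact kappaSq_im_pos_of_one_le hτ h0 h1 h23.1 h23.2
  rcases le_total (normSq τ) (normSq (τ - 1)) with h3 | h3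
  · have h2 : normSq τ ≤ 1 := by
      by_contra! h2
      exact h23 ⟨h2.le, h2.le.trans h3⟩
    rw [← kappaSq_one_sub_inv_im_pos hτ]
    refine kappaSq_im_pos_of_one_le ?_ ?_ ?_ ?_ ?_
    · rw [one_sub_inv_im]; positivity
    · rw [sub_re, one_re, one_div, inv_re, sub_pos, div_lt_one hn]; exact h
    · rw [sub_re, one_re, one_div, inv_re]
      have := div_pos h0 hn
      linarith
    · rw [show 1 - 1 / τ = (τ - 1) / τ by field_simp, normSq_div, one_le_div hn]; exact h3
    · rw [sub_sub_cancel_left, normSq_neg, one_div, normSq_inv]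
      exact (one_le_inv₀ hn).2 h2
  · have h2 : normSq (τ - 1) ≤ 1 := by
      by_contra! h2
      exact h23 ⟨h2.le.trans h3, h2.le⟩
    -- Here the vertex 1 is the near one, and the inverse rotation sends it to `∞`.
    set σ := 1 / (1 - τ) with hσ
    have hne' : 1 - τ ≠ 0 := by rw [← neg_sub, neg_ne_zero]; exact normSq_pos.1 hn1'
    have hσ0 : σ ≠ 0 := one_div_ne_zero hne'
    have e : τ = 1 - 1 / σ := by rw [hσ]; field_simp; ring
    have hns : normSq (1 - τ) = normSq (τ - 1) := by rw [← normSq_neg, neg_sub]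
    have him : σ.im = τ.im / normSq (τ - 1) := by
      rw [hσ, one_div, inv_im, hns]; simp
    have hre : σ.re = (1 - τ.re) / normSq (τ - 1) := by
      rw [hσ, one_div, inv_re, hns]; simp
    have hσim : 0 < σ.im := by rw [him]; positivity
    rw [e, kappaSq_one_sub_inv_im_pos hσim]
    refine kappaSq_im_pos_of_one_le hσim ?_ ?_ ?_ ?_
    · rw [hre]; exact div_pos (by linarith) hn1'
    · rw [hre, div_lt_one hn1']; linarith
    · rw [hσ, one_div, normSq_inv, hns]
      exact (one_le_inv₀ hn1').2 h2
    · have : σ - 1 = τ / (1 - τ) := by rw [hσ]; field_simp; ring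
      rw [this, normSq_div, hns, one_le_div hn1']
      linarith

theorem mem_quadQ_iff {τ : ℂ} : τ ∈ quadQ ↔
    0 < τ.im ∧ |τ.re| < 1 ∧ τ.re < normSq τ ∧ -τ.re < normSq τ := by
  have key : ∀ c : ℝ, 1 / 2 < ‖τ - c / 2‖ ↔ 1 < 4 * normSq τ - 4 * c * τ.re + c ^ 2 := fun c => by
    rw [← abs_of_pos (show (0 : ℝ) < 1 / 2 by norm_num), ← abs_norm, ← sq_lt_sq,
      ← normSq_eq_norm_sq, normSq_apply, normSq_apply]
    simp
    constructor <;> intro h <;> nlinarith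
  have k1 := key 1
  have k2 := key (-1)
  push_cast at k1 k2
  rw [neg_div, sub_neg_eq_add] at k2
  simp only [quadQ, mem_ofPred_eq]
  rw [k1, k2]
  refine and_congr_right fun _ => and_congr_right fun _ => and_congr ?_ ?_ <;>
  constructor <;> intro h <;> linarith

theorem kappaSq_mem_slitDomain {τ : ℂ} (hτ : τ ∈ quadQ) : kappaSq τ ∈ slitDomain := by
  obtain ⟨him, hre, h1, h2⟩ := mem_quadQ_iff.1 hτ
  rw [abs_lt] at hre
  have key : (kappaSq τ).im ≠ 0 → kappaSq τ ∈ slitDomain := fun h =>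
    ⟨mem_slitPlane_iff.2 (Or.inr h), mem_slitPlane_iff.2 (Or.inr (by simpa using h))⟩
  rcases lt_trichotomy τ.re 0 with h | h | h
  · refine key ?_
    -- On the left half, `τ + 1` lies in the triangle; a real `κ²(τ)` would make `κ²(τ + 1) = -κ²/(1
    -- - κ²)` real.
    have him' : 0 < (τ + 1).im := by simpa using him
    have h3 : 0 < (kappaSq (τ + 1)).im := by
      refine kappaSq_im_pos him' (by simp; linarith) (by simpa using h) ?_
      rw [normSq_apply] at h2 ⊢
      simp; nlinarith
    intro h0
    rw [kappaSq_add_one him, ← re_add_im (kappaSq τ), h0] at h3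
    have : -((kappaSq τ).re + (0 : ℝ) * I : ℂ) / (1 - ((kappaSq τ).re + (0 : ℝ) * I))
        = ((-(kappaSq τ).re / (1 - (kappaSq τ).re) : ℝ) : ℂ) := by push_cast; ring
    rw [this, ofReal_im] at h3
    exact lt_irrefl _ h3
  · obtain ⟨a, ha0, ha1, ha⟩ := kappaSq_ofReal_mul_I him
    have : τ = τ.im * I := by
      conv_lhs => rw [← re_add_im τ, h, ofReal_zero, zero_add]
    rw [this, ha]
    refine ⟨ofReal_mem_slitPlane.2 ha0, ?_⟩
    rw [← ofReal_one, ← ofReal_sub]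
    exact ofReal_mem_slitPlane.2 (by linarith)
  · exact key (kappaSq_im_pos him h hre.2 h1).ne'

/-! ### The Cayley transform -/

/-- The Cayley transform from the upper half-plane to the disc. -/
noncomputable def cay (τ : ℂ) : ℂ := (τ - I) / (τ + I)

/-- The inverse of the Cayley transform. -/
noncomputable def cayInv (z : ℂ) : ℂ := I * (1 + z) / (1 - z)

theorem add_I_ne_zero {τ : ℂ} (hτ : 0 < τ.im) : τ + I ≠ 0 := by
  intro h
  have := congrArg im h
  simp at this
  linarith

theorem one_sub_ne_zero_of_norm_lt {z : ℂ} (hz : ‖z‖ < 1) : 1 - z ≠ 0 := by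
  intro h
  rw [sub_eq_zero] at h
  rw [← h, norm_one] at hz
  exact lt_irrefl _ hz

theorem norm_cay_lt_one {τ : ℂ} (hτ : 0 < τ.im) : ‖cay τ‖ < 1 := by
  rw [cay, norm_div, div_lt_one (norm_pos_iff.2 (add_I_ne_zero hτ)), ← abs_norm, ← abs_norm (τ + I),
    ← sq_lt_sq, ← normSq_eq_norm_sq, ← normSq_eq_norm_sq, normSq_apply, normSq_apply]
  simp
  nlinarith

theorem cayInv_im_pos {z : ℂ} (hz : ‖z‖ < 1) : 0 < (cayInv z).im := by
  have h0 := one_sub_ne_zero_of_norm_lt hz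
  have h1 : (cayInv z).im = (1 - normSq z) / normSq (1 - z) := by
    rw [cayInv, div_im, normSq_apply, normSq_apply]
    simp
    ring
  rw [h1]
  refine div_pos ?_ (normSq_pos.2 h0)
  rw [normSq_eq_norm_sq]
  nlinarith [norm_nonneg z]

theorem cayInv_cay {τ : ℂ} (hτ : 0 < τ.im) : cayInv (cay τ) = τ := by
  have h := add_I_ne_zero hτ
  have h1 : 1 - cay τ = 2 * I / (τ + I) := by rw [cay]; field_simp; ring
  have h2 : 1 + cay τ = 2 * τ / (τ + I) := by rw [cay]; field_simp; ring
  rw [cayInv, h1, h2]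
  field_simp

theorem cay_cayInv {z : ℂ} (hz : ‖z‖ < 1) : cay (cayInv z) = z := by
  have h := one_sub_ne_zero_of_norm_lt hz
  have h1 : cayInv z - I = 2 * I * z / (1 - z) := by rw [cayInv]; field_simp; ring
  have h2 : cayInv z + I = 2 * I / (1 - z) := by rw [cayInv]; field_simp; ring
  rw [cay, h1, h2]
  field_simp

theorem hasDerivAt_cay {τ : ℂ} (hτ : 0 < τ.im) : HasDerivAt cay (2 * I / (τ + I) ^ 2) τ := by
  have := ((hasDerivAt_id τ).sub_const I).div ((hasDerivAt_id τ).add_const I) (add_I_ne_zero hτ)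
  refine this.congr_deriv ?_
  simp only [id]
  ring

theorem hasDerivAt_cayInv {z : ℂ} (hz : ‖z‖ < 1) :
    HasDerivAt cayInv (2 * I / (1 - z) ^ 2) z := by
  have := (((hasDerivAt_id z).const_add 1).const_mul I).div ((hasDerivAt_id z).const_sub 1)
    (one_sub_ne_zero_of_norm_lt hz)
  refine this.congr_deriv ?_
  simp only [id]
  ring

/-! ### The developing map -/

/-- The weight two form `θ₂ θ₃² θ₄`. -/
noncomputable def thProd (τ : ℂ) : ℂ := th2 τ * th3 τ ^ 2 * th4 τ

theorem differentiableAt_thProd {τ : ℂ} (hτ : 0 < τ.im) : DifferentiableAt ℂ thProd τ :=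
  ((differentiableAt_th2 hτ).mul ((differentiableAt_th3 hτ).pow 2)).mul (differentiableAt_th4 hτ)

theorem thProd_ne_zero {τ : ℂ} (hτ : 0 < τ.im) : thProd τ ≠ 0 :=
  mul_ne_zero (mul_ne_zero (th2_ne_zero hτ) (pow_ne_zero 2 (th3_ne_zero hτ))) (th4_ne_zero hτ)

theorem thProd_neg_inv {τ : ℂ} (hτ : 0 < τ.im) : thProd (-1 / τ) = -τ ^ 2 * thProd τ := by
  rw [thProd, th2_neg_inv hτ, th3_neg_inv hτ, th4_neg_inv hτ, thProd, ← sFac_pow_four]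
  ring

theorem exp_pi_div_four_sq : exp (π * I / 4) ^ 2 = I := by
  rw [← exp_nat_mul, show ((2 : ℕ) * (π * I / 4) : ℂ) = π / 2 * I by push_cast; ring,
    exp_pi_div_two_mul_I]

theorem th2_add_two (τ : ℂ) : th2 (τ + 2) = I * th2 τ := by
  rw [show τ + 2 = τ + 1 + 1 by ring, th2_add_one, th2_add_one, ← mul_assoc, ← sq,
    exp_pi_div_four_sq]

theorem thProd_add_two (τ : ℂ) : thProd (τ + 2) = I * thProd τ := by
  rw [thProd, th2_add_two, show τ + 2 = τ + 1 + 1 by ring, th3_add_one, th4_add_one, th4_add_one,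
    th3_add_one, thProd]
  ring

/-- The constant in the derivative of the developing map. -/
noncomputable def devC : ℂ := exp (π * I / 4) * scC * (π * I)

theorem norm_exp_pi_div_four : ‖exp (π * I / 4)‖ = 1 := by
  rw [show (π * I / 4 : ℂ) = ((π / 4 : ℝ) : ℂ) * I by push_cast; ring, norm_exp_ofReal_mul_I]

theorem norm_devC : ‖devC‖ = scC * π := by
  rw [devC, norm_mul, norm_mul, norm_mul, norm_exp_pi_div_four, norm_I, norm_real, norm_real,
    Real.norm_of_nonneg scC_pos.le, Real.norm_of_nonneg Real.pi_pos.le]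
  ring

theorem devC_ne_zero : devC ≠ 0 :=
  norm_pos_iff.1 (by rw [norm_devC]; exact mul_pos scC_pos Real.pi_pos)

/-- The form is integrated on the disc, the factor `2i/(1 - z)²` being the derivative of the inverse
Cayley transform, so that holomorphic functions on a ball supply the primitive. -/
theorem exists_primitive : ∃ f : ℂ → ℂ, f 0 = rectCenter 1 ∧ ∀ z : ℂ, ‖z‖ < 1 →
    HasDerivAt f (devC * thProd (cayInv z) * (2 * I / (1 - z) ^ 2)) z := by
  have hd : DifferentiableOn ℂ (fun z => devC * thProd (cayInv z) * (2 * I / (1 - z) ^ 2))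
      (Metric.ball 0 1) := by
    intro z hz
    rw [mem_ball_zero_iff] at hz
    have h1 : DifferentiableAt ℂ (fun z => thProd (cayInv z)) z :=
      (differentiableAt_thProd (cayInv_im_pos hz)).comp z (hasDerivAt_cayInv hz).differentiableAt
    have h2 : DifferentiableAt ℂ (fun z : ℂ => 2 * I / (1 - z) ^ 2) z :=
      (differentiableAt_const _).div (by fun_prop)
        (pow_ne_zero 2 (one_sub_ne_zero_of_norm_lt hz))
    exact ((h1.const_mul devC).mul h2).differentiableWithinAt
  obtain ⟨f, hf0, hf⟩ := hd.isExactOn_ball.with_val_at 0 (rectCenter 1)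
  exact ⟨f, hf0, fun z hz => hf z (by simpa using hz)⟩

/-- The covering of the complement of the lattice by the unit disc. -/
noncomputable def discMap : ℂ → ℂ := Classical.choose exists_primitive

theorem discMap_zero : discMap 0 = rectCenter 1 := (Classical.choose_spec exists_primitive).1

theorem hasDerivAt_discMap {z : ℂ} (hz : ‖z‖ < 1) :
    HasDerivAt discMap (devC * thProd (cayInv z) * (2 * I / (1 - z) ^ 2)) z :=
  (Classical.choose_spec exists_primitive).2 z hz

/-- The covering of the complement of the lattice by the upper half-plane. -/
noncomputable def dev (τ : ℂ) : ℂ := discMap (cay τ)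

theorem dev_I : dev I = π + π * I := by
  rw [dev, cay, sub_self, zero_div, discMap_zero, rectCenter]; simp

theorem hasDerivAt_dev {τ : ℂ} (hτ : 0 < τ.im) : HasDerivAt dev (devC * thProd τ) τ := by
  refine ((hasDerivAt_discMap (norm_cay_lt_one hτ)).comp τ (hasDerivAt_cay hτ)).congr_deriv ?_
  have h := add_I_ne_zero hτ
  have h1 : 1 - cay τ = 2 * I / (τ + I) := by rw [cay]; field_simp; ring
  rw [cayInv_cay hτ, h1]
  have := I_ne_zero
  field_simp

theorem differentiableOn_dev : DifferentiableOn ℂ dev {τ | 0 < τ.im} := fun _ hτ =>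
  (hasDerivAt_dev hτ).differentiableAt.differentiableWithinAt

/-- Two functions with the same derivative on a preconnected open set that agree at a point. -/
theorem eqOn_of_hasDerivAt {s : Set ℂ} (hs : IsOpen s) (hs' : IsPreconnected s) {f g f' : ℂ → ℂ}
    (hf : ∀ z ∈ s, HasDerivAt f (f' z) z) (hg : ∀ z ∈ s, HasDerivAt g (f' z) z) {x : ℂ}
    (hx : x ∈ s) (hfg : f x = g x) : EqOn f g s :=
  hs.eqOn_of_deriv_eq hs' (fun z hz => (hf z hz).differentiableAt.differentiableWithinAt)
    (fun z hz => (hg z hz).differentiableAt.differentiableWithinAt)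
    (fun z hz => (hf z hz).deriv.trans (hg z hz).deriv.symm) hx hfg

/-- Both sides have the same derivative, as `θ₂θ₃²θ₄` is anti-invariant of weight two under `S`, and
they agree at the fixed point `i`. -/
theorem dev_neg_inv {τ : ℂ} (hτ : 0 < τ.im) : dev (-1 / τ) = 2 * π + 2 * π * I - dev τ := by
  refine eqOn_of_hasDerivAt (f := fun τ => dev (-1 / τ))
    (g := fun τ => 2 * π + 2 * π * I - dev τ) (f' := fun τ => -(devC * thProd τ))
    isOpen_im_pos convex_im_pos.isPreconnected ?_ ?_
    (x := I) (by simp) ?_ hτ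
  · intro τ hτ
    refine ((hasDerivAt_dev (neg_inv_im_pos hτ)).comp τ (hasDerivAt_neg_inv hτ)).congr_deriv ?_
    have := ne_zero_of_im_pos hτ
    rw [thProd_neg_inv hτ]
    field_simp
  · intro τ hτ
    exact (hasDerivAt_dev hτ).const_sub _
  · rw [neg_div, one_div, inv_I, neg_neg, dev_I]; ring

/-! ### Comparison with the Schwarz–Christoffel map -/

theorem isOpen_quadQ : IsOpen quadQ := by
  have h1 : IsOpen {τ : ℂ | |τ.re| < 1} :=
    isOpen_lt (continuous_abs.comp continuous_re) continuous_const
  have h2 : ∀ c : ℂ, IsOpen {τ : ℂ | 1 / 2 < ‖τ - c‖} := fun c =>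
    isOpen_lt continuous_const (by fun_prop)
  have h3 : IsOpen {τ : ℂ | 1 / 2 < ‖τ + 1 / 2‖} := isOpen_lt continuous_const (by fun_prop)
  exact isOpen_im_pos.inter (h1.inter ((h2 _).inter h3))

/-- From every point the vertical ray upwards stays in the region and meets the convex half-strip
`Im τ > 1`. -/
theorem isPreconnected_quadQ : IsPreconnected quadQ := by
  set A : Set ℂ := {τ | |τ.re| < 1 ∧ 1 < τ.im} with hA
  have hAc : Convex ℝ A := by
    have : A = {τ : ℂ | -1 < τ.re} ∩ {τ | τ.re < 1} ∩ {τ | 1 < τ.im} := by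
      ext τ; simp [A, abs_lt]
    rw [this]
    exact ((convex_halfSpace_re_gt _).inter (convex_halfSpace_re_lt _)).inter
      (convex_halfSpace_im_gt _)
  have hAQ : A ⊆ quadQ := fun τ hτ => by
    rw [mem_quadQ_iff, normSq_apply]
    have := abs_lt.1 hτ.1
    have h1 := hτ.2
    refine ⟨by linarith, hτ.1, ?_, ?_⟩ <;> nlinarith
  refine isPreconnected_of_forall (2 * I) fun τ hτ => ?_
  set R : Set ℂ := {σ | σ.re = τ.re ∧ τ.im ≤ σ.im}
  have hRc : Convex ℝ R :=
    (convex_hyperplane (f := re) ⟨fun _ _ => add_re _ _, fun c z => by simp⟩ τ.re).inter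
      (convex_halfSpace_im_ge τ.im)
  have hRQ : R ⊆ quadQ := by
    rintro σ ⟨h1, h2⟩
    rw [mem_quadQ_iff, normSq_apply] at hτ ⊢
    rw [h1]
    have h3 : τ.im * τ.im ≤ σ.im * σ.im := mul_self_le_mul_self hτ.1.le h2
    exact ⟨hτ.1.trans_le h2, hτ.2.1, by linarith [hτ.2.2.1], by linarith [hτ.2.2.2]⟩
  refine ⟨A ∪ R, union_subset hAQ hRQ, Or.inl (by simp [A]), Or.inr ⟨rfl, le_rfl⟩, ?_⟩
  refine hAc.isPreconnected.union (τ.re + (max τ.im 2 : ℝ) * I) ?_ ?_ hRc.isPreconnected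
  · refine ⟨by simpa using (mem_quadQ_iff.1 hτ).2.1, ?_⟩
    simp
  · refine ⟨by simp, ?_⟩
    simp

theorem ofReal_mul_I_mem_quadQ {y : ℝ} (hy : 0 < y) : (y : ℂ) * I ∈ quadQ := by
  rw [mem_quadQ_iff, normSq_apply]
  simp [hy]

theorem I_mem_quadQ : I ∈ quadQ := by simpa using ofReal_mul_I_mem_quadQ one_pos

/-- Two continuous fourth roots of a non-vanishing function on a connected set agree once they agree
at one point. This identifies the principal branches in `g` with theta quotients, positive at `i`.
-/
theorem cpow_quarter_eqOn {u g : ℂ → ℂ} (hu : ContinuousOn u quadQ)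
    (hus : ∀ τ ∈ quadQ, u τ ∈ slitPlane) (hg : ContinuousOn g quadQ)
    (hgu : ∀ τ ∈ quadQ, g τ ^ 4 = u τ) {a : ℝ} (ha : 0 < a) (haI : g I = a) :
    EqOn (fun τ => u τ ^ (1 / 4 : ℂ)) g quadQ := by
  have hf : ContinuousOn (fun τ => u τ ^ (1 / 4 : ℂ)) quadQ := hu.cpow_const hus
  have hf4 : ∀ τ, (u τ ^ (1 / 4 : ℂ)) ^ 4 = u τ := fun τ => by
    rw [← cpow_nat_mul]; norm_num
  have hg0 : ∀ {τ}, τ ∈ quadQ → g τ ≠ 0 := fun {τ} hτ h => by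
    have := hgu τ hτ
    rw [h] at this
    exact slitPlane_ne_zero (hus τ hτ) (by rw [← this]; norm_num)
  have hI : u I ^ (1 / 4 : ℂ) = g I := by
    rw [← hgu I I_mem_quadQ, haI, ← ofReal_pow, show (1 / 4 : ℂ) = ((1 / 4 : ℝ) : ℂ) by norm_num,
      ← ofReal_cpow (by positivity)]
    congr 1
    have := Real.pow_rpow_inv_natCast ha.le (n := 4) (by norm_num)
    norm_num at this ⊢
    exact this
  have hsq : EqOn (fun τ => (u τ ^ (1 / 4 : ℂ)) ^ 2) (fun τ => g τ ^ 2) quadQ := by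
    refine isPreconnected_quadQ.eq_of_sq_eq (hf.pow 2) (hg.pow 2) (fun τ hτ => ?_)
      (fun hτ => pow_ne_zero 2 (hg0 hτ)) I_mem_quadQ (by rw [hI])
    simp only [Pi.pow_apply, ← pow_mul]
    norm_num
    rw [hgu τ hτ, hf4]
  exact isPreconnected_quadQ.eq_of_sq_eq hf hg hsq hg0 I_mem_quadQ hI

theorem th4_I : th4 I = th2 I := by
  have h := th2_neg_inv (τ := I) (by simp)
  rw [neg_div, one_div, inv_I, neg_neg, sFac, neg_mul, I_mul_I, neg_neg, one_cpow, one_mul] at h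
  exact h.symm

theorem cpow_neg_three_quarters (u : ℂ) : u ^ (-3 / 4 : ℂ) = ((u ^ (1 / 4 : ℂ)) ^ 3)⁻¹ := by
  rw [← cpow_nat_mul, ← cpow_neg]; norm_num

theorem im_pos_of_mem_quadQ {τ : ℂ} (hτ : τ ∈ quadQ) : 0 < τ.im := hτ.1

theorem exp_pi_div_four_mul_sqrt_two : exp (π * I / 4) * (√2 : ℝ) = 1 + I := by
  have h1 : exp (π * I / 4) = Real.cos (π / 4) + Real.sin (π / 4) * I := by
    rw [show (π * I / 4 : ℂ) = ((π / 4 : ℝ) : ℂ) * I by push_cast; ring, exp_mul_I,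
      ofReal_cos, ofReal_sin]
  rw [h1, Real.cos_pi_div_four, Real.sin_pi_div_four]
  have h2 : ((√2 : ℝ) : ℂ) * (√2 : ℝ) = 2 := by
    rw [← ofReal_mul, Real.mul_self_sqrt (by norm_num)]; norm_num
  push_cast
  linear_combination (1 / 2 + I / 2) * h2

/-- With `κ² = (θ₂/θ₃)⁴` and `1 - κ² = (θ₄/θ₃)⁴`, the chain rule leaves `πi C θ₂θ₃²θ₄`, and the
values at `i` agree. -/
theorem dev_eq_scMap {τ : ℂ} (hτ : τ ∈ quadQ) :
    dev τ = exp (π * I / 4) * scMap (kappaSq τ) := by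
  have hkc : ContinuousOn kappaSq quadQ := fun τ hτ =>
    (differentiableAt_kappaSq hτ.1).continuousAt.continuousWithinAt
  have hc2 : ContinuousOn th2 quadQ := fun τ hτ =>
    (differentiableAt_th2 hτ.1).continuousAt.continuousWithinAt
  have hc3 : ContinuousOn th3 quadQ := fun τ hτ =>
    (differentiableAt_th3 hτ.1).continuousAt.continuousWithinAt
  have hc4 : ContinuousOn th4 quadQ := fun τ hτ =>
    (differentiableAt_th4 hτ.1).continuousAt.continuousWithinAt
  obtain ⟨a, ha, ha'⟩ := th2_ofReal_mul_I one_pos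
  obtain ⟨b, hb, hb'⟩ := th3_ofReal_mul_I 1
  rw [ofReal_one, one_mul] at ha' hb'
  have e1 := cpow_quarter_eqOn (u := kappaSq) (g := fun τ => th2 τ / th3 τ) hkc
    (fun τ hτ => (kappaSq_mem_slitDomain hτ).1)
    (hc2.div hc3 fun τ hτ => th3_ne_zero hτ.1)
    (fun τ _ => by rw [kappaSq_eq, div_pow]) (div_pos ha hb) (by rw [ha', hb']; push_cast; rfl)
  have e2 := cpow_quarter_eqOn (u := fun τ => 1 - kappaSq τ) (g := fun τ => th4 τ / th3 τ)
    (continuousOn_const.sub hkc)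
    (fun τ hτ => (kappaSq_mem_slitDomain hτ).2)
    (hc4.div hc3 fun τ hτ => th3_ne_zero hτ.1)
    (fun τ hτ => by rw [one_sub_kappaSq hτ.1, div_pow]) (div_pos ha hb)
    (by rw [th4_I, ha', hb']; push_cast; rfl)
  refine eqOn_of_hasDerivAt (f' := fun τ => devC * thProd τ)
    (g := fun τ => exp (π * I / 4) * scMap (kappaSq τ)) isOpen_quadQ isPreconnected_quadQ
    (fun τ hτ => hasDerivAt_dev hτ.1) (fun τ hτ => ?_) I_mem_quadQ ?_ hτ
  · have h := ((hasDerivAt_scMap (kappaSq_mem_slitDomain hτ)).comp τ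
      (hasDerivAt_kappaSq hτ.1)).const_mul (exp (π * I / 4))
    refine h.congr_deriv ?_
    have e1' := e1 hτ
    have e2' := e2 hτ
    simp only at e1' e2'
    rw [cpow_neg_three_quarters, cpow_neg_three_quarters, e1', e2', kappaSq_eq, scConst_eq, devC,
      thProd]
    have h2 := th2_ne_zero hτ.1
    have h3 := th3_ne_zero hτ.1
    have h4 := th4_ne_zero hτ.1
    field_simp
  · rw [dev_I, kappaSq_I, scMap_half]
    linear_combination -(π : ℂ) * exp_pi_div_four_mul_sqrt_two

/-! ### Behaviour at infinity and translations -/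

theorem tendsto_mul_I_comap : Tendsto (fun y : ℝ => (y : ℂ) * I) atTop (comap im atTop) := by
  rw [tendsto_comap_iff]
  exact tendsto_id.congr fun y => by simp

theorem tendsto_kappaSq : Tendsto kappaSq (comap im atTop) (𝓝 0) := by
  have hP := (differentiableAt_thetaP (h := 0) (by simp)).continuousAt
  have h3 := (differentiableAt_thetaThree (h := 0) (by simp)).continuousAt
  have hc : ContinuousAt (fun h => 16 * h * thetaP h ^ 4 / thetaThree h ^ 4) 0 := by
    refine ContinuousAt.div ((continuousAt_const.mul continuousAt_id).mul (hP.pow 4)) (h3.pow 4) ?_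
    simp [thetaThree_zero]
  have := hc.tendsto
  simp only [mul_zero, zero_mul, zero_div] at this
  refine (this.comp tendsto_nome).congr fun τ => ?_
  rw [Function.comp, kappaSq_eq, th2_pow_four, th3]

theorem tendsto_dev_mul_I : Tendsto (fun y : ℝ => dev (y * I)) atTop (𝓝 0) := by
  have h1 : Tendsto (fun y : ℝ => (kappaSq (y * I)).re) atTop (𝓝[>] 0) := by
    rw [tendsto_nhdsWithin_iff]
    constructor
    · have := (continuous_re.tendsto 0).comp (tendsto_kappaSq.comp tendsto_mul_I_comap)
      exact this
    · filter_upwards [eventually_gt_atTop 0] with y hy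
      obtain ⟨a, ha, -, ha'⟩ := kappaSq_ofReal_mul_I hy
      rw [ha', ofReal_re]
      exact ha
  have h2 := (tendsto_scMap_zero.comp h1).const_mul (exp (π * I / 4))
  rw [mul_zero] at h2
  refine h2.congr' ?_
  filter_upwards [eventually_gt_atTop 0] with y hy
  obtain ⟨a, ha, -, ha'⟩ := kappaSq_ofReal_mul_I hy
  rw [dev_eq_scMap (ofReal_mul_I_mem_quadQ hy), Function.comp, ha', ofReal_re]

/-- The holomorphic factor of `θ₂ θ₃² θ₄`. -/
theorem thProd_eq (τ : ℂ) : thProd τ = 2 * exp (π * I * τ / 4) *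
    (thetaP (nome τ) * thetaThree (nome τ) ^ 2 * thetaThree (-nome τ)) := by
  rw [thProd, th2, th3, th4]; ring

theorem norm_exp_quarter (τ : ℂ) : ‖exp (π * I * τ / 4)‖ = Real.exp (-(π * τ.im / 4)) := by
  rw [norm_exp, show (π * I * τ / 4 : ℂ) = ((π / 4 : ℝ) : ℂ) * (I * τ) by push_cast; ring,
    re_ofReal_mul]
  congr 1; simp; ring

theorem tendsto_exp_quarter : Tendsto (fun τ : ℂ => exp (π * I * τ / 4)) (comap im atTop) (𝓝 0) := by
  rw [tendsto_zero_iff_norm_tendsto_zero]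
  have : Tendsto (fun y : ℝ => Real.exp (-(π / 4 * y))) atTop (𝓝 0) :=
    Real.tendsto_exp_neg_atTop_nhds_zero.comp
      (tendsto_id.const_mul_atTop (by positivity : 0 < π / 4))
  refine (this.comp tendsto_comap).congr fun τ => ?_
  rw [norm_exp_quarter, Function.comp]
  ring_nf

theorem tendsto_thProd : Tendsto thProd (comap im atTop) (𝓝 0) := by
  have hP := (differentiableAt_thetaP (h := 0) (by simp)).continuousAt
  have h3 := (differentiableAt_thetaThree (h := 0) (by simp)).continuousAt
  have h4 : ContinuousAt (fun h => thetaThree (-h)) 0 :=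
    ContinuousAt.comp (x := (0 : ℂ)) (g := thetaThree) (f := fun h => -h)
      (differentiableAt_thetaThree (by simp)).continuousAt continuous_neg.continuousAt
  have h5 := ((hP.mul (h3.pow 2)).mul h4).tendsto.comp tendsto_nome
  have h6 := (tendsto_exp_quarter.const_mul 2).mul h5
  rw [mul_zero, zero_mul] at h6
  exact h6.congr fun τ => (thProd_eq τ).symm

theorem norm_sub_le_of_line {f f' : ℂ → ℂ} {C p : ℝ} (hp : 0 ≤ p) {τ : ℂ}
    (hf : ∀ σ : ℂ, σ.im = τ.im → HasDerivAt f (f' σ) σ)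
    (hC : ∀ σ : ℂ, σ.im = τ.im → ‖f' σ‖ ≤ C) : ‖f (τ + p) - f τ‖ ≤ C * p := by
  have hc : Convex ℝ {σ : ℂ | σ.im = τ.im} :=
    convex_hyperplane (f := im) ⟨fun _ _ => add_im _ _, fun c z => by simp⟩ τ.im
  have hm : τ + p ∈ {σ : ℂ | σ.im = τ.im} := by simp
  have := hc.norm_image_sub_le_of_norm_hasDerivWithin_le (f := f) (f' := f') (x := τ) (y := τ + p)
    (fun σ hσ => (hf σ hσ).hasDerivWithinAt) (fun σ hσ => hC σ hσ) rfl hm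
  rwa [add_sub_cancel_left, norm_real, Real.norm_of_nonneg hp] at this

/-- Since `θ₂θ₃²θ₄` is multiplied by `i`, the identity holds up to a constant `k`. Along the
imaginary axis `dev` tends to `0`, and so does the increment over a horizontal step of length 2,
because the derivative decays; hence `k = 0`. -/
theorem dev_add_two {τ : ℂ} (hτ : 0 < τ.im) : dev (τ + 2) = I * dev τ := by
  set k := dev (I + 2) - I * dev I with hk
  have key : ∀ τ : ℂ, 0 < τ.im → dev (τ + 2) = I * dev τ + k := fun τ hτ => by
    refine eqOn_of_hasDerivAt (f' := fun τ => devC * (I * thProd τ)) (f := fun τ => dev (τ + 2))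
      (g := fun τ => I * dev τ + k) isOpen_im_pos convex_im_pos.isPreconnected
      (fun τ hτ => ?_) (fun τ hτ => ?_) (x := I) (by simp) (by rw [hk]; ring) hτ
    · have := HasDerivAt.comp_add_const τ 2 (hasDerivAt_dev (τ := τ + 2) (by simpa using hτ))
      rwa [thProd_add_two] at this
    · refine (((hasDerivAt_dev hτ).const_mul I).add_const k).congr_deriv ?_
      ring
  have hk0 : k = 0 := by
    have h1 : Tendsto (fun y : ℝ => dev (y * I + (2 : ℝ)) - dev (y * I)) atTop (𝓝 0) := by
      rw [Metric.tendsto_nhds]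
      intro ε hε
      have h2 := (tendsto_thProd.const_mul devC).norm
      rw [mul_zero, norm_zero] at h2
      have h3 := h2.eventually_lt_const (show 0 < ε / 4 by positivity)
      rw [eventually_comap, eventually_atTop] at h3
      obtain ⟨Y, hY⟩ := h3
      filter_upwards [eventually_ge_atTop Y, eventually_gt_atTop 0] with y hy hy0
      rw [dist_zero_right]
      have := norm_sub_le_of_line (f := dev) (f' := fun τ => devC * thProd τ) (C := ε / 4) (p := 2)
        two_pos.le (τ := y * I) (fun σ hσ => hasDerivAt_dev (by rw [hσ]; simpa using hy0))
        (fun σ hσ => (hY y hy σ (by rw [hσ]; simp)).le)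
      linarith
    have h4 := (h1.add (tendsto_dev_mul_I.const_mul (1 - I)))
    rw [mul_zero, add_zero] at h4
    refine tendsto_nhds_unique (tendsto_const_nhds (x := k) (f := atTop (α := ℝ))) (h4.congr' ?_)
    filter_upwards [eventually_gt_atTop 0] with y hy
    have := key (y * I) (by simpa using hy)
    push_cast
    rw [this]; ring
  rw [key τ hτ, hk0, add_zero]

/-! ### Quantitative estimates -/

theorem norm_I_sub_one : ‖I - 1‖ = √2 := by
  rw [Complex.norm_def, normSq_apply]; norm_num

/-- If a period step multiplies `f` by `i`, then `|f(τ + p) - f(τ)| = √2 |f(τ)|`, so a derivative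
bound on one horizontal line bounds `f` itself, with no integration out to the cusp. -/
theorem norm_le_of_add_eq_I_mul {f f' : ℂ → ℂ} {C p : ℝ} (hp : 0 ≤ p) {τ : ℂ}
    (hf : ∀ σ : ℂ, σ.im = τ.im → HasDerivAt f (f' σ) σ)
    (hC : ∀ σ : ℂ, σ.im = τ.im → ‖f' σ‖ ≤ C) (hper : f (τ + p) = I * f τ) :
    √2 * ‖f τ‖ ≤ C * p := by
  have := norm_sub_le_of_line hp hf hC
  rwa [hper, show I * f τ - f τ = (I - 1) * f τ by ring, norm_mul, norm_I_sub_one] at this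

/-- The product of theta series entering `θ₂ θ₃² θ₄`. -/
noncomputable def qProd (h : ℂ) : ℂ := thetaP h * thetaThree h ^ 2 * thetaThree (-h)

/-- The subtracted term integrates `2 e^{πiτ/4}(1 + ah + bh² + ch³)` termwise; the exponents `n +
1/4` produce the coefficients `4/(4n + 1)`. It too is multiplied by `i` under `τ ↦ τ + 2`, so the
previous bound applies to the difference. -/
theorem norm_dev_sub_le (a b c : ℂ) {δ : ℝ} {τ : ℂ} (hτ : 0 < τ.im)
    (hδ : ∀ h : ℂ, ‖h‖ = ‖nome τ‖ → ‖qProd h - (1 + a * h + b * h ^ 2 + c * h ^ 3)‖ ≤ δ) :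
    ‖dev τ - devC * 2 * exp (π * I * τ / 4) * (4 + 4 / 5 * a * nome τ + 4 / 9 * b * nome τ ^ 2
      + 4 / 13 * c * nome τ ^ 3) / (π * I)‖ ≤
    √2 * (scC * π * (2 * Real.exp (-(π * τ.im / 4)) * δ)) := by
  have hpi : (π : ℂ) * I ≠ 0 := mul_ne_zero (ofReal_ne_zero.2 Real.pi_ne_zero) I_ne_zero
  have key := norm_le_of_add_eq_I_mul (f := fun τ => dev τ - devC * 2 * exp (π * I * τ / 4) *
      (4 + 4 / 5 * a * nome τ + 4 / 9 * b * nome τ ^ 2 + 4 / 13 * c * nome τ ^ 3) / (π * I))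
    (f' := fun τ => devC * (2 * exp (π * I * τ / 4) *
      (qProd (nome τ) - (1 + a * nome τ + b * nome τ ^ 2 + c * nome τ ^ 3))))
    (C := scC * π * (2 * Real.exp (-(π * τ.im / 4)) * δ)) (p := 2) two_pos.le (τ := τ) ?_ ?_ ?_
  · have h2 : √2 * √2 = 2 := Real.mul_self_sqrt (by norm_num)
    have h0 : 0 < √2 := by positivity
    refine le_of_mul_le_mul_left (key.trans_eq ?_) h0
    rw [← mul_assoc √2 √2, h2]
    ring
  · intro σ hσ
    have hσ' : 0 < σ.im := hσ ▸ hτ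
    have he : HasDerivAt (fun τ : ℂ => exp (π * I * τ / 4)) (exp (π * I * σ / 4) * (π * I / 4)) σ := by
      have : HasDerivAt (fun τ : ℂ => π * I * τ / 4) (π * I / 4) σ := by
        simpa using ((hasDerivAt_id σ).const_mul (π * I : ℂ)).div_const 4
      exact this.cexp
    have hn := hasDerivAt_nome σ
    have hq : HasDerivAt (fun τ => 4 + 4 / 5 * a * nome τ + 4 / 9 * b * nome τ ^ 2
        + 4 / 13 * c * nome τ ^ 3) _ σ :=
      (((hn.const_mul (4 / 5 * a)).const_add 4).add ((hn.pow 2).const_mul (4 / 9 * b))).add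
        ((hn.pow 3).const_mul (4 / 13 * c))
    refine ((hasDerivAt_dev hσ').sub (((he.const_mul (devC * 2)).mul hq).div_const
      (π * I))).congr_deriv ?_
    rw [thProd_eq, ← qProd]
    field_simp
    push_cast
    ring
  · intro σ hσ
    rw [norm_mul, norm_mul, norm_mul, norm_devC, norm_exp_quarter, hσ, Complex.norm_ofNat]
    have h1 := hδ (nome σ) (by rw [norm_nome, norm_nome, hσ])
    have := mul_pos scC_pos Real.pi_pos
    gcongr
  · have h1 : exp (π * I * (τ + 2) / 4) = I * exp (π * I * τ / 4) := by
      rw [show (π * I * (τ + 2) / 4 : ℂ) = π / 2 * I + π * I * τ / 4 by ring, exp_add,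
        exp_pi_div_two_mul_I]
    have h2 : nome (τ + 2) = nome τ := by
      rw [show τ + 2 = τ + 1 + 1 by ring, nome_add_one, nome_add_one, neg_neg]
    push_cast
    rw [dev_add_two hτ, h1, h2]
    ring

/-- Horner evaluation with the invariant bound 13, which survives each step because `12 + 0.0433 ·
13 ≤ 13`. The polynomial is the remainder of the product of truncated theta series after division by
`h⁴`. -/
theorem norm_qPoly_le {h : ℂ} (hh : ‖h‖ ≤ 0.0433) :
    ‖2 - 2 * h ^ 2 + 8 * h ^ 3 + 4 * h ^ 4 + 8 * h ^ 5 + 12 * h ^ 6 + 8 * h ^ 7 + 8 * h ^ 8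
      + 8 * h ^ 10‖ ≤ 2.9 := by
  have step : ∀ {z : ℂ} (c : ℂ) (k : ℝ), ‖c‖ = k → ‖z‖ ≤ 13 → k ≤ 12 → ‖c + h * z‖ ≤ 13 := by
    intro z c k hc hz hk
    refine (norm_add_le _ _).trans ?_
    rw [norm_mul, hc]
    have := mul_le_mul hh hz (norm_nonneg _) (by norm_num)
    norm_num at this
    linarith
  have h1 : ‖8 + h * (0 + h * 8)‖ ≤ 13 :=
    step 8 8 (by simp) (step 0 0 (by simp) (by norm_num) (by norm_num)) (by norm_num)
  have h2 := step 12 12 (by simp) (step 8 8 (by simp) h1 (by norm_num)) le_rfl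
  have h3 := step 4 4 (by simp) (step 8 8 (by simp) h2 (by norm_num)) (by norm_num)
  have h4 := step (-2) 2 (by simp) (step 8 8 (by simp) h3 (by norm_num)) (by norm_num)
  have e : 2 - 2 * h ^ 2 + 8 * h ^ 3 + 4 * h ^ 4 + 8 * h ^ 5 + 12 * h ^ 6 + 8 * h ^ 7 + 8 * h ^ 8
      + 8 * h ^ 10 = 2 + h * (h * (-2 + h * (8 + h * (4 + h * (8 + h * (12 + h * (8 + h * (8
        + h * (0 + h * 8))))))))) := by ring
  rw [e]
  refine (norm_add_le _ _).trans ?_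
  rw [norm_mul, norm_mul, Complex.norm_ofNat]
  have h5 := mul_le_mul hh (mul_le_mul hh h4 (norm_nonneg _) (by norm_num))
    (by positivity) (by norm_num)
  norm_num at h5 ⊢
  linarith

theorem norm_qProd_sub_le {h : ℂ} (hh : ‖h‖ ≤ 0.0433) :
    ‖qProd h - (1 + 2 * h + -3 * h ^ 2 + -6 * h ^ 3)‖ ≤ 3 * ‖h‖ ^ 4 := by
  have hh1 : ‖h‖ < 1 := hh.trans_lt (by norm_num)
  have hp := norm_thetaP_sub_le hh1
  have ha := norm_thetaThree_sub_le hh1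
  have hb := norm_thetaThree_sub_le (h := -h) (by rwa [norm_neg])
  rw [norm_neg] at hb
  set r := ‖h‖ with hr
  have hr0 : 0 ≤ r := norm_nonneg h
  have hr4 : 0 ≤ r ^ 4 := by positivity
  have e6 : r ^ 6 / (1 - r) ≤ 0.002 * r ^ 4 := by
    rw [div_le_iff₀ (by linarith)]
    have : r ^ 2 ≤ 0.002 * (1 - r) := by nlinarith
    calc r ^ 6 = r ^ 2 * r ^ 4 := by ring
      _ ≤ 0.002 * (1 - r) * r ^ 4 := by gcongr
      _ = _ := by ring
  have e9 : 2 * (r ^ 9 / (1 - r)) ≤ 0.001 * r ^ 4 := by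
    have h3 : r ^ 3 ≤ 0.0433 ^ 3 := by gcongr
    have : r ^ 9 / (1 - r) = r ^ 3 * (r ^ 6 / (1 - r)) := by ring
    rw [this]
    calc 2 * (r ^ 3 * (r ^ 6 / (1 - r))) ≤ 2 * (0.0433 ^ 3 * (0.002 * r ^ 4)) := by gcongr
      _ ≤ _ := by nlinarith
  set T := 1 + 2 * h + 2 * h ^ 4 with hT
  set U := 1 + 2 * -h + 2 * (-h) ^ 4 with hU
  have hp' := hp.trans e6
  have ha' := ha.trans e9
  have hb' := hb.trans e9
  have hr4' : r ^ 4 ≤ 0.0001 := (pow_le_pow_left₀ hr0 hh 4).trans (by norm_num)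
  have nT : ‖T‖ ≤ 1.1 := by
    calc ‖T‖ ≤ ‖(1 : ℂ)‖ + ‖2 * h‖ + ‖2 * h ^ 4‖ := norm_add₃_le
      _ = 1 + 2 * r + 2 * r ^ 4 := by simp [hr]
      _ ≤ 1.1 := by linarith
  have nA : ‖thetaThree h‖ ≤ 1.1 := by
    calc ‖thetaThree h‖ = ‖T + (thetaThree h - T)‖ := by congr 1; ring
      _ ≤ (1 + 2 * r + 2 * r ^ 4) + 0.001 * r ^ 4 := by
        refine (norm_add_le _ _).trans (add_le_add ?_ ha')
        refine norm_add₃_le.trans_eq ?_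
        simp [hr]
      _ ≤ 1.1 := by linarith
  have nB : ‖thetaThree (-h)‖ ≤ 1.1 := by
    calc ‖thetaThree (-h)‖ = ‖U + (thetaThree (-h) - U)‖ := by congr 1; ring
      _ ≤ (1 + 2 * r + 2 * r ^ 4) + 0.001 * r ^ 4 := by
        refine (norm_add_le _ _).trans (add_le_add ?_ hb')
        refine norm_add₃_le.trans_eq ?_
        simp [hr]
      _ ≤ 1.1 := by linarith
  have nP : ‖1 + h ^ 2‖ ≤ 1.01 := by
    refine (norm_add_le _ _).trans ?_
    rw [norm_one, norm_pow, ← hr]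
    nlinarith
  have nR : ‖2 - 2 * h ^ 2 + 8 * h ^ 3 + 4 * h ^ 4 + 8 * h ^ 5 + 12 * h ^ 6 + 8 * h ^ 7 + 8 * h ^ 8
      + 8 * h ^ 10‖ ≤ 2.9 := norm_qPoly_le hh
  -- Exact product of the truncations, then the three truncation errors inserted one factor at a
  -- time.
  have e : qProd h - (1 + 2 * h + -3 * h ^ 2 + -6 * h ^ 3) =
      h ^ 4 * (2 - 2 * h ^ 2 + 8 * h ^ 3 + 4 * h ^ 4 + 8 * h ^ 5 + 12 * h ^ 6 + 8 * h ^ 7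
        + 8 * h ^ 8 + 8 * h ^ 10)
      + ((thetaP h - (1 + h ^ 2)) * (thetaThree h * thetaThree h) * thetaThree (-h)
      + (1 + h ^ 2) * (thetaThree h - T) * (thetaThree h + T) * thetaThree (-h)
      + (1 + h ^ 2) * (T * T) * (thetaThree (-h) - U)) := by
    rw [qProd, hT, hU]; ring
  rw [e]
  refine (norm_add_le _ _).trans ?_
  have t1 : ‖(thetaP h - (1 + h ^ 2)) * (thetaThree h * thetaThree h) * thetaThree (-h)‖ ≤
      0.002 * r ^ 4 * (1.1 * 1.1) * 1.1 := by
    rw [norm_mul, norm_mul, norm_mul]; gcongr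
  have t2 : ‖(1 + h ^ 2) * (thetaThree h - T) * (thetaThree h + T) * thetaThree (-h)‖ ≤
      1.01 * (0.001 * r ^ 4) * (1.1 + 1.1) * 1.1 := by
    rw [norm_mul, norm_mul, norm_mul]
    have := (norm_add_le (thetaThree h) T).trans (add_le_add nA nT)
    gcongr
  have t3 : ‖(1 + h ^ 2) * (T * T) * (thetaThree (-h) - U)‖ ≤
      1.01 * (1.1 * 1.1) * (0.001 * r ^ 4) := by
    rw [norm_mul, norm_mul, norm_mul]; gcongr
  have t0 : ‖h ^ 4 * (2 - 2 * h ^ 2 + 8 * h ^ 3 + 4 * h ^ 4 + 8 * h ^ 5 + 12 * h ^ 6 + 8 * h ^ 7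
        + 8 * h ^ 8 + 8 * h ^ 10)‖ ≤ r ^ 4 * 2.9 := by
    rw [norm_mul, norm_pow]; gcongr
  have := norm_add₃_le (a := (thetaP h - (1 + h ^ 2)) * (thetaThree h * thetaThree h) * thetaThree (-h))
    (b := (1 + h ^ 2) * (thetaThree h - T) * (thetaThree h + T) * thetaThree (-h))
    (c := (1 + h ^ 2) * (T * T) * (thetaThree (-h) - U))
  linarith

/-! ### Numerical value of the Beta integral -/

/-- Ten Taylor terms work because `π/4 < 1`; the nome at `i` is the fourth power of this number. -/
theorem exp_neg_pi_div_four_bounds :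
    0.455937 ≤ Real.exp (-(π / 4)) ∧ Real.exp (-(π / 4)) ≤ 0.455939 := by
  have h1 : Real.exp 0.785398 ≤ Real.exp (π / 4) :=
    Real.exp_le_exp.2 (by linarith [Real.pi_gt_d6])
  have h2 : Real.exp (π / 4) ≤ Real.exp 0.78539825 :=
    Real.exp_le_exp.2 (by linarith [Real.pi_lt_d6])
  have h3 := Real.sum_le_exp_of_nonneg (show (0 : ℝ) ≤ 0.785398 by norm_num) 10
  have h4 := Real.exp_bound' (x := 0.78539825) (by norm_num) (by norm_num) (n := 10) (by norm_num)
  rw [Real.exp_neg]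
  constructor
  · refine (le_inv_comm₀ (by norm_num) (Real.exp_pos _)).2 (h2.trans (h4.trans ?_))
    norm_num [Finset.sum_range_succ, Nat.factorial]
  · refine (inv_le_comm₀ (Real.exp_pos _) (by norm_num)).2 (le_trans ?_ (h3.trans h1))
    norm_num [Finset.sum_range_succ, Nat.factorial]

theorem nome_I : nome I = Real.exp (-π) := by
  have := nome_ofReal_mul_I 1
  simpa using this

theorem exp_neg_pi : Real.exp (-π) = Real.exp (-(π / 4)) ^ 4 := by
  rw [← Real.exp_nat_mul]; congr 1; push_cast; ring

theorem exp_neg_pi_bounds : 0.0432133 ≤ Real.exp (-π) ∧ Real.exp (-π) ≤ 0.0432144 := by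
  obtain ⟨h1, h2⟩ := exp_neg_pi_div_four_bounds
  rw [exp_neg_pi]
  constructor
  · exact le_trans (by norm_num) (pow_le_pow_left₀ (by norm_num) h1 4)
  · exact (pow_le_pow_left₀ (Real.exp_pos _).le h2 4).trans (by norm_num)

/-- At `τ = i` the value `dev i = π + πi` is known exactly, whereas its expansion is proportional to
`C = 2π√2 / B`. Comparing the two gives `B ≈ 4x(4 + 8r/5 - 4r²/3 - 24r³/13)` with `x = e^{-π/4}`, `r
= e^{-π}`, up to `12π√2 x r⁴`. -/
theorem betaQ_bounds : 7.41617 ≤ betaQ ∧ betaQ ≤ 7.41642 := by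
  obtain ⟨hx1, hx2⟩ := exp_neg_pi_div_four_bounds
  obtain ⟨hr1, hr2⟩ := exp_neg_pi_bounds
  have hn : ‖nome I‖ = Real.exp (-π) := by
    rw [nome_I, norm_real, Real.norm_of_nonneg (Real.exp_pos _).le]
  have key := norm_dev_sub_le 2 (-3) (-6) (δ := 3 * Real.exp (-π) ^ 4) (τ := I) (by simp)
    (fun h hh => by
      rw [hn] at hh
      rw [← hh]
      exact norm_qProd_sub_le (hh.trans_le (hr2.trans (by norm_num))))
  rw [dev_I, I_im, mul_one, neg_div'] at key
  have hexp : exp (π * I * I / 4) = (Real.exp (-(π / 4)) : ℝ) := by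
    rw [mul_assoc, I_mul_I]; push_cast; ring_nf
  rw [hexp, nome_I] at key
  rw [← neg_div'] at key
  set x := Real.exp (-(π / 4)) with hx
  set r := Real.exp (-π) with hr
  have hpi : (π : ℂ) ≠ 0 := ofReal_ne_zero.2 Real.pi_ne_zero
  have e : (π + π * I - devC * 2 * x * (4 + 4 / 5 * 2 * r + 4 / 9 * -3 * r ^ 2
      + 4 / 13 * -6 * r ^ 3) / (π * I) : ℂ) = exp (π * I / 4) *
      ((π * √2 - scC * (2 * x * (4 + 8 / 5 * r - 4 / 3 * r ^ 2 - 24 / 13 * r ^ 3)) : ℝ) : ℂ) := by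
    have h1 := exp_pi_div_four_mul_sqrt_two
    rw [devC]
    push_cast
    have := I_ne_zero
    field_simp
    linear_combination (-1755 * (π : ℂ)) * h1
  rw [e, norm_mul, norm_exp_pi_div_four, one_mul, norm_real, Real.norm_eq_abs] at key
  have hB := betaQ_pos
  have h2 : √2 * √2 = 2 := Real.mul_self_sqrt (by norm_num)
  have hs : √2 ≤ 1.42 := by
    rw [Real.sqrt_le_left (by norm_num)]; norm_num
  have hsp : 0 < √2 := by positivity
  have e2 : π * √2 - scC * (2 * x * (4 + 8 / 5 * r - 4 / 3 * r ^ 2 - 24 / 13 * r ^ 3))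
      = π * √2 / betaQ * (betaQ - 4 * x * (4 + 8 / 5 * r - 4 / 3 * r ^ 2 - 24 / 13 * r ^ 3)) := by
    rw [scC]; field_simp; ring
  have hc : 0 < π * √2 / betaQ := by have := Real.pi_pos; positivity
  have e3 : √2 * (scC * π * (2 * x * (3 * r ^ 4)))
      = π * √2 / betaQ * (12 * π * √2 * x * r ^ 4) := by
    rw [scC]; field_simp; ring
  rw [e2, e3, abs_mul, abs_of_pos hc] at key
  have key2 := abs_le.1 (le_of_mul_le_mul_left key hc)
  have hr0 : 0 ≤ r := (Real.exp_pos _).le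
  have hx0 : 0 ≤ x := (Real.exp_pos _).le
  have hbd : 12 * π * √2 * x * r ^ 4 ≤ 0.000087 := by
    calc 12 * π * √2 * x * r ^ 4 ≤ 12 * 3.1416 * 1.42 * 0.455939 * 0.0432144 ^ 4 := by
          gcongr
          exact Real.pi_lt_d4.le
      _ ≤ _ := by norm_num
  have hq1 : 4.066494 ≤ 4 + 8 / 5 * r - 4 / 3 * r ^ 2 - 24 / 13 * r ^ 3 := by
    have a2 : r ^ 2 ≤ 0.0432144 ^ 2 := by gcongr
    have a3 : r ^ 3 ≤ 0.0432144 ^ 3 := by gcongr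
    norm_num at a2 a3 ⊢
    linarith
  have hq2 : 4 + 8 / 5 * r - 4 / 3 * r ^ 2 - 24 / 13 * r ^ 3 ≤ 4.066507 := by
    have a2 : (0.0432133 : ℝ) ^ 2 ≤ r ^ 2 := by gcongr
    have a3 : (0.0432133 : ℝ) ^ 3 ≤ r ^ 3 := by gcongr
    norm_num at a2 a3 ⊢
    linarith
  have hm1 : 4 * 0.455937 * 4.066494 ≤ 4 * x * (4 + 8 / 5 * r - 4 / 3 * r ^ 2 - 24 / 13 * r ^ 3) := by
    gcongr
  have hm2 : 4 * x * (4 + 8 / 5 * r - 4 / 3 * r ^ 2 - 24 / 13 * r ^ 3) ≤ 4 * 0.455939 * 4.066507 := by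
    gcongr
  norm_num at hm1 hm2 hbd ⊢
  constructor <;> linarith [key2.1, key2.2]

/-! ### The three expansions of the developing map -/

theorem norm_mul_sub_one_le {x y : ℂ} {a b : ℝ} (hx : ‖x - 1‖ ≤ a) (hy : ‖y - 1‖ ≤ b) :
    ‖x * y - 1‖ ≤ a + b + a * b := by
  have ha := (norm_nonneg _).trans hx
  calc ‖x * y - 1‖ = ‖(x - 1) + (y - 1) + (x - 1) * (y - 1)‖ := by congr 1; ring
    _ ≤ ‖x - 1‖ + ‖y - 1‖ + ‖(x - 1) * (y - 1)‖ := norm_add₃_le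
    _ ≤ a + b + a * b := by rw [norm_mul]; gcongr

theorem norm_thetaThree_sub_le_of_le {h : ℂ} (hh : ‖h‖ ≤ 0.066) :
    ‖thetaThree h - (1 + 2 * h)‖ ≤ 0.0001 := by
  refine (norm_thetaThree_sub_le' (hh.trans_lt (by norm_num))).trans ?_
  have : ‖h‖ ^ 4 / (1 - ‖h‖) ≤ 0.066 ^ 4 / (1 - 0.066) := by gcongr
  norm_num at this ⊢
  linarith

theorem norm_thetaThree_sub_one_le {h : ℂ} (hh : ‖h‖ ≤ 0.066) : ‖thetaThree h - 1‖ ≤ 0.1321 := by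
  calc ‖thetaThree h - 1‖ = ‖(thetaThree h - (1 + 2 * h)) + 2 * h‖ := by congr 1; ring
    _ ≤ 0.0001 + 2 * ‖h‖ := by
      refine (norm_add_le _ _).trans (add_le_add (norm_thetaThree_sub_le_of_le hh) ?_)
      rw [norm_mul, Complex.norm_ofNat]
    _ ≤ 0.1321 := by linarith

/-- The linear terms cancel in `(1 + 2h)(1 - 2h)`, so the product is much closer to 1 than either
factor. -/
theorem norm_thetaThree_mul_sub_one_le {h : ℂ} (hh : ‖h‖ ≤ 0.066) :
    ‖thetaThree h * thetaThree (-h) - 1‖ ≤ 0.018 := by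
  have hh' : ‖-h‖ ≤ 0.066 := by rwa [norm_neg]
  have ha := norm_thetaThree_sub_le_of_le hh
  have hb := norm_thetaThree_sub_le_of_le hh'
  have h4 : ‖thetaThree (-h)‖ ≤ 1.2 := by
    have := norm_le_norm_add_norm_sub' (thetaThree (-h)) 1
    have := norm_thetaThree_sub_one_le hh'
    rw [norm_one] at *
    linarith
  have h5 : ‖1 + 2 * h‖ ≤ 1.2 := by
    refine (norm_add_le _ _).trans ?_
    rw [norm_one, norm_mul, Complex.norm_ofNat]
    linarith
  calc ‖thetaThree h * thetaThree (-h) - 1‖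
      = ‖-4 * (h * h) + (thetaThree h - (1 + 2 * h)) * thetaThree (-h)
        + (1 + 2 * h) * (thetaThree (-h) - (1 + 2 * -h))‖ := by congr 1; ring
    _ ≤ 4 * (0.066 * 0.066) + 0.0001 * 1.2 + 1.2 * 0.0001 := by
      refine norm_add₃_le.trans ?_
      rw [norm_mul, norm_mul, norm_mul, norm_mul, norm_neg, Complex.norm_ofNat]
      gcongr
    _ ≤ 0.018 := by norm_num

theorem norm_thetaP_sub_one_le_of_le {h : ℂ} (hh : ‖h‖ ≤ 0.066) : ‖thetaP h - 1‖ ≤ 0.005 := by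
  refine (norm_thetaP_sub_one_le (hh.trans_lt (by norm_num))).trans ?_
  have : ‖h‖ ^ 2 / (1 - ‖h‖) ≤ 0.066 ^ 2 / (1 - 0.066) := by gcongr
  norm_num at this ⊢
  linarith

theorem norm_qProd_sub_one_le {h : ℂ} (hh : ‖h‖ ≤ 0.066) : ‖qProd h - 1‖ ≤ 0.17 := by
  rw [show qProd h = thetaP h * thetaThree h * (thetaThree h * thetaThree (-h)) by
    rw [qProd]; ring]
  refine (norm_mul_sub_one_le (norm_mul_sub_one_le (norm_thetaP_sub_one_le_of_le hh)
    (norm_thetaThree_sub_one_le hh)) (norm_thetaThree_mul_sub_one_le hh)).trans ?_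
  norm_num

/-- The product of theta series entering `θ₂² θ₃ θ₄`. -/
noncomputable def cuspProd (h : ℂ) : ℂ := thetaP h ^ 2 * (thetaThree h * thetaThree (-h))

theorem norm_cuspProd_sub_one_le {h : ℂ} (hh : ‖h‖ ≤ 0.066) : ‖cuspProd h - 1‖ ≤ 0.03 := by
  have hp := norm_thetaP_sub_one_le_of_le hh
  rw [cuspProd, sq]
  refine (norm_mul_sub_one_le (norm_mul_sub_one_le hp hp)
    (norm_thetaThree_mul_sub_one_le hh)).trans ?_
  norm_num

/-- The developing map in the coordinate at the cusp `1`. -/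
noncomputable def devCusp (τ : ℂ) : ℂ := dev (-1 / τ + 1)

theorem neg_inv_add_one_im_pos {τ : ℂ} (hτ : 0 < τ.im) : 0 < (-1 / τ + 1).im := by
  simpa only [add_im, one_im, add_zero] using neg_inv_im_pos hτ

theorem hasDerivAt_devCusp {τ : ℂ} (hτ : 0 < τ.im) : HasDerivAt devCusp
    (-(devC * exp (π * I / 4)) * (4 * exp (π * I * τ / 4) ^ 2 * cuspProd (nome τ))) τ := by
  refine ((hasDerivAt_dev (neg_inv_add_one_im_pos hτ)).comp τ
    ((hasDerivAt_neg_inv hτ).add_const 1)).congr_deriv ?_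
  have e : thProd (-1 / τ + 1) = -τ ^ 2 * exp (π * I / 4) * (th2 τ ^ 2 * th3 τ * th4 τ) := by
    rw [thProd, th2_add_one, th3_add_one, th4_add_one, th2_neg_inv hτ, th3_neg_inv hτ,
      th4_neg_inv hτ, ← sFac_pow_four]
    ring
  rw [e, th2, th3, th4, cuspProd]
  have := ne_zero_of_im_pos hτ
  field_simp
  ring

/-- The translation becomes `S` following a shift by 2 in the original coordinate. The fixed point
of `w ↦ 2π + 2πi + iw` is `2πi`, the lattice point at the cusp 1. -/
theorem devCusp_add_one {τ : ℂ} (hτ : 0 < τ.im) :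
    devCusp (τ + 1) = 2 * π + 2 * π * I + I * devCusp τ := by
  have h1 : 0 < (-1 / τ - 1).im := by
    simpa only [sub_im, one_im, sub_zero] using neg_inv_im_pos hτ
  have h0 := ne_zero_of_im_pos hτ
  have h0' : τ + 1 ≠ 0 := ne_zero_of_im_pos (by simpa using hτ)
  have h0'' := ne_zero_of_im_pos h1
  have e : -1 / (τ + 1) + 1 = -1 / (-1 / τ - 1) := by
    have : -1 / τ - 1 = -(τ + 1) / τ := by field_simp; ring
    rw [this]
    field_simp
    ring
  have h2 := dev_add_two h1
  rw [show -1 / τ - 1 + 2 = -1 / τ + 1 by ring] at h2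
  rw [devCusp, e, dev_neg_inv h1, devCusp, h2, ← mul_assoc, I_mul_I]
  ring

theorem scC_mul_pi_le : scC * π ≤ 3.77 := by
  have h1 := betaQ_bounds.1
  have hs : √2 ≤ 1.4143 := by
    rw [Real.sqrt_le_left (by norm_num)]; norm_num
  have hp := Real.pi_lt_d4
  have h0 := Real.pi_pos
  rw [scC, div_mul_eq_mul_div, div_le_iff₀ betaQ_pos]
  calc 2 * π * √2 * π ≤ 2 * 3.1416 * 1.4143 * 3.1416 := by gcongr
    _ ≤ 3.77 * 7.41617 := by norm_num
    _ ≤ 3.77 * betaQ := by gcongr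

theorem exp_quarter_le {τ : ℂ} (hτ : 0 < τ.im) (h : 3 / 4 ≤ τ.im ^ 2) :
    Real.exp (-(π * τ.im / 4)) ≤ 0.508 := by
  have h1 := norm_nome_le hτ h
  have h2 : Real.exp (-(π * τ.im / 4)) ^ 4 = ‖nome τ‖ := by
    rw [norm_nome, ← Real.exp_nat_mul]; congr 1; push_cast; ring
  refine le_of_pow_le_pow_left₀ (n := 4) (by norm_num) (by norm_num) ?_
  rw [h2]
  exact h1.trans (by norm_num)

/-- Comparison of a function with its leading term. -/
theorem bounds_of_norm_sub_le {z w : ℂ} {A : ℝ} (hA : 0 < A) (hw : ‖w‖ = 8 / π * A)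
    (h : ‖z - w‖ ≤ 0.49 * A) : z ≠ 0 ∧ ‖z‖ ≤ 3.05 * A := by
  have h0 := Real.pi_pos
  -- `2 ≤ 8/π ≤ 2.56`: an error of `0.49` cannot cancel the leading term, and `2.56 + 0.49 = 3.05`.
  have h1 : 2 * A ≤ 8 / π * A := by
    gcongr
    rw [le_div_iff₀ h0]
    linarith [Real.pi_lt_d2]
  have h2 : 8 / π * A ≤ 2.56 * A := by
    gcongr
    rw [div_le_iff₀ h0]
    linarith [Real.pi_gt_d2]
  have h3 := norm_le_norm_add_norm_sub w z
  have h4 := norm_le_norm_add_norm_sub' z w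
  rw [norm_sub_rev] at h3
  constructor
  · rintro rfl
    rw [zero_sub, norm_neg, hw] at h
    linarith
  · linarith

theorem sqrt_two_le : √2 ≤ 1.42 := by
  rw [Real.sqrt_le_left (by norm_num)]; norm_num

theorem dev_bounds {τ : ℂ} (hτ : 0 < τ.im) (h : 3 / 4 ≤ τ.im ^ 2) :
    dev τ ≠ 0 ∧ ‖dev τ‖ ≤ 3.05 * (scC * π * Real.exp (-(π * τ.im / 4))) := by
  have hn := norm_nome_le hτ h
  have key := norm_dev_sub_le 0 0 0 (δ := 0.17) hτ (fun z hz => by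
    simpa using norm_qProd_sub_one_le (hz.trans_le hn))
  have hc := mul_pos scC_pos Real.pi_pos
  have hx := Real.exp_pos (-(π * τ.im / 4))
  refine bounds_of_norm_sub_le (mul_pos hc hx) ?_ (key.trans ?_)
  · rw [norm_div, norm_mul, norm_mul, norm_mul, norm_mul, norm_devC, norm_exp_quarter, norm_I,
      norm_real, Real.norm_of_nonneg Real.pi_pos.le]
    norm_num
    ring
  · have := sqrt_two_le
    calc √2 * (scC * π * (2 * Real.exp (-(π * τ.im / 4)) * 0.17))
        = √2 * (0.34 * (scC * π * Real.exp (-(π * τ.im / 4)))) := by ring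
      -- The margin is `1.42 · 0.34 < 0.49`.
      _ ≤ 1.42 * (0.34 * (scC * π * Real.exp (-(π * τ.im / 4)))) := by gcongr
      _ ≤ _ := by nlinarith [mul_pos hc hx]

theorem devCusp_bounds {τ : ℂ} (hτ : 0 < τ.im) (h : 3 / 4 ≤ τ.im ^ 2) :
    devCusp τ - 2 * π * I ≠ 0 ∧
    ‖devCusp τ - 2 * π * I‖ ≤ 3.05 * (scC * π * Real.exp (-(π * τ.im / 4)) ^ 2) := by
  have hn := norm_nome_le hτ h
  have hc := mul_pos scC_pos Real.pi_pos
  have hx := Real.exp_pos (-(π * τ.im / 4))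
  have hx2 : 0 < Real.exp (-(π * τ.im / 4)) ^ 2 := by positivity
  have hpi : (π : ℂ) * I ≠ 0 := mul_ne_zero (ofReal_ne_zero.2 Real.pi_ne_zero) I_ne_zero
  have key := norm_le_of_add_eq_I_mul (τ := τ) (p := 1) (f := fun τ => devCusp τ - 2 * π * I -
      -(devC * exp (π * I / 4)) * (4 * exp (π * I * τ / 4) ^ 2) * 2 / (π * I))
    (f' := fun τ => -(devC * exp (π * I / 4)) * (4 * exp (π * I * τ / 4) ^ 2 *
      (cuspProd (nome τ) - 1)))
    (C := scC * π * (4 * Real.exp (-(π * τ.im / 4)) ^ 2 * 0.03)) one_pos.le ?_ ?_ ?_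
  · refine bounds_of_norm_sub_le (mul_pos hc hx2) (w := -(devC * exp (π * I / 4)) *
      (4 * exp (π * I * τ / 4) ^ 2) * 2 / (π * I)) ?_ ?_
    · rw [norm_div, norm_mul, norm_mul, norm_mul, norm_mul, norm_neg, norm_mul, norm_devC,
        norm_exp_pi_div_four, norm_pow, norm_exp_quarter, norm_I,
        norm_real, Real.norm_of_nonneg Real.pi_pos.le]
      norm_num
      ring
    · have h1 : 1 ≤ √2 := Real.one_le_sqrt.2 (by norm_num)
      refine (le_mul_of_one_le_left (norm_nonneg _) h1).trans (key.trans ?_)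
      nlinarith [mul_pos hc hx2]
  · intro σ hσ
    have hσ' : 0 < σ.im := hσ ▸ hτ
    have he : HasDerivAt (fun τ : ℂ => exp (π * I * τ / 4)) (exp (π * I * σ / 4) * (π * I / 4)) σ := by
      have : HasDerivAt (fun τ : ℂ => π * I * τ / 4) (π * I / 4) σ := by
        simpa using ((hasDerivAt_id σ).const_mul (π * I : ℂ)).div_const 4
      exact this.cexp
    refine (((hasDerivAt_devCusp hσ').sub_const _).sub (((((he.pow 2).const_mul 4).const_mul
      (-(devC * exp (π * I / 4)))).mul_const 2).div_const (π * I))).congr_deriv ?_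
    field_simp
    push_cast
    ring
  · intro σ hσ
    rw [norm_mul, norm_mul, norm_mul, norm_neg, norm_mul, norm_devC, norm_exp_pi_div_four, norm_pow,
      norm_exp_quarter, hσ, Complex.norm_ofNat, mul_one]
    have h1 := norm_cuspProd_sub_one_le (h := nome σ) (by
      rw [norm_nome, hσ, ← norm_nome]; exact hn)
    gcongr
  · have h1 : exp (π * I * (τ + 1) / 4) ^ 2 = I * exp (π * I * τ / 4) ^ 2 := by
      rw [show (π * I * (τ + 1) / 4 : ℂ) = π * I / 4 + π * I * τ / 4 by ring, exp_add, mul_pow,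
        exp_pi_div_four_sq]
    push_cast
    rw [devCusp_add_one hτ, h1]
    linear_combination (2 * (π : ℂ)) * I_mul_I

theorem dev_norm_lt {τ : ℂ} (hτ : 0 < τ.im) (h : 3 / 4 ≤ τ.im ^ 2) : ‖dev τ‖ < 2 * π := by
  refine (dev_bounds hτ h).2.trans_lt ?_
  have h1 := exp_quarter_le hτ h
  have h2 := scC_mul_pi_le
  have hx := Real.exp_pos (-(π * τ.im / 4))
  calc 3.05 * (scC * π * Real.exp (-(π * τ.im / 4))) ≤ 3.05 * (3.77 * 0.508) := by gcongr
    _ < 2 * 3.14 := by norm_num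
    _ < 2 * π := by linarith [Real.pi_gt_d2]

theorem devCusp_norm_lt {τ : ℂ} (hτ : 0 < τ.im) (h : 3 / 4 ≤ τ.im ^ 2) :
    ‖devCusp τ - 2 * π * I‖ < 2 * π := by
  refine (devCusp_bounds hτ h).2.trans_lt ?_
  have h1 := exp_quarter_le hτ h
  have h2 := scC_mul_pi_le
  have hx := Real.exp_pos (-(π * τ.im / 4))
  calc 3.05 * (scC * π * Real.exp (-(π * τ.im / 4)) ^ 2) ≤ 3.05 * (3.77 * 0.508 ^ 2) := by gcongr
    _ < 2 * 3.14 := by norm_num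
    _ < 2 * π := by linarith [Real.pi_gt_d2]

/-- Values at distance at least `δ` from the lattice are thereby confined to bounded height, which
is what makes the compactness argument possible. -/
theorem exists_im_bound {δ : ℝ} (hδ : 0 < δ) : ∃ Y : ℝ, ∀ τ : ℂ, 0 < τ.im → 3 / 4 ≤ τ.im ^ 2 →
    Y ≤ τ.im → ‖dev τ‖ < δ ∧ ‖devCusp τ - 2 * π * I‖ < δ := by
  have hc := mul_pos scC_pos Real.pi_pos
  have h1 : Tendsto (fun y : ℝ => 3.05 * (scC * π * Real.exp (-(π / 4 * y)))) atTop (𝓝 0) := by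
    have : Tendsto (fun y : ℝ => Real.exp (-(π / 4 * y))) atTop (𝓝 0) :=
      Real.tendsto_exp_neg_atTop_nhds_zero.comp
        (tendsto_id.const_mul_atTop (by positivity : 0 < π / 4))
    simpa using (this.const_mul (scC * π)).const_mul 3.05
  obtain ⟨Y, hY⟩ := eventually_atTop.1 (h1.eventually_lt_const hδ)
  refine ⟨Y, fun τ hτ h hle => ?_⟩
  have h2 := hY τ.im hle
  rw [show π / 4 * τ.im = π * τ.im / 4 by ring] at h2
  refine ⟨(dev_bounds hτ h).2.trans_lt h2, (devCusp_bounds hτ h).2.trans_lt (lt_of_le_of_lt ?_ h2)⟩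
  have hx := Real.exp_pos (-(π * τ.im / 4))
  have hx1 := exp_quarter_le hτ h
  gcongr
  nlinarith

/-! ### The lattice -/

theorem mem_lattice_iff {z : ℂ} :
    z ∈ rectLattice 1 ↔ ∃ m n : ℤ, z = 2 * π * (m + n * I) := by
  simp only [rectLattice, mem_ofPred_eq, ofReal_one, mul_one]
  refine exists_congr fun m => exists_congr fun n => ?_
  rw [show (m * (2 * π) + n * (2 * π * I) : ℂ) = 2 * π * (m + n * I) by ring]

theorem lattice_add {z w : ℂ} (hz : z ∈ rectLattice 1) (hw : w ∈ rectLattice 1) :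
    z + w ∈ rectLattice 1 := by
  rw [mem_lattice_iff] at *
  obtain ⟨m, n, rfl⟩ := hz
  obtain ⟨m', n', rfl⟩ := hw
  exact ⟨m + m', n + n', by push_cast; ring⟩

theorem lattice_I_mul {z : ℂ} (hz : z ∈ rectLattice 1) : I * z ∈ rectLattice 1 := by
  rw [mem_lattice_iff] at *
  obtain ⟨m, n, rfl⟩ := hz
  exact ⟨-n, m, by push_cast; linear_combination (2 * π * n : ℂ) * I_mul_I⟩

theorem lattice_neg {z : ℂ} (hz : z ∈ rectLattice 1) : -z ∈ rectLattice 1 := by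
  rw [mem_lattice_iff] at *
  obtain ⟨m, n, rfl⟩ := hz
  exact ⟨-m, -n, by push_cast; ring⟩

theorem two_pi_I_mem_lattice : 2 * π * I ∈ rectLattice 1 :=
  mem_lattice_iff.2 ⟨0, 1, by push_cast; ring⟩

theorem zero_mem_lattice : (0 : ℂ) ∈ rectLattice 1 := mem_lattice_iff.2 ⟨0, 0, by simp⟩

theorem two_pi_add_mem_lattice : 2 * π + 2 * π * I ∈ rectLattice 1 :=
  mem_lattice_iff.2 ⟨1, 1, by push_cast; ring⟩

theorem eq_zero_of_mem_lattice {z : ℂ} (hz : z ∈ rectLattice 1) (h : ‖z‖ < 2 * π) : z = 0 := by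
  obtain ⟨m, n, rfl⟩ := mem_lattice_iff.1 hz
  have h0 := Real.pi_pos
  rw [norm_mul, norm_mul, Complex.norm_ofNat, norm_real, Real.norm_of_nonneg h0.le] at h
  have h1 : ‖(m + n * I : ℂ)‖ < 1 := by
    by_contra! h1
    nlinarith
  have hre : |((m + n * I : ℂ)).re| < 1 := (abs_re_le_norm _).trans_lt h1
  have him : |((m + n * I : ℂ)).im| < 1 := (abs_im_le_norm _).trans_lt h1
  simp at hre him
  have hm : m = 0 := by rw [← Int.abs_lt_one_iff]; exact_mod_cast hre
  have hn : n = 0 := by rw [← Int.abs_lt_one_iff]; exact_mod_cast him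
  simp [hm, hn]

theorem isClosed_lattice : IsClosed (rectLattice 1) := by
  have h : ∀ z ∈ rectLattice 1, ∀ w ∈ rectLattice 1, dist z w < 2 * π → z = w := by
    intro z hz w hw h
    rw [dist_eq_norm] at h
    exact sub_eq_zero.1 (eq_zero_of_mem_lattice (by
      rw [sub_eq_add_neg]; exact lattice_add hz (lattice_neg hw)) h)
  refine Metric.isClosed_of_pairwise_le_dist (ε := 2 * π) (by positivity) fun z hz w hw hne => ?_
  by_contra! hlt
  exact hne (h z hz w hw hlt)

theorem countable_lattice : (rectLattice 1).Countable := by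
  have : rectLattice 1 = range fun p : ℤ × ℤ => (2 * π * (p.1 + p.2 * I) : ℂ) := by
    ext z
    rw [mem_lattice_iff]
    simp [eq_comm]
  rw [this]
  exact countable_range _

/-! ### Induction over the modular group -/

/-- The three functions are carried together because `T` exchanges `dev` with `dev (· + 1)`, and `S`
exchanges `dev (· + 1)` with `devCusp`, up to lattice motions. Taking `R` as a relation between a
function and a point separates the change of argument from the affine change of value. -/
theorem dev_induction {R : (ℂ → ℂ) → ℂ → Prop}
    (hcongr : ∀ f g : ℂ → ℂ, ∀ τ : ℂ, 0 < τ.im → EqOn f g {τ | 0 < τ.im} → R f τ → R g τ)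
    (hT : ∀ f : ℂ → ℂ, ∀ τ : ℂ, 0 < τ.im → R (fun σ => f (σ + 1)) τ → R f (τ + 1))
    (hT' : ∀ f : ℂ → ℂ, ∀ τ : ℂ, 0 < τ.im → R (fun σ => f (σ - 1)) τ → R f (τ - 1))
    (hS : ∀ f : ℂ → ℂ, ∀ τ : ℂ, 0 < τ.im → R (fun σ => f (-1 / σ)) τ → R f (-1 / τ))
    (haff : ∀ f : ℂ → ℂ, ∀ τ u v : ℂ, 0 < τ.im → (u = I ∨ u = -I ∨ u = -1) → v ∈ rectLattice 1 →
      R f τ → R (fun σ => u * f σ + v) τ)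
    (h : ∀ τ : ℂ, 0 < τ.im → |τ.re| ≤ 1 / 2 → 3 / 4 ≤ τ.im ^ 2 →
      R dev τ ∧ R (fun σ => dev (σ + 1)) τ ∧ R devCusp τ) :
    ∀ τ : ℂ, 0 < τ.im → R dev τ := by
  have him1 : ∀ {τ : ℂ}, 0 < τ.im → 0 < (τ + 1).im := fun h => by simpa using h
  have him1' : ∀ {τ : ℂ}, 0 < τ.im → 0 < (τ - 1).im := fun h => by simpa using h
  suffices key : ∀ τ : ℂ, 0 < τ.im → R dev τ ∧ R (fun σ => dev (σ + 1)) τ ∧ R devCusp τ from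
    fun τ hτ => (key τ hτ).1
  refine upperHalfPlane_induction ?_ ?_ ?_ h
  · rintro τ hτ ⟨h1, h2, h3⟩
    refine ⟨hT _ τ hτ h2, hT _ τ hτ ?_, hT _ τ hτ ?_⟩
    · refine hcongr _ _ τ hτ (fun σ hσ => ?_) (haff dev τ I 0 hτ (by simp) zero_mem_lattice h1)
      rw [show σ + 1 + 1 = σ + 2 by ring, dev_add_two hσ, add_zero]
    · refine hcongr _ _ τ hτ (fun σ hσ => ?_)
        (haff devCusp τ I _ hτ (by simp) two_pi_add_mem_lattice h3)
      rw [devCusp_add_one hσ]; ring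
  · rintro τ hτ ⟨h1, h2, h3⟩
    refine ⟨hT' _ τ hτ ?_, hT' _ τ hτ ?_, hT' _ τ hτ ?_⟩
    · refine hcongr _ _ τ hτ (fun σ hσ => ?_)
        (haff _ τ (-I) 0 hτ (by simp) zero_mem_lattice h2)
      have := dev_add_two (him1' hσ)
      rw [show σ - 1 + 2 = σ + 1 by ring] at this
      simp only [this]
      linear_combination -dev (σ - 1) * I_mul_I
    · exact hcongr _ _ τ hτ (fun σ hσ => by rw [sub_add_cancel]) h1
    · refine hcongr _ _ τ hτ (fun σ hσ => ?_)
        (haff devCusp τ (-I) (I * (2 * π + 2 * π * I)) hτ (by simp)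
          (lattice_I_mul two_pi_add_mem_lattice) h3)
      have := devCusp_add_one (him1' hσ)
      rw [sub_add_cancel] at this
      simp only [this]
      linear_combination -devCusp (σ - 1) * I_mul_I
  · rintro τ hτ ⟨h1, h2, h3⟩
    refine ⟨hS _ τ hτ ?_, hS _ τ hτ h3, hS _ τ hτ ?_⟩
    · refine hcongr _ _ τ hτ (fun σ hσ => ?_)
        (haff dev τ (-1) _ hτ (by simp) two_pi_add_mem_lattice h1)
      rw [dev_neg_inv hσ]; ring
    · refine hcongr _ _ τ hτ (fun σ hσ => ?_) h2
      have := ne_zero_of_im_pos hσ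
      rw [devCusp]
      congr 2
      field_simp

/-- On the fundamental domain the values of `dev` and `dev (· + 1)` lie within `2π` of `0`, those of
`devCusp` within `2π` of `2πi`. That point is the only lattice point so near, and it is not
attained. -/
theorem dev_notMem_lattice {τ : ℂ} (hτ : 0 < τ.im) : dev τ ∉ rectLattice 1 := by
  refine dev_induction (R := fun f τ => f τ ∉ rectLattice 1) ?_ (fun _ _ _ h => h)
    (fun _ _ _ h => h) (fun _ _ _ h => h) ?_ ?_ τ hτ
  · intro f g τ hτ hfg h
    rwa [← hfg hτ]
  · intro f τ u v _ hu hv h hmem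
    refine h ?_
    have h1 : u * f τ ∈ rectLattice 1 := by
      simpa using lattice_add hmem (lattice_neg hv)
    rcases hu with rfl | rfl | rfl
    · have := lattice_neg (lattice_I_mul h1)
      rwa [← mul_assoc, I_mul_I, neg_one_mul, neg_neg] at this
    · have := lattice_I_mul h1
      rwa [← mul_assoc, mul_neg, I_mul_I, neg_neg, one_mul] at this
    · simpa using lattice_neg h1
  · intro τ hτ _ h
    have hτ1 : 0 < (τ + 1).im := by simpa using hτ
    have h1 : 3 / 4 ≤ (τ + 1).im ^ 2 := by simpa using h
    refine ⟨fun hm => (dev_bounds hτ h).1 (eq_zero_of_mem_lattice hm (dev_norm_lt hτ h)),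
      fun hm => (dev_bounds hτ1 h1).1 (eq_zero_of_mem_lattice hm (dev_norm_lt hτ1 h1)),
      fun hm => (devCusp_bounds hτ h).1 (eq_zero_of_mem_lattice ?_ (devCusp_norm_lt hτ h))⟩
    rw [sub_eq_add_neg]
    exact lattice_add hm (lattice_neg two_pi_I_mem_lattice)

/-! ### A covering criterion by local sections -/

theorem discreteTopology_fiber {X Y : Type*} [TopologicalSpace X] {p : X → Y}
    (hinj : IsLocallyInjective p) (y : Y) : DiscreteTopology (p ⁻¹' {y}) := by
  refine discreteTopology_iff_isOpen_singleton.2 fun e => ?_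
  obtain ⟨N, hN, heN, hinjN⟩ := hinj e
  have : ({e} : Set (p ⁻¹' {y})) = Subtype.val ⁻¹' N := by
    ext e'
    simp only [mem_singleton_iff, mem_preimage]
    refine ⟨fun h => h ▸ heN, fun h => Subtype.ext (hinjN h heN ?_)⟩
    rw [show p e' = y from e'.2, show p e = y from e.2]
  rw [this]
  exact hN.preimage continuous_subtype_val

section Covering

variable {X Y : Type*} [TopologicalSpace X] [TopologicalSpace Y] {p : X → Y}

/-- Through every point over `U` there passes a continuous section over `U`. -/
def HasSections (p : X → Y) (U : Set Y) : Prop :=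
  ∀ x, p x ∈ U → ∃ s : Y → X, ContinuousOn s U ∧ s (p x) = x ∧ ∀ w ∈ U, p (s w) = w

/-- Sections over a connected `U` that agree at one point agree throughout, by local injectivity and
separatedness. A point `x` over `U` is thus determined by `p x` together with the value over `y` of
the section through `x`. -/
theorem isEvenlyCovered_of_hasSections [T2Space X] (hp : Continuous p)
    (hinj : IsLocallyInjective p) {y : Y} {U : Set Y} (hU : IsOpen U) (hUc : IsPreconnected U)
    (hy : y ∈ U) (hs : HasSections p U) : IsEvenlyCovered p y (p ⁻¹' {y}) := by
  rcases isEmpty_or_nonempty X with hX | hX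
  · exact IsCoveringMap.of_isEmpty (f := p) y
  choose! s hsc hsx hps using hs
  have key : ∀ x x' u, p x ∈ U → p x' ∈ U → u ∈ U → s x u = s x' u → EqOn (s x) (s x') U :=
    fun x x' u hx hx' hu h => (T2Space.isSeparatedMap p).eqOn_of_comp_eqOn hinj hUc (hsc x hx)
      (hsc x' hx') (fun w hw => (hps x hx w hw).trans (hps x' hx' w hw).symm) hu h
  have hfib : ∀ e : p ⁻¹' {y}, p e = y := fun e => e.2
  have := discreteTopology_fiber hinj y
  refine ⟨this, U, hy, hU, hU.preimage hp, ?_⟩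
  refine ⟨{ toFun x := (⟨p x, x.2⟩, ⟨s x y, hps x x.2 y hy⟩)
            invFun q := ⟨s q.2 q.1, by
              change p (s q.2 q.1) ∈ U
              rw [hps _ (by rw [hfib]; exact hy) _ q.1.2]; exact q.1.2⟩
            left_inv x := ?_
            right_inv q := ?_
            continuous_toFun := ?_
            continuous_invFun := ?_ }, fun x => rfl⟩
  · refine Subtype.ext ?_
    have h1 : p (s x y) ∈ U := by rw [hps x x.2 y hy]; exact hy
    have h2 : s (s x y) y = s x y := by
      have := hsx (s x y) h1
      rwa [hps x x.2 y hy] at this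
    exact (key _ _ y h1 x.2 hy h2 x.2).trans (hsx x x.2)
  · obtain ⟨u, e⟩ := q
    have he : p e ∈ U := by rw [hfib]; exact hy
    have h0 : p (s e u) = u := hps e he u u.2
    have h1 : p (s e u) ∈ U := by rw [h0]; exact u.2
    have h2 : s (s e u) u = s e u := by
      have := hsx (s e u) h1
      rwa [h0] at this
    refine Prod.ext (Subtype.ext h0) (Subtype.ext ?_)
    have h3 := hsx e he
    rw [hfib] at h3
    exact (key _ _ u h1 he u.2 h2 hy).trans h3
  · refine Continuous.prodMk (by fun_prop) (Continuous.subtype_mk ?_ _)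
    refine continuous_iff_continuousAt.2 fun x => ?_
    -- The sheet label is locally constant: nearby points lie on the section through `x`.
    refine (continuousAt_const (y := s x y)).congr ?_
    obtain ⟨N, hN, hxN, hinjN⟩ := hinj x
    have hc : ContinuousAt (fun x' : p ⁻¹' U => s x (p x')) x :=
      ContinuousAt.comp (f := fun x' : p ⁻¹' U => p x') (g := s x)
        ((hsc x x.2).continuousAt (hU.mem_nhds x.2)) (by fun_prop)
    have h1 : ∀ᶠ x' : p ⁻¹' U in 𝓝 x, s x (p x') ∈ N :=
      hc.eventually_mem (hN.mem_nhds (by rw [hsx x x.2]; exact hxN))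
    have h2 : ∀ᶠ x' : p ⁻¹' U in 𝓝 x, (x' : X) ∈ N :=
      continuousAt_subtype_val.eventually_mem (hN.mem_nhds hxN)
    filter_upwards [h1, h2] with x' h1 h2
    have h3 : s x (p x') = x' := hinjN h1 h2 (hps x x.2 _ x'.2)
    exact key _ _ (p x') x.2 x'.2 x'.2 (h3.trans (hsx x' x'.2).symm) hy
  · refine Continuous.subtype_mk ?_ _
    refine continuous_prod_of_discrete_right.2 fun e => ?_
    exact continuousOn_iff_continuous_domRestrict.1 (hsc e (by rw [hfib]; exact hy))

/-- Each neighbourhood with sections lies wholly in the range or misses it, so the range is clopen.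
-/
theorem surjective_of_hasSections [PreconnectedSpace Y] [Nonempty X]
    (h : ∀ y, ∃ U, IsOpen U ∧ y ∈ U ∧ HasSections p U) : Function.Surjective p := by
  have h1 : ∀ y, ∃ U, IsOpen U ∧ y ∈ U ∧ ((∃ w ∈ U, w ∈ range p) → U ⊆ range p) := by
    intro y
    obtain ⟨U, hU, hy, hs⟩ := h y
    refine ⟨U, hU, hy, ?_⟩
    rintro ⟨_, hw, x, rfl⟩ v hv
    obtain ⟨s, -, -, hps⟩ := hs x hw
    exact ⟨s v, hps v hv⟩
  refine range_eq_univ.1 (IsClopen.eq_univ ⟨⟨?_⟩, ?_⟩ (range_nonempty p))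
  · refine isOpen_iff_forall_mem_open.2 fun y hy => ?_
    obtain ⟨U, hU, hyU, h2⟩ := h1 y
    exact ⟨U, fun w hw hwr => hy (h2 ⟨w, hw, hwr⟩ hyU), hU, hyU⟩
  · refine isOpen_iff_forall_mem_open.2 fun y hy => ?_
    obtain ⟨U, hU, hyU, h2⟩ := h1 y
    exact ⟨U, h2 ⟨y, hyU, hy⟩, hU, hyU⟩

end Covering

/-! ### Uniform local sections -/

/-- `f` has a local section over the `ε`-ball about `f τ` with values in the upper half-plane. -/
def HasBallSection (f : ℂ → ℂ) (τ : ℂ) (ε : ℝ) : Prop :=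
  ∃ s : ℂ → ℂ, ContinuousOn s (Metric.ball (f τ) ε) ∧ s (f τ) = τ ∧
    ∀ w ∈ Metric.ball (f τ) ε, 0 < (s w).im ∧ f (s w) = w

theorem HasBallSection.mono {f : ℂ → ℂ} {τ : ℂ} {ε ε' : ℝ} (h : HasBallSection f τ ε)
    (hε : ε' ≤ ε) : HasBallSection f τ ε' := by
  obtain ⟨s, h1, h2, h3⟩ := h
  have := Metric.ball_subset_ball (x := f τ) hε
  exact ⟨s, h1.mono this, h2, fun w hw => h3 w (this hw)⟩

/-- Near a point where the derivative does not vanish, a holomorphic function is locally inverted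
by a continuous function. -/
theorem exists_local_inverse {f : ℂ → ℂ} {U : Set ℂ} (hU : IsOpen U) (hf : DifferentiableOn ℂ f U)
    {τ : ℂ} (hτ : τ ∈ U) (hf' : deriv f τ ≠ 0) :
    ∃ e : OpenPartialHomeomorph ℂ ℂ, τ ∈ e.source ∧ e.source ⊆ U ∧ ∀ z, e z = f z := by
  have h1 : HasStrictDerivAt f (deriv f τ) τ :=
    (hf.analyticAt (hU.mem_nhds hτ)).hasStrictDerivAt
  let e := (h1.hasStrictFDerivAt_equiv hf').toOpenPartialHomeomorph f
  refine ⟨e.restrOpen U hU, ⟨?_, hτ⟩, fun z hz => hz.2, fun z => rfl⟩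
  exact (h1.hasStrictFDerivAt_equiv hf').mem_toOpenPartialHomeomorph_source

theorem exists_hasBallSection_nhds {f : ℂ → ℂ} (hf : DifferentiableOn ℂ f {τ | 0 < τ.im})
    {τ : ℂ} (hτ : 0 < τ.im) (hf' : deriv f τ ≠ 0) :
    ∃ ε > 0, ∀ᶠ σ in 𝓝 τ, HasBallSection f σ ε := by
  obtain ⟨e, h1, h2, h3⟩ := exists_local_inverse isOpen_im_pos hf hτ hf'
  have h4 : f τ ∈ e.target := h3 τ ▸ e.map_source h1
  obtain ⟨ε, hε, hball⟩ := Metric.isOpen_iff.1 e.open_target _ h4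
  -- Half the radius lets one local inverse serve all nearby base points at once.
  refine ⟨ε / 2, by positivity, ?_⟩
  have hc : ContinuousAt f τ := (hf.differentiableAt (isOpen_im_pos.mem_nhds hτ)).continuousAt
  filter_upwards [hc.eventually_mem (Metric.ball_mem_nhds _ (half_pos hε)),
    e.open_source.mem_nhds h1] with σ hσ hσ'
  have hsub : Metric.ball (f σ) (ε / 2) ⊆ e.target := by
    refine (Metric.ball_subset_ball' ?_).trans hball
    have := Metric.mem_ball.1 hσ
    linarith
  refine ⟨e.symm, e.continuousOn_symm.mono hsub, by rw [← h3 σ, e.left_inv hσ'], fun w hw => ?_⟩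
  exact ⟨h2 (e.map_target (hsub hw)), by rw [← h3, e.right_inv (hsub hw)]⟩

theorem exists_hasBallSection_of_isCompact {f : ℂ → ℂ} (hf : DifferentiableOn ℂ f {τ | 0 < τ.im})
    (hf' : ∀ τ : ℂ, 0 < τ.im → deriv f τ ≠ 0) {K : Set ℂ} (hK : IsCompact K)
    (hKH : ∀ τ ∈ K, 0 < τ.im) : ∃ ε > 0, ∀ τ ∈ K, HasBallSection f τ ε := by
  refine hK.induction_on (p := fun K => ∃ ε > 0, ∀ τ ∈ K, HasBallSection f τ ε)
    ⟨1, one_pos, by simp⟩ ?_ ?_ ?_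
  · rintro s t hst ⟨ε, hε, h⟩
    exact ⟨ε, hε, fun τ hτ => h τ (hst hτ)⟩
  · rintro s t ⟨ε, hε, h⟩ ⟨ε', hε', h'⟩
    refine ⟨min ε ε', lt_min hε hε', ?_⟩
    rintro τ (hτ | hτ)
    exacts [(h τ hτ).mono (min_le_left _ _), (h' τ hτ).mono (min_le_right _ _)]
  · intro τ hτ
    obtain ⟨ε, hε, h⟩ := exists_hasBallSection_nhds hf (hKH τ hτ) (hf' τ (hKH τ hτ))
    exact ⟨_, mem_nhdsWithin_of_mem_nhds h, ε, hε, fun σ hσ => hσ⟩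

/-! ### Sections of the developing map -/

theorem deriv_dev_ne_zero {τ : ℂ} (hτ : 0 < τ.im) : deriv dev τ ≠ 0 := by
  rw [(hasDerivAt_dev hτ).deriv]
  exact mul_ne_zero devC_ne_zero (thProd_ne_zero hτ)

/-- Above height `Y` the distance hypotheses fail, since the values are within `δ` of `0` or `2πi`;
below it the points form a compact set with non-vanishing derivatives. -/
theorem exists_hasBallSection_base {δ : ℝ} (hδ : 0 < δ) : ∃ ε > 0, ∀ τ : ℂ, 0 < τ.im →
    |τ.re| ≤ 1 / 2 → 3 / 4 ≤ τ.im ^ 2 →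
    ((∀ l ∈ rectLattice 1, δ ≤ ‖dev τ - l‖) → HasBallSection dev τ ε) ∧
    ((∀ l ∈ rectLattice 1, δ ≤ ‖dev (τ + 1) - l‖) →
      HasBallSection (fun σ => dev (σ + 1)) τ ε) ∧
    ((∀ l ∈ rectLattice 1, δ ≤ ‖devCusp τ - l‖) → HasBallSection devCusp τ ε) := by
  obtain ⟨Y, hY⟩ := exists_im_bound hδ
  have hK := isCompact_re_im (1 / 2) (√3 / 2) Y
  have hKH : ∀ τ ∈ {τ : ℂ | |τ.re| ≤ 1 / 2 ∧ √3 / 2 ≤ τ.im ∧ τ.im ≤ Y}, 0 < τ.im :=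
    fun τ hτ => (by positivity : (0 : ℝ) < √3 / 2).trans_le hτ.2.1
  have him1 : ∀ {τ : ℂ}, 0 < τ.im → 0 < (τ + 1).im := fun h => by simpa using h
  have hd1 : ∀ τ : ℂ, 0 < τ.im → HasDerivAt (fun σ => dev (σ + 1)) (devC * thProd (τ + 1)) τ :=
    fun τ hτ => (hasDerivAt_dev (him1 hτ)).comp_add_const τ 1
  have hd2 : ∀ τ : ℂ, 0 < τ.im →
      HasDerivAt devCusp (devC * thProd (-1 / τ + 1) * (1 / τ ^ 2)) τ := fun τ hτ =>
    (hasDerivAt_dev (neg_inv_add_one_im_pos hτ)).comp τ ((hasDerivAt_neg_inv hτ).add_const 1)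
  obtain ⟨ε₁, hε₁, h₁⟩ := exists_hasBallSection_of_isCompact differentiableOn_dev
    (fun τ hτ => deriv_dev_ne_zero hτ) hK hKH
  obtain ⟨ε₂, hε₂, h₂⟩ := exists_hasBallSection_of_isCompact
    (fun τ hτ => (hd1 τ hτ).differentiableAt.differentiableWithinAt)
    (fun τ hτ => by
      rw [(hd1 τ hτ).deriv]; exact mul_ne_zero devC_ne_zero (thProd_ne_zero (him1 hτ))) hK hKH
  obtain ⟨ε₃, hε₃, h₃⟩ := exists_hasBallSection_of_isCompact
    (fun τ hτ => (hd2 τ hτ).differentiableAt.differentiableWithinAt)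
    (fun τ hτ => by
      rw [(hd2 τ hτ).deriv]
      exact mul_ne_zero (mul_ne_zero devC_ne_zero (thProd_ne_zero (neg_inv_add_one_im_pos hτ)))
        (one_div_ne_zero (pow_ne_zero 2 (ne_zero_of_im_pos hτ)))) hK hKH
  refine ⟨min ε₁ (min ε₂ ε₃), lt_min hε₁ (lt_min hε₂ hε₃), fun τ hτ hre him => ?_⟩
  rcases le_total Y τ.im with h | h
  · have b1 := (hY τ hτ him h).1
    have b2 := (hY (τ + 1) (him1 hτ) (by simpa using him) (by simpa using h)).1
    have b3 := (hY τ hτ him h).2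
    refine ⟨fun hl => ?_, fun hl => ?_, fun hl => ?_⟩
    · exact absurd (hl 0 zero_mem_lattice) (by simpa using b1)
    · exact absurd (hl 0 zero_mem_lattice) (by simpa using b2)
    · exact absurd (hl _ two_pi_I_mem_lattice) (by simpa using b3)
  · have hmem : τ ∈ {τ : ℂ | |τ.re| ≤ 1 / 2 ∧ √3 / 2 ≤ τ.im ∧ τ.im ≤ Y} :=
      ⟨hre, sqrt_three_div_two_le hτ him, h⟩
    exact ⟨fun _ => (h₁ τ hmem).mono (min_le_left _ _),
      fun _ => (h₂ τ hmem).mono ((min_le_right _ _).trans (min_le_left _ _)),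
      fun _ => (h₃ τ hmem).mono ((min_le_right _ _).trans (min_le_right _ _))⟩

theorem HasBallSection.precomp {f a : ℂ → ℂ} {τ : ℂ} {ε : ℝ}
    (h : HasBallSection (fun σ => f (a σ)) τ ε) (ha : ∀ σ, 0 < σ.im → 0 < (a σ).im)
    (hac : ∀ σ, 0 < σ.im → ContinuousAt a σ) : HasBallSection f (a τ) ε := by
  obtain ⟨s, h1, h2, h3⟩ := h
  refine ⟨a ∘ s, ?_, congrArg a h2, fun w hw => ⟨ha _ (h3 w hw).1, (h3 w hw).2⟩⟩
  intro w hw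
  exact (hac _ (h3 w hw).1).comp_continuousWithinAt (h1 w hw)

theorem HasBallSection.postcomp {f : ℂ → ℂ} {τ u v : ℂ} {ε : ℝ} (h : HasBallSection f τ ε)
    (hu : ‖u‖ = 1) : HasBallSection (fun σ => u * f σ + v) τ ε := by
  have hu0 : u ≠ 0 := by rintro rfl; simp at hu
  obtain ⟨s, h1, h2, h3⟩ := h
  have hm : MapsTo (fun w => u⁻¹ * (w - v)) (Metric.ball (u * f τ + v) ε)
      (Metric.ball (f τ) ε) := by
    intro w hw
    rw [mem_ball_iff_norm] at hw ⊢
    have : w - (u * f τ + v) = u * (u⁻¹ * (w - v) - f τ) := by field_simp; ring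
    rwa [this, norm_mul, hu, one_mul] at hw
  refine ⟨fun w => s (u⁻¹ * (w - v)), h1.comp (by fun_prop) hm, ?_, fun w hw => ?_⟩
  · convert h2 using 2
    field_simp
    ring
  · refine ⟨(h3 _ (hm hw)).1, ?_⟩
    simp only [(h3 _ (hm hw)).2]
    field_simp
    ring

theorem HasBallSection.congr {f g : ℂ → ℂ} {τ : ℂ} {ε : ℝ} (hτ : 0 < τ.im)
    (hfg : EqOn f g {τ | 0 < τ.im}) (h : HasBallSection f τ ε) : HasBallSection g τ ε := by
  obtain ⟨s, h1, h2, h3⟩ := h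
  rw [HasBallSection, ← hfg hτ]
  exact ⟨s, h1, h2, fun w hw => ⟨(h3 w hw).1, by rw [← hfg (h3 w hw).1]; exact (h3 w hw).2⟩⟩

/-- The motions `w ↦ uw + v` are isometries preserving the lattice, so both the distance condition
and the radius pass through the modular induction unchanged. -/
theorem exists_hasBallSection_dev {δ : ℝ} (hδ : 0 < δ) : ∃ ε > 0, ∀ τ : ℂ, 0 < τ.im →
    (∀ l ∈ rectLattice 1, δ ≤ ‖dev τ - l‖) → HasBallSection dev τ ε := by
  obtain ⟨ε, hε, h⟩ := exists_hasBallSection_base hδ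
  refine ⟨ε, hε, dev_induction
    (R := fun f τ => (∀ l ∈ rectLattice 1, δ ≤ ‖f τ - l‖) → HasBallSection f τ ε)
    ?_ ?_ ?_ ?_ ?_ h⟩
  · intro f g τ hτ hfg h hl
    exact (h (by rwa [hfg hτ])).congr hτ hfg
  · intro f τ hτ h hl
    exact (h hl).precomp (a := fun σ => σ + 1) (fun σ hσ => by simpa using hσ)
      (fun σ _ => by fun_prop)
  · intro f τ hτ h hl
    exact (h hl).precomp (a := fun σ => σ - 1) (fun σ hσ => by simpa using hσ)
      (fun σ _ => by fun_prop)
  · intro f τ hτ h hl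
    exact (h hl).precomp (a := fun σ => -1 / σ) (fun σ hσ => neg_inv_im_pos hσ)
      (fun σ hσ => (hasDerivAt_neg_inv hσ).continuousAt)
  · intro f τ u v hτ hu hv h hl
    have hu1 : ‖u‖ = 1 := by rcases hu with rfl | rfl | rfl <;> simp
    refine (h fun l hl' => ?_).postcomp hu1
    have hul : u * l ∈ rectLattice 1 := by
      rcases hu with rfl | rfl | rfl
      · exact lattice_I_mul hl'
      · rw [neg_mul]; exact lattice_neg (lattice_I_mul hl')
      · rw [neg_one_mul]; exact lattice_neg hl'
    have := hl _ (lattice_add hul hv)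
    rwa [show u * f τ + v - (u * l + v) = u * (f τ - l) by ring, norm_mul, hu1, one_mul] at this

/-! ### The covering of the lattice complement -/

theorem discMap_eq_dev {z : ℂ} (hz : ‖z‖ < 1) : discMap z = dev (cayInv z) := by
  rw [dev, cay_cayInv hz]

theorem mapsTo_discMap : MapsTo discMap (Metric.ball 0 1) (rectLattice 1)ᶜ := by
  intro z hz
  rw [mem_ball_zero_iff] at hz
  rw [discMap_eq_dev hz]
  exact dev_notMem_lattice (cayInv_im_pos hz)

/-- The restriction of `discMap` to a map of the disc to the complement of the lattice. -/
noncomputable def discCover : Metric.ball (0 : ℂ) 1 → ((rectLattice 1)ᶜ : Set ℂ) :=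
  mapsTo_discMap.restrict discMap (Metric.ball 0 1) (rectLattice 1)ᶜ

theorem differentiableOn_discMap : DifferentiableOn ℂ discMap (Metric.ball 0 1) := fun _ hz =>
  (hasDerivAt_discMap (mem_ball_zero_iff.1 hz)).differentiableAt.differentiableWithinAt

theorem deriv_discMap_ne_zero {z : ℂ} (hz : ‖z‖ < 1) : deriv discMap z ≠ 0 := by
  rw [(hasDerivAt_discMap hz).deriv]
  have h1 : 1 - z ≠ 0 := by
    intro h
    rw [← sub_eq_zero.1 h] at hz
    simp at hz
  exact mul_ne_zero (mul_ne_zero devC_ne_zero (thProd_ne_zero (cayInv_im_pos hz)))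
    (div_ne_zero (mul_ne_zero two_ne_zero I_ne_zero) (pow_ne_zero 2 h1))

theorem isLocallyInjective_discCover : IsLocallyInjective discCover := by
  intro z
  obtain ⟨e, h1, h2, h3⟩ := exists_local_inverse Metric.isOpen_ball differentiableOn_discMap z.2
    (deriv_discMap_ne_zero (mem_ball_zero_iff.1 z.2))
  refine ⟨Subtype.val ⁻¹' e.source, e.open_source.preimage continuous_subtype_val, h1, ?_⟩
  intro a ha b hb hab
  refine Subtype.ext (e.injOn ha hb ?_)
  rw [h3, h3]
  exact congrArg Subtype.val hab

theorem continuous_discCover : Continuous discCover :=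
  differentiableOn_discMap.continuousOn.mapsToRestrict mapsTo_discMap

theorem exists_hasSections_discCover (y : ((rectLattice 1)ᶜ : Set ℂ)) :
    ∃ U, IsOpen U ∧ IsPreconnected U ∧ y ∈ U ∧ HasSections discCover U := by
  obtain ⟨d, hd, hball⟩ := Metric.isOpen_iff.1 isClosed_lattice.isOpen_compl y y.2
  obtain ⟨ε, hε, hsec⟩ := exists_hasBallSection_dev (half_pos hd)
  -- Points over the `r`-ball have values at least `d/2` from the lattice, and their section balls
  -- of radius `ε ≥ 2r` contain the whole `r`-ball.
  set r := min (d / 2) (ε / 2) with hr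
  have hr0 : 0 < r := lt_min (half_pos hd) (half_pos hε)
  have hr1 : r ≤ d / 2 := min_le_left _ _
  have hr2 : r ≤ ε / 2 := min_le_right _ _
  refine ⟨Subtype.val ⁻¹' Metric.ball (y : ℂ) r, Metric.isOpen_ball.preimage continuous_subtype_val,
    ?_, Metric.mem_ball_self hr0, ?_⟩
  · rw [← Topology.IsInducing.subtypeVal.isPreconnected_image, Subtype.image_preimage_coe,
      inter_eq_right.2 ((Metric.ball_subset_ball (by linarith)).trans hball)]
    exact (convex_ball _ _).isPreconnected
  · intro x hx
    have hx1 := mem_ball_zero_iff.1 x.2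
    have hxv : (discCover x : ℂ) = dev (cayInv x) := discMap_eq_dev hx1
    have hxb : dist (dev (cayInv x)) y < r := by rw [← hxv]; exact hx
    obtain ⟨s, h1, h2, h3⟩ := hsec (cayInv x) (cayInv_im_pos hx1) (by
      intro l hl
      by_contra! hlt
      rw [← dist_eq_norm, dist_comm] at hlt
      refine hball (Metric.mem_ball.2 ?_) hl
      linarith [dist_triangle l (dev (cayInv x)) y])
    have hsub : Metric.ball (y : ℂ) r ⊆ Metric.ball (dev (cayInv x)) ε := by
      refine Metric.ball_subset_ball' ?_
      rw [dist_comm]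
      linarith
    obtain ⟨t, ht⟩ : ∃ t : ((rectLattice 1)ᶜ : Set ℂ) → Metric.ball (0 : ℂ) 1,
        ∀ w : ((rectLattice 1)ᶜ : Set ℂ), (w : ℂ) ∈ Metric.ball (y : ℂ) r →
          (t w : ℂ) = cay (s w) := by
      classical
      refine ⟨fun w => if hw : (w : ℂ) ∈ Metric.ball (y : ℂ) r then
        ⟨cay (s w), mem_ball_zero_iff.2 (norm_cay_lt_one (h3 _ (hsub hw)).1)⟩ else x, fun w hw => ?_⟩
      beta_reduce
      rw [dif_pos hw]
    refine ⟨t, ?_, Subtype.ext ?_, fun w hw => Subtype.ext ?_⟩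
    · rw [Topology.IsInducing.subtypeVal.continuousOn_iff]
      refine ContinuousOn.congr
        (f := fun w : ((rectLattice 1)ᶜ : Set ℂ) => cay (s w)) (fun w hw => ?_) ht
      have h4 := (h1.continuousAt (Metric.isOpen_ball.mem_nhds (hsub hw)))
      have h5 := (hasDerivAt_cay (h3 _ (hsub hw)).1).continuousAt
      exact ((h5.comp h4).comp continuousAt_subtype_val).continuousWithinAt
    · rw [ht _ hx, hxv, h2, cay_cayInv hx1]
    · change discMap (t w) = w
      rw [ht w hw]
      exact (h3 _ (hsub hw)).2

theorem isUniversalCover_discMap : IsUniversalCover discMap (rectLattice 1)ᶜ := by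
  have h := exists_hasSections_discCover
  have hcov : IsCoveringMap discCover := fun y => by
    obtain ⟨U, hU, hUc, hy, hs⟩ := h y
    exact isEvenlyCovered_of_hasSections continuous_discCover isLocallyInjective_discCover hU hUc
      hy hs
  have hconn : IsConnected (rectLattice 1)ᶜ := countable_lattice.isConnected_compl_of_one_lt_rank
    (by rw [Complex.rank_real_complex]; norm_num)
  have : PreconnectedSpace ((rectLattice 1)ᶜ : Set ℂ) :=
    isPreconnected_iff_preconnectedSpace.1 hconn.isPreconnected
  have : Nonempty (Metric.ball (0 : ℂ) 1) := ⟨⟨0, by simp⟩⟩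
  have hsurj : Function.Surjective discCover := surjective_of_hasSections fun y => by
    obtain ⟨U, hU, -, hy, hs⟩ := h y
    exact ⟨U, hU, hy, hs⟩
  refine ⟨differentiableOn_discMap, mapsTo_discMap, fun y hy => ?_, hcov⟩
  obtain ⟨x, hx⟩ := hsurj ⟨y, hy⟩
  exact ⟨x, x.2, congrArg Subtype.val hx⟩

/-! ### Uniqueness of the universal covering -/

/-- A universal covering factors through any other one with the same value at `0`. -/
theorem _root_.IsUniversalCover.exists_lift {f g : ℂ → ℂ} {U : Set ℂ} (hf : IsUniversalCover f U)
    (hg : IsUniversalCover g U) (h0 : f 0 = g 0) : ∃ φ : ℂ → ℂ,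
    ContinuousOn φ (Metric.ball 0 1) ∧ MapsTo φ (Metric.ball 0 1) (Metric.ball 0 1) ∧ φ 0 = 0 ∧
      EqOn (g ∘ φ) f (Metric.ball 0 1) := by
  have hz : (0 : ℂ) ∈ Metric.ball (0 : ℂ) 1 := Metric.mem_ball_self one_pos
  have : ContractibleSpace (Metric.ball (0 : ℂ) 1) := (convex_ball _ _).contractibleSpace ⟨0, hz⟩
  have : LocallyPathConnectedSpace (Metric.ball (0 : ℂ) 1) :=
    Metric.isOpen_ball.locallyPathConnectedSpace
  obtain ⟨F, ⟨hF0, hF⟩, -⟩ := hg.isCoveringMap.existsUnique_continuousMap_lifts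
    ⟨_, hf.isCoveringMap.continuous⟩ ⟨0, hz⟩ ⟨0, hz⟩ (Subtype.ext h0.symm)
  classical
  obtain ⟨φ, hφ⟩ : ∃ φ : ℂ → ℂ, ∀ z : Metric.ball (0 : ℂ) 1, φ z = F z := by
    refine ⟨fun z => if hz : z ∈ Metric.ball (0 : ℂ) 1 then F ⟨z, hz⟩ else 0, fun z => ?_⟩
    beta_reduce
    rw [dif_pos z.2]
  refine ⟨φ, ?_, fun z hz => ?_, ?_, fun z hz => ?_⟩
  · rw [continuousOn_iff_continuous_domRestrict]
    have : (Metric.ball (0 : ℂ) 1).domRestrict φ = fun z => (F z : ℂ) := funext hφ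
    rw [this]
    exact continuous_subtype_val.comp F.continuous
  · rw [hφ ⟨z, hz⟩]; exact (F ⟨z, hz⟩).2
  · rw [hφ ⟨0, hz⟩, hF0]
  · have := congrArg Subtype.val (congrFun hF ⟨z, hz⟩)
    rw [Function.comp_apply, hφ ⟨z, hz⟩]
    exact this

/-- A self-map of a covering of the disc which fixes `0` is the identity. -/
theorem _root_.IsUniversalCover.eqOn_id {f φ : ℂ → ℂ} {U : Set ℂ} (hf : IsUniversalCover f U)
    (hφ : ContinuousOn φ (Metric.ball 0 1)) (hm : MapsTo φ (Metric.ball 0 1) (Metric.ball 0 1))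
    (h0 : φ 0 = 0) (h : EqOn (f ∘ φ) f (Metric.ball 0 1)) : EqOn φ id (Metric.ball 0 1) := by
  have hz : (0 : ℂ) ∈ Metric.ball (0 : ℂ) 1 := Metric.mem_ball_self one_pos
  have : PreconnectedSpace (Metric.ball (0 : ℂ) 1) :=
    isPreconnected_iff_preconnectedSpace.1 (convex_ball _ _).isPreconnected
  have key := hf.isCoveringMap.eq_of_comp_eq (g₁ := hm.restrict φ _ _) (g₂ := id)
    (hφ.mapsToRestrict hm) continuous_id (funext fun z => Subtype.ext (h z.2)) ⟨0, hz⟩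
    (Subtype.ext h0)
  exact fun z hz => congrArg Subtype.val (congrFun key ⟨z, hz⟩)

/-- A continuous inverse of a holomorphic self-map of an open set is holomorphic. -/
theorem differentiableOn_inverse {U : Set ℂ} (hU : IsOpen U) {φ ψ : ℂ → ℂ}
    (hφ : DifferentiableOn ℂ φ U) (hψ : ContinuousOn ψ U) (hψm : MapsTo ψ U U)
    (h1 : ∀ z ∈ U, φ (ψ z) = z) (h2 : ∀ z ∈ U, ψ (φ z) = z) : DifferentiableOn ℂ ψ U := by
  intro w hw
  have hUw := hU.mem_nhds hw
  have hψw := hψ.continuousAt hUw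
  have hz := hψm hw
  have hUz := hU.mem_nhds hz
  refine AnalyticAt.differentiableWithinAt ?_
  refine Complex.analyticAt_of_differentiable_on_punctured_nhds_of_continuousAt ?_ hψw
  -- Zeros of `φ'` are isolated, as `φ` is injective and not locally constant. Off them the inverse
  -- function rule applies, and continuity of `ψ` removes the remaining singularity.
  have hne : ∀ᶠ z in 𝓝[≠] (ψ w), deriv φ z ≠ 0 := by
    refine ((hφ.analyticAt hUz).deriv.eventually_eq_zero_or_eventually_ne_zero).resolve_left ?_
    intro h
    obtain ⟨r, hr, hball⟩ := Metric.eventually_nhds_iff_ball.1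
      (h.and (hU.eventually_mem hz))
    have hconst : ∀ z ∈ Metric.ball (ψ w) r, φ z = φ (ψ w) := fun z hz =>
      Metric.isOpen_ball.is_const_of_deriv_eq_zero (convex_ball _ _).isPreconnected
        (hφ.mono fun z hz => (hball z hz).2) (fun z hz => (hball z hz).1) hz
        (Metric.mem_ball_self hr)
    have hmem : ψ w + (r / 2 : ℝ) ∈ Metric.ball (ψ w) r := by
      rw [mem_ball_iff_norm, add_sub_cancel_left, norm_real, Real.norm_of_nonneg (by positivity)]
      linarith
    have := congrArg ψ (hconst _ hmem)
    rw [h2 _ (hball _ hmem).2, h2 _ hz, add_eq_left, ofReal_eq_zero] at this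
    linarith
  have ht : Tendsto ψ (𝓝[≠] w) (𝓝[≠] (ψ w)) := by
    refine tendsto_nhdsWithin_iff.2 ⟨hψw.tendsto.mono_left nhdsWithin_le_nhds, ?_⟩
    filter_upwards [self_mem_nhdsWithin, mem_nhdsWithin_of_mem_nhds hUw] with v hv hvU heq
    refine hv ?_
    have := congrArg φ heq
    rwa [h1 v hvU, h1 w hw] at this
  filter_upwards [ht.eventually hne, mem_nhdsWithin_of_mem_nhds hUw] with v hv hvU
  refine (HasDerivAt.of_local_left_inverse (hψ.continuousAt (hU.mem_nhds hvU))
    (hφ.differentiableAt (hU.mem_nhds (hψm hvU))).hasDerivAt hv ?_).differentiableAt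
  filter_upwards [hU.mem_nhds hvU] with y hy using h1 y hy

/-- A holomorphic automorphism of the disc fixing `0` is a rotation. -/
theorem exists_rotation {φ ψ : ℂ → ℂ} (hφ : DifferentiableOn ℂ φ (Metric.ball 0 1))
    (hψ : DifferentiableOn ℂ ψ (Metric.ball 0 1))
    (hφm : MapsTo φ (Metric.ball 0 1) (Metric.ball 0 1))
    (hψm : MapsTo ψ (Metric.ball 0 1) (Metric.ball 0 1)) (hφ0 : φ 0 = 0) (hψ0 : ψ 0 = 0)
    (h2 : ∀ z ∈ Metric.ball (0 : ℂ) 1, ψ (φ z) = z) :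
    ∃ u : ℂ, ‖u‖ = 1 ∧ EqOn φ (fun z => u * z) (Metric.ball 0 1) := by
  -- The Schwarz lemma for `φ` and for its inverse forces equality.
  have hnorm : ∀ z : ℂ, ‖z‖ < 1 → ‖φ z‖ = ‖z‖ := by
    intro z hz
    refine le_antisymm (norm_le_norm_of_mapsTo_ball hφ
      (hφm.mono_right Metric.ball_subset_closedBall) hφ0 hz) ?_
    have h := mem_ball_zero_iff.1 (hφm (mem_ball_zero_iff.2 hz))
    have := norm_le_norm_of_mapsTo_ball hψ (hψm.mono_right Metric.ball_subset_closedBall) hψ0 h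
    rwa [h2 z (mem_ball_zero_iff.2 hz)] at this
  have hhalf : ‖(1 / 2 : ℂ)‖ < 1 := by norm_num
  have hm : MapsTo φ (Metric.ball 0 1) (Metric.closedBall (φ 0) 1) := by
    rw [hφ0]; exact hφm.mono_right Metric.ball_subset_closedBall
  obtain ⟨u, hu, h⟩ := affine_of_mapsTo_ball_of_exists_norm_dslope_eq_div' hφ hm
    ⟨1 / 2, mem_ball_zero_iff.2 hhalf, by
      rw [dslope_of_ne _ (by norm_num), slope_def_field, hφ0, sub_zero, sub_zero, norm_div,
        hnorm _ hhalf, div_one, div_self (by norm_num)]⟩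
  refine ⟨u, by simpa using hu, fun z hz => ?_⟩
  rw [h hz]
  simp only [hφ0, zero_add, sub_zero, smul_eq_mul, mul_comm]

theorem _root_.IsUniversalCover.exists_eq_discMap {f : ℂ → ℂ} (hf : IsUniversalCover f (rectLattice 1)ᶜ)
    (h0 : f 0 = rectCenter 1) :
    ∃ u : ℂ, ‖u‖ = 1 ∧ EqOn f (fun z => discMap (u * z)) (Metric.ball 0 1) := by
  have hg := isUniversalCover_discMap
  have h0' : f 0 = discMap 0 := by rw [h0, discMap_zero]
  obtain ⟨φ, hφ, hφm, hφ0, hφf⟩ := hf.exists_lift hg h0'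
  obtain ⟨ψ, hψ, hψm, hψ0, hψf⟩ := hg.exists_lift hf h0'.symm
  have h1 : EqOn (φ ∘ ψ) id (Metric.ball 0 1) := by
    refine hg.eqOn_id (hφ.comp hψ hψm) (hφm.comp hψm) (by simp [hφ0, hψ0]) fun z hz => ?_
    exact (hφf (hψm hz)).trans (hψf hz)
  have h2 : EqOn (ψ ∘ φ) id (Metric.ball 0 1) := by
    refine hf.eqOn_id (hψ.comp hφ hφm) (hψm.comp hφm) (by simp [hφ0, hψ0]) fun z hz => ?_
    exact (hψf (hφm hz)).trans (hφf hz)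
  -- Locally `φ` is `f` followed by a holomorphic inverse of `discMap`. The derivative of `f` is not
  -- known to be non-zero in advance, so `ψ` is handled as the inverse of `φ` instead.
  have hφd : DifferentiableOn ℂ φ (Metric.ball 0 1) := by
    intro z hz
    have hzn := Metric.isOpen_ball.mem_nhds hz
    have hφz := mem_ball_zero_iff.1 (hφm hz)
    obtain ⟨e, he1, -, he3⟩ := exists_local_inverse Metric.isOpen_ball differentiableOn_discMap
      (hφm hz) (deriv_discMap_ne_zero hφz)
    have hgz : discMap (φ z) = f z := hφf hz
    have hmem : f z ∈ e.target := by rw [← hgz, ← he3]; exact e.map_source he1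
    have hes : e.symm (f z) = φ z := by rw [← hgz, ← he3, e.left_inv he1]
    have hd : HasDerivAt e (deriv discMap (φ z)) (e.symm (f z)) := by
      rw [hes, funext he3]
      exact (hasDerivAt_discMap hφz).differentiableAt.hasDerivAt
    have hd' := e.hasDerivAt_symm hmem (deriv_discMap_ne_zero hφz) hd
    have hc : DifferentiableAt ℂ (fun w => e.symm (f w)) z :=
      hd'.differentiableAt.comp z (hf.differentiableOn.differentiableAt hzn)
    refine (hc.congr_of_eventuallyEq ?_).differentiableWithinAt
    filter_upwards [hzn, (hφ.continuousAt hzn).eventually_mem (e.open_source.mem_nhds he1)]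
      with w hw hws
    have hgw : discMap (φ w) = f w := hφf hw
    rw [← hgw, ← he3, e.left_inv hws]
  have hψd : DifferentiableOn ℂ ψ (Metric.ball 0 1) :=
    differentiableOn_inverse Metric.isOpen_ball hφd hψ hψm h1 h2
  obtain ⟨u, hu, h⟩ := exists_rotation hφd hψd hφm hψm hφ0 hψ0 h2
  refine ⟨u, hu, fun z hz => ?_⟩
  rw [← hφf hz, Function.comp_apply, h hz]

/-! ### The derivative at the centre -/

/-- At the fixed point of `S` one has `θ₂ = θ₄`, so Jacobi's identity becomes `θ₃⁴ = 2θ₄⁴`. -/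
theorem norm_thProd_I : ‖thProd I‖ = √2 * ‖th4 I‖ ^ 4 := by
  have hI : 0 < I.im := by simp
  have h3 : ‖th3 I‖ ^ 2 = √2 * ‖th4 I‖ ^ 2 := by
    have h := jacobi_identity hI
    rw [← th4_I, ← two_mul] at h
    have h' := congrArg norm h
    rw [norm_mul, norm_pow, norm_pow, Complex.norm_ofNat] at h'
    refine (pow_left_inj₀ (by positivity) (by positivity) two_ne_zero).1 ?_
    rw [mul_pow, Real.sq_sqrt (by norm_num), ← pow_mul, ← pow_mul]
    exact h'.symm
  rw [thProd, ← th4_I, norm_mul, norm_mul, norm_pow, h3]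
  ring

theorem norm_deriv_discMap_zero : ‖deriv discMap 0‖ = 2 * √2 * (scC * π) * ‖th4 I‖ ^ 4 := by
  have h : cayInv 0 = I := by simp [cayInv]
  rw [(hasDerivAt_discMap (by simp)).deriv, h, norm_mul, norm_mul, norm_devC, norm_thProd_I,
    sub_zero, one_pow, div_one, norm_mul, norm_I, Complex.norm_ofNat]
  ring

theorem _root_.IsUniversalCover.norm_deriv_zero {f : ℂ → ℂ} (hf : IsUniversalCover f (rectLattice 1)ᶜ)
    (h0 : f 0 = rectCenter 1) : ‖deriv f 0‖ = 2 * √2 * (scC * π) * ‖th4 I‖ ^ 4 := by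
  obtain ⟨u, hu, h⟩ := hf.exists_eq_discMap h0
  have h1 : HasDerivAt (fun z => discMap (u * z)) (deriv discMap 0 * u) 0 := by
    have h2 : HasDerivAt (fun z : ℂ => u * z) u 0 := by simpa using (hasDerivAt_id 0).const_mul u
    have h3 := (hasDerivAt_discMap (z := u * 0) (by simp)).differentiableAt.hasDerivAt
    have h4 := h3.comp (0 : ℂ) h2
    rwa [mul_zero] at h4
  have h2 : f =ᶠ[𝓝 0] fun z => discMap (u * z) :=
    h.eventuallyEq_of_mem (Metric.ball_mem_nhds 0 one_pos)
  rw [h2.deriv_eq, h1.deriv, norm_mul, hu, mul_one, norm_deriv_discMap_zero]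

theorem norm_deriv_kappaSq_I : ‖deriv kappaSq I‖ = π / 2 * ‖th4 I‖ ^ 4 := by
  rw [(hasDerivAt_kappaSq (by simp)).deriv, kappaSq_I, norm_mul, norm_mul, norm_mul,
    norm_pow, norm_I, norm_real, Real.norm_of_nonneg Real.pi_pos.le, norm_div, norm_one,
    Complex.norm_ofNat]
  ring

theorem two_cpow_three_halves : (2 : ℂ) ^ (3 / 2 : ℂ) = ((2 * √2 : ℝ) : ℂ) := by
  have : (2 : ℝ) ^ (3 / 2 : ℝ) = 2 * √2 := by
    rw [show (3 / 2 : ℝ) = 1 + 1 / 2 by norm_num, Real.rpow_add two_pos, Real.rpow_one,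
      ← Real.sqrt_eq_rpow]
  rw [← this, ofReal_cpow two_pos.le]
  norm_num

theorem deriv_scMap_half : deriv scMap (1 / 2) = ((scC * (2 * √2) : ℝ) : ℂ) := by
  rw [hasDerivAt_scMap_half.deriv, two_cpow_three_halves, scConst_eq, ← ofReal_mul]

theorem norm_th4_I_bounds : 0.913578 ≤ ‖th4 I‖ ∧ ‖th4 I‖ ≤ 0.9135805 := by
  obtain ⟨h1, h2⟩ := exp_neg_pi_bounds
  set r := Real.exp (-π) with hr
  have hn : ‖(-(r : ℂ))‖ = r := by
    rw [norm_neg, norm_real, Real.norm_of_nonneg (Real.exp_pos _).le]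
  have key := norm_thetaThree_sub_le (h := -(r : ℂ)) (by rw [hn]; linarith)
  rw [hn] at key
  have he : 2 * (r ^ 9 / (1 - r)) ≤ 0.000000001 := by
    have : r ^ 9 / (1 - r) ≤ 0.0432144 ^ 9 / (1 - 0.0432144) := by gcongr
    norm_num at this ⊢
    linarith
  have ht : th4 I = thetaThree (-(r : ℂ)) := by rw [th4, nome_I]
  have hx : ‖(1 + 2 * (-(r : ℂ)) + 2 * (-(r : ℂ)) ^ 4)‖ = 1 - 2 * r + 2 * r ^ 4 := by
    rw [show (1 + 2 * (-(r : ℂ)) + 2 * (-(r : ℂ)) ^ 4) = ((1 - 2 * r + 2 * r ^ 4 : ℝ) : ℂ) by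
      push_cast; ring, norm_real, Real.norm_of_nonneg]
    have : 0 ≤ r ^ 4 := by positivity
    linarith
  rw [← ht] at key
  have h3 := norm_sub_norm_le (th4 I) (1 + 2 * (-(r : ℂ)) + 2 * (-(r : ℂ)) ^ 4)
  have h4 := norm_sub_norm_le (1 + 2 * (-(r : ℂ)) + 2 * (-(r : ℂ)) ^ 4) (th4 I)
  rw [norm_sub_rev] at h4
  rw [hx] at h3 h4
  have h5 : r ^ 4 ≤ 0.0432144 ^ 4 := by gcongr
  have h6 : 0.0432133 ^ 4 ≤ r ^ 4 := by gcongr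
  norm_num at h5 h6 he ⊢
  constructor <;> linarith

/-- Substituting `C = 2π√2/B` reduces the claim to enclosures of `π`, `|θ₄(i)|` and `B`. -/
theorem abs_sub_lt : |2 * √2 * (scC * π) * ‖th4 I‖ ^ 4 - 7.416| < 0.0005 := by
  obtain ⟨h1, h2⟩ := norm_th4_I_bounds
  obtain ⟨b1, b2⟩ := betaQ_bounds
  have p1 := Real.pi_gt_d6
  have p2 := Real.pi_lt_d6
  have hB := betaQ_pos
  have hs : √2 * √2 = 2 := Real.mul_self_sqrt (by norm_num)
  have e : 2 * √2 * (scC * π) * ‖th4 I‖ ^ 4 = 8 * π ^ 2 * ‖th4 I‖ ^ 4 / betaQ := by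
    rw [scC]
    field_simp
    linear_combination 4 * hs
  rw [e, abs_sub_lt_iff, sub_lt_iff_lt_add, sub_lt_comm, lt_div_iff₀ hB, div_lt_iff₀ hB]
  constructor
  · calc 8 * π ^ 2 * ‖th4 I‖ ^ 4 ≤ 8 * 3.141593 ^ 2 * 0.9135805 ^ 4 := by gcongr
      _ < (0.0005 + 7.416) * 7.41617 := by norm_num
      _ ≤ _ := by gcongr
  · calc (7.416 - 0.0005) * betaQ ≤ (7.416 - 0.0005) * 7.41642 := by gcongr
      _ < 8 * 3.141592 ^ 2 * 0.913578 ^ 4 := by norm_num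
      _ ≤ _ := by gcongr

/-! ### The derivative of `κ²` in terms of the nome -/

/-- The argument of the nome is `π Re τ`, strictly between `-π` and `π`, so the principal quarter
root in `θ₂` is differentiable there. -/
theorem nome_mem_slitPlane {τ : ℂ} (hτ : τ ∈ quadQ) : nome τ ∈ slitPlane := by
  have h := hτ.2.1
  have hp := Real.pi_pos
  rw [nome, show (π * I * τ : ℂ) = ((-(π * τ.im) : ℝ) : ℂ) + ((π * τ.re : ℝ) : ℂ) * I by
    apply Complex.ext <;> simp, exp_add, ← ofReal_exp, mem_slitPlane_iff_arg]
  rw [arg_real_mul _ (Real.exp_pos _), arg_exp_mul_I, toIocMod_eq_self _ |>.2]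
  · refine ⟨?_, mul_ne_zero (ofReal_ne_zero.2 (Real.exp_pos _).ne') (exp_ne_zero _)⟩
    have := (abs_lt.1 h).2
    nlinarith
  · have := abs_lt.1 h
    constructor <;> nlinarith

theorem differentiableAt_thetaTwo {h : ℂ} (hh : ‖h‖ < 1) (hs : h ∈ slitPlane) :
    DifferentiableAt ℂ thetaTwo h := by
  have h1 : DifferentiableAt ℂ (fun h : ℂ => 2 * h ^ (1 / 4 : ℂ)) h :=
    (differentiableAt_id.cpow_const hs).const_mul 2
  exact h1.mul (differentiableAt_thetaP hh)

theorem hasDerivAt_kappaSq_nome {τ : ℂ} (hτ : τ ∈ quadQ) : HasDerivAt kappaSq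
    (4 * thetaTwo (nome τ) ^ 3 * (thetaThree (nome τ) ^ 5)⁻¹ *
      (deriv thetaTwo (nome τ) * thetaThree (nome τ) -
        thetaTwo (nome τ) * deriv thetaThree (nome τ)) * deriv nome τ) τ := by
  have hn := norm_nome_lt_one (im_pos_of_mem_quadQ hτ)
  have hne : thetaThree (nome τ) ≠ 0 := th3_ne_zero (im_pos_of_mem_quadQ hτ)
  have h2 := (differentiableAt_thetaTwo hn (nome_mem_slitPlane hτ)).hasDerivAt
  have h3 := (differentiableAt_thetaThree hn).hasDerivAt
  have h := (((h2.div h3 hne).pow 4).comp τ (hasDerivAt_nome τ).differentiableAt.hasDerivAt)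
  refine h.congr_deriv ?_
  simp only [Pi.div_apply]
  push_cast
  simp only [div_eq_mul_inv, mul_pow]
  field_simp

end KappaCover

theorem mainTheorem2 :
    kappaSq I = 1 / 2 ∧
    HasDerivAt scMap (scConst * (2 : ℂ) ^ (3 / 2 : ℂ)) (1 / 2) ∧
    nome I = Real.exp (-Real.pi) ∧
    (∀ τ ∈ quadQ,
      DifferentiableAt ℂ thetaTwo (nome τ) ∧ DifferentiableAt ℂ thetaThree (nome τ) ∧
      HasDerivAt nome (Real.pi * I * nome τ) τ ∧
      HasDerivAt kappaSq
        (4 * thetaTwo (nome τ) ^ 3 * (thetaThree (nome τ) ^ 5)⁻¹ *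
          (deriv thetaTwo (nome τ) * thetaThree (nome τ) -
            thetaTwo (nome τ) * deriv thetaThree (nome τ)) * deriv nome τ) τ) ∧
    (∃ f : ℂ → ℂ, IsUniversalCover f (rectLattice 1)ᶜ ∧ f 0 = rectCenter 1) ∧
    ∀ f : ℂ → ℂ, IsUniversalCover f (rectLattice 1)ᶜ → f 0 = rectCenter 1 →
      (∃ c : ℂ, ‖c‖ = 1 ∧ ∀ τ ∈ quadQ,
        f (c * ((τ - I) / (τ + I))) = exp (Real.pi * I / 4) * scMap (kappaSq τ)) ∧
      ((‖deriv f 0‖ : ℝ) : ℂ) = 2 * (‖deriv kappaSq I‖ : ℝ) * deriv scMap (1 / 2) ∧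
      |‖deriv f 0‖ - 7.416| < 0.0005 := by
  refine ⟨KappaCover.kappaSq_I, KappaCover.hasDerivAt_scMap_half, KappaCover.nome_I,
    fun τ hτ => ?_, ⟨KappaCover.discMap, KappaCover.isUniversalCover_discMap,
      KappaCover.discMap_zero⟩, fun f hf h0 => ⟨?_, ?_, ?_⟩⟩
  · have hn := KappaCover.norm_nome_lt_one (KappaCover.im_pos_of_mem_quadQ hτ)
    exact ⟨KappaCover.differentiableAt_thetaTwo hn (KappaCover.nome_mem_slitPlane hτ),
      KappaCover.differentiableAt_thetaThree hn, KappaCover.hasDerivAt_nome τ,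
      KappaCover.hasDerivAt_kappaSq_nome hτ⟩
  · obtain ⟨u, hu, h⟩ := hf.exists_eq_discMap h0
    have hu0 : u ≠ 0 := by rintro rfl; simp at hu
    refine ⟨u⁻¹, by rw [norm_inv, hu, inv_one], fun τ hτ => ?_⟩
    rw [← KappaCover.dev_eq_scMap hτ, KappaCover.dev, KappaCover.cay, h]
    · simp only [mul_inv_cancel_left₀ hu0]
    rw [mem_ball_zero_iff, norm_mul, norm_inv, hu, inv_one, one_mul]
    exact KappaCover.norm_cay_lt_one (KappaCover.im_pos_of_mem_quadQ hτ)
  · rw [hf.norm_deriv_zero h0, KappaCover.norm_deriv_kappaSq_I,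
      KappaCover.deriv_scMap_half]
    push_cast
    ring
  · rw [hf.norm_deriv_zero h0]
    exact KappaCover.abs_sub_lt
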